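/- Let $d\in\{1,2,3\}$ and let $\Omega\subset\mathbb R^d$ be a bounded interval ($d=1$), polygonal ($d=2$) or polyhedral ($d=3$) domain, i.e. a bounded connected open set with $\operatorname{int}\overline\Omega=\Omega$ whose closure is a finite union of simplices. Write $\|\cdot\|$ and $\langle\cdot,\cdot\rangle$ for the $L^2(\Omega)$-norm and inner product, and $$\|w\|_{H^{-2}(\Omega)}=\sup_{v\in H^2(\Omega)\cap H^1_0(\Omega)}\frac{\langle w,v\rangle}{\|v\|_{H^2(\Omega)}} .$$ Let $(\mathcal T_j)_{j\ge 0}$ be finite conforming meshes of $\overline\Omega$, all simplicial or all consisting of axis-parallel boxes, with mesh size $h_j=\max_{T\in\mathcal T_j}\operatorname{diam}T$, such that $\mathcal T_{j+1}$ refines $\mathcal T_j$, such that for some constant $\rho>0$ each $T\in\mathcal T_j$ contains a ball of diameter $\rho h_j$ (quasi-uniformity), and such that $\underline f\le h_j/h_{j-1}\le\overline f$ for all $j\ge1$, with constants $0<\underline f\le\overline f<1$. Let $\mathcal V_j$ be the space of continuous functions on $\overline\Omega$ that vanish on $\partial\Omega$ and are, on each element, polynomials of degree at most one (simplicial case) or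 multilinear, that is in $\mathcal Q_1$ (box case). For each vertex $P$ of $\mathcal T_j$ lying in $\Omega$ (interior node) let $\varphi^{(j)}_P\in\mathcal V_j$ be the nodal basis function. Fix $j\ge 1$ and an arbitrary set $\mathcal I^{(j)}$ of interior nodes of $\mathcal T_j$ (the inactive nodes), and put $$\mathcal V_j^{\rm in}=\operatorname{span}\{\varphi^{(j)}_P: P\in\mathcal I^{(j)}\},\qquad \Omega_j^{\rm in}=\bigcup_{P\in\mathcal I^{(j)}}\operatorname{supp}\varphi_P^{(j)},$$ $$\mathcal I^{(j-1)}=\{P \text{ interior node of }\mathcal T_{j-1}:\ \operatorname{supp}\varphi^{(j-1)}_P\subseteq\Omega_j^{\rm in}\},\qquad \mathcal V_{j-1}^{\rm in}=\operatorname{span}\{\varphi^{(j-1)}_P: P\in\mathcal I^{(j-1)}\}.$$ Let $\operatorname{Int}_{\rm n}\Omega_j^{\rm in}$ be the union of all $T\in\mathcal T_{j-1}$ with $T\subseteq\Omega_j^{\rm in}$ all of whose vertices lie in $\mathcal I^{(j-1)}$ or on $\partial\Omega$, and let $\mu_j^{\rm in}$ be the Lebesgue measure of the numerical boundary $\partial_{\rm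 n}\Omega_j^{\rm in}=\Omega_j^{\rm in}\setminus\operatorname{Int}_{\rm n}\Omega_j^{\rm in}$. Let $\pi_{j-1}^{\rm in}$ denote the $L^2(\Omega)$-orthogonal projection onto $\mathcal V_{j-1}^{\rm in}$. Then $\pi_{j-1}^{\rm in}u$ exists and is unique for every $u\in\mathcal V_j^{\rm in}$, and $$\|(I-\pi_{j-1}^{\rm in})u\|_{H^{-2}(\Omega)}\le C\Bigl(h_j^2+\sqrt{\mu_j^{\rm in}}\Bigr)\|u\|\qquad\text{for all }u\in\mathcal V_j^{\rm in},$$ where the constant $C>0$ depends only on $\Omega$, on the base mesh $\mathcal T_0$ and on the fixed mesh-independent constants $\rho,\underline f,\overline f$; it is independent of $j$, of the other meshes and of the inactive set $\mathcal I^{(j)}$. -/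

import Mathlib

open MeasureTheory Set
open scoped ENNReal ContDiff

noncomputable section

namespace TwoGrid

/-- Points of `ℝ^d`, with the Euclidean distance and Lebesgue measure `volume`. -/
abbrev Pt (d : ℕ) := EuclideanSpace ℝ (Fin d)

variable {d : ℕ}

/-! ### Sobolev spaces on an open set -/

/-- The `L²(Ω)`-norm. -/
def l2Norm (Ω : Set (Pt d)) (f : Pt d → ℝ) : ℝ :=
  (eLpNorm f 2 (volume.restrict Ω)).toReal

/-- The `L²(Ω)`-inner product. -/
def l2Inner (Ω : Set (Pt d)) (f g : Pt d → ℝ) : ℝ :=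
  ∫ x in Ω, f x * g x

/-- Test functions: `C_c^∞(Ω)`. -/
def IsTestFunction (Ω : Set (Pt d)) (φ : Pt d → ℝ) : Prop :=
  ContDiff ℝ ∞ φ ∧ HasCompactSupport φ ∧ tsupport φ ⊆ Ω

/-- `g` is the weak partial derivative `∂ᵢ v` in `Ω` and belongs to `L²(Ω)`. -/
def HasWeakPartial (Ω : Set (Pt d)) (i : Fin d) (v g : Pt d → ℝ) : Prop :=
  MemLp g 2 (volume.restrict Ω) ∧
    ∀ φ : Pt d → ℝ, IsTestFunction Ω φ →
      l2Inner Ω v (fun x => fderiv ℝ φ x (EuclideanSpace.single i 1)) = -l2Inner Ω g φ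

open Classical in
/-- The weak partial derivative `∂ᵢ v` (unique up to a null set of `Ω`) when it exists in
`L²(Ω)`; only used when it does. -/
def weakPartial (Ω : Set (Pt d)) (i : Fin d) (v : Pt d → ℝ) : Pt d → ℝ :=
  if h : ∃ g, HasWeakPartial Ω i v g then h.choose else 0

/-- `v ∈ H¹(Ω)`. -/
def MemH1 (Ω : Set (Pt d)) (v : Pt d → ℝ) : Prop :=
  MemLp v 2 (volume.restrict Ω) ∧ ∀ i, ∃ g, HasWeakPartial Ω i v g

/-- `v ∈ H²(Ω)`. -/
def MemH2 (Ω : Set (Pt d)) (v : Pt d → ℝ) : Prop :=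
  MemH1 Ω v ∧ ∀ i, MemH1 Ω (weakPartial Ω i v)

/-- The norm of `H¹(Ω)`. -/
def h1Norm (Ω : Set (Pt d)) (v : Pt d → ℝ) : ℝ :=
  √(l2Norm Ω v ^ 2 + ∑ i, l2Norm Ω (weakPartial Ω i v) ^ 2)

/-- The norm of `H²(Ω)`: the root of the sum of `‖D^α v‖²` over all multi-indices `|α| ≤ 2`. -/
def h2Norm (Ω : Set (Pt d)) (v : Pt d → ℝ) : ℝ :=
  √(l2Norm Ω v ^ 2 + ∑ i, l2Norm Ω (weakPartial Ω i v) ^ 2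
    + ∑ i, ∑ k ∈ Finset.univ.filter (i ≤ ·), l2Norm Ω (weakPartial Ω k (weakPartial Ω i v)) ^ 2)

/-- `v ∈ H¹₀(Ω)`, the closure of `C_c^∞(Ω)` in `H¹(Ω)`. -/
def MemH10 (Ω : Set (Pt d)) (v : Pt d → ℝ) : Prop :=
  MemH1 Ω v ∧ ∀ ε : ℝ, 0 < ε → ∃ φ, IsTestFunction Ω φ ∧ h1Norm Ω (fun x => v x - φ x) < ε

/-- The norm of the dual of `H²(Ω) ∩ H¹₀(Ω)` with respect to the `L²`-inner product,
`‖u‖_{H⁻²(Ω)} = sup_v (u, v) / ‖v‖_{H²(Ω)}`, as a number of `[0, ∞]`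
(the function `v = 0` contributes the value `0`). -/
def hNegTwoNorm (Ω : Set (Pt d)) (u : Pt d → ℝ) : ℝ≥0∞ :=
  ⨆ (v : Pt d → ℝ) (_ : MemH2 Ω v ∧ MemH10 Ω v),
    ENNReal.ofReal (l2Inner Ω u v / h2Norm Ω v)

/-! ### Domains and meshes -/

/-- `s` is the set of the `d + 1` vertices of a nondegenerate `d`-simplex. -/
def IsSimplexVertexSet (s : Finset (Pt d)) : Prop :=
  AffineIndependent ℝ (fun p : s => (p : Pt d)) ∧ s.card = d + 1

/-- `s` is the set of the `2 ^ d` corners of a nondegenerate axis-parallel box. -/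
def IsBoxVertexSet (s : Finset (Pt d)) : Prop :=
  ∃ a b : Pt d, (∀ i, a i < b i) ∧ (s : Set (Pt d)) = {x | ∀ i, x i = a i ∨ x i = b i}

/-- The closed element with vertex set `s`. -/
def cell (s : Finset (Pt d)) : Set (Pt d) := convexHull ℝ (s : Set (Pt d))

/-- A bounded interval (`d = 1`), polygonal (`d = 2`) or polyhedral (`d = 3`) domain: a bounded
connected open set whose closure is a finite union of simplices and which lies on one side of its
boundary, in the sense that it is the interior of its closure (no slits, no punctures). -/
structure IsPolyhedralDomain (Ω : Set (Pt d)) : Prop where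
  isOpen : IsOpen Ω
  isConnected : IsConnected Ω
  isBounded : Bornology.IsBounded Ω
  interior_closure : interior (closure Ω) = Ω
  polyhedral : ∃ S : Finset (Finset (Pt d)),
    (∀ s ∈ S, IsSimplexVertexSet s) ∧ closure Ω = ⋃ s ∈ S, cell s

/-- The two kinds of meshes. -/
inductive MeshKind
  | simplicial
  | rectangular

/-- Admissible vertex sets of elements. -/
def MeshKind.IsVertexSet : MeshKind → Finset (Pt d) → Prop
  | .simplicial, s => IsSimplexVertexSet s
  | .rectangular, s => IsBoxVertexSet s

/-- Local functions on the elements: polynomials of degree at most one on simplices, and on boxes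
the space `Q₁` of sums of products of one-variable polynomials of degree at most one. -/
def MeshKind.localSpace : MeshKind → Submodule ℝ (Pt d → ℝ)
  | .simplicial => Submodule.span ℝ
      {p | ∃ (c : ℝ) (a : Fin d → ℝ), p = fun x => c + ∑ k, a k * x k}
  | .rectangular => Submodule.span ℝ
      {p | ∃ a b : Fin d → ℝ, p = fun x => ∏ k, (a k + b k * x k)}

/-- A (conforming, finite) mesh of `Ω`. An element is given by the finite set of its vertices; two
elements meet exactly in the common face spanned by their common vertices. -/
structure Mesh (Ω : Set (Pt d)) (kind : MeshKind) where
  elems : Finset (Finset (Pt d))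
  isVertexSet : ∀ s ∈ elems, kind.IsVertexSet s
  covers : ⋃ s ∈ elems, cell s = closure Ω
  conforming : ∀ s ∈ elems, ∀ t ∈ elems,
    cell s ∩ cell t = convexHull ℝ ((s : Set (Pt d)) ∩ (t : Set (Pt d)))

namespace Mesh

variable {Ω : Set (Pt d)} {kind : MeshKind}

/-- The mesh size `h`, the maximal diameter of the elements. -/
def size (T : Mesh Ω kind) : ℝ := ⨆ s : T.elems, Metric.diam (cell (s : Finset (Pt d)))

/-- The nodes of the mesh that lie in the interior of the domain. -/
def interiorNodes (T : Mesh Ω kind) : Set (Pt d) :=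
  {P | P ∈ Ω ∧ ∃ s ∈ T.elems, P ∈ s}

/-- The finite element space `V`: continuous functions on the closure of `Ω` that vanish on the
boundary and belong to the local space on every element. Its members are extended by zero to the
whole space. -/
def feSpace (T : Mesh Ω kind) : Submodule ℝ (Pt d → ℝ) where
  carrier := {u | Continuous u ∧ (∀ x, x ∉ Ω → u x = 0) ∧
    ∀ s ∈ T.elems, ∃ p ∈ kind.localSpace, EqOn u p (cell s)}
  zero_mem' := ⟨continuous_const, fun _ _ => rfl, fun _ _ => ⟨0, Submodule.zero_mem _, fun _ _ => rfl⟩⟩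
  add_mem' := by
    rintro u v ⟨hu, hu0, hup⟩ ⟨hv, hv0, hvp⟩
    refine ⟨hu.add hv, fun x hx => by simp [hu0 x hx, hv0 x hx], fun s hs => ?_⟩
    obtain ⟨p, hp, hpu⟩ := hup s hs
    obtain ⟨q, hq, hqv⟩ := hvp s hs
    exact ⟨p + q, Submodule.add_mem _ hp hq, fun x hx => by simp [hpu hx, hqv hx]⟩
  smul_mem' := by
    rintro c u ⟨hu, hu0, hup⟩
    refine ⟨hu.const_smul c, fun x hx => by simp [hu0 x hx], fun s hs => ?_⟩
    obtain ⟨p, hp, hpu⟩ := hup s hs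
    exact ⟨c • p, Submodule.smul_mem _ c hp, fun x hx => by simp [hpu hx]⟩

/-- `φ` is the standard nodal basis function of the interior node `P`: the member of the finite
element space that is `1` at `P` and `0` at all other interior nodes. -/
def IsNodalBasisFunction (T : Mesh Ω kind) (P : Pt d) (φ : Pt d → ℝ) : Prop :=
  φ ∈ T.feSpace ∧ P ∈ T.interiorNodes ∧ φ P = 1 ∧ ∀ Q ∈ T.interiorNodes, Q ≠ P → φ Q = 0

/-- The space spanned by the nodal basis functions of the nodes in `I`. -/
def inactiveSpace (T : Mesh Ω kind) (I : Set (Pt d)) : Submodule ℝ (Pt d → ℝ) :=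
  Submodule.span ℝ {φ | ∃ P ∈ I, T.IsNodalBasisFunction P φ}

/-- The union of the supports of the nodal basis functions of the nodes in `I`. -/
def inactiveDomain (T : Mesh Ω kind) (I : Set (Pt d)) : Set (Pt d) :=
  ⋃ (φ : Pt d → ℝ) (_ : ∃ P ∈ I, T.IsNodalBasisFunction P φ), tsupport φ

/-- The coarse inactive nodes: the interior nodes of the coarse mesh `Tc` whose nodal basis
functions are supported in the inactive domain of the set `I` of inactive nodes of the fine mesh. -/
def coarseInactive (Tc Tf : Mesh Ω kind) (I : Set (Pt d)) : Set (Pt d) :=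
  {P | ∃ φ, Tc.IsNodalBasisFunction P φ ∧ tsupport φ ⊆ Tf.inactiveDomain I}

/-- The numerical interior of the fine inactive domain: the union of the coarse elements that are
contained in the fine inactive domain and all of whose vertices are coarse inactive nodes or lie
on the boundary of `Ω`. -/
def numericalInterior (Tc Tf : Mesh Ω kind) (I : Set (Pt d)) : Set (Pt d) :=
  ⋃ (s : Finset (Pt d)) (_ : s ∈ Tc.elems ∧ cell s ⊆ Tf.inactiveDomain I ∧
    ∀ P ∈ s, P ∈ coarseInactive Tc Tf I ∨ P ∈ frontier Ω), cell s

/-- The numerical boundary of the fine inactive domain. -/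
def numericalBoundary (Tc Tf : Mesh Ω kind) (I : Set (Pt d)) : Set (Pt d) :=
  Tf.inactiveDomain I \ numericalInterior Tc Tf I

/-- A sequence of nested meshes that is quasi-uniform with parameter `ρ` (every element of the
`j`-th mesh contains a ball of diameter `ρ h_j`) and whose mesh sizes have consecutive ratios
`h_j / h_{j-1}` between `fl` and `fu`. -/
structure IsHierarchy (T : ℕ → Mesh Ω kind) (ρ fl fu : ℝ) : Prop where
  refinement : ∀ j, ∀ t ∈ (T (j + 1)).elems, ∃ s ∈ (T j).elems, cell t ⊆ cell s
  quasiUniform : ∀ j, ∀ s ∈ (T j).elems,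
    ∃ x, Metric.closedBall x (ρ * (T j).size / 2) ⊆ cell s
  ratio_lower : ∀ j, fl ≤ (T (j + 1)).size / (T j).size
  ratio_upper : ∀ j, (T (j + 1)).size / (T j).size ≤ fu

end Mesh

/-- `p` is the `L²(Ω)`-orthogonal projection of `u` onto the space `V`. -/
def IsL2Projection (Ω : Set (Pt d)) (V : Submodule ℝ (Pt d → ℝ)) (u p : Pt d → ℝ) : Prop :=
  p ∈ V ∧ ∀ w ∈ V, l2Inner Ω (fun x => u x - p x) w = 0

end TwoGrid

end

open MeasureTheory Set
open scoped ENNReal ContDiff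

noncomputable section

namespace TwoGrid

variable {d : ℕ}

open Filter Topology

section Mollification

open Convolution ContinuousLinearMap

/-! ### Mollification -/

/-! The proof is a duality argument. Let `r = u - p` be the projection error and `v` a competitor in
`H² ∩ H¹₀`. Orthogonality gives `⟨r, v⟩ = ⟨r, v - w⟩` for every `w` in the coarse inactive space.
Moreover `r` vanishes off the fine inactive domain `D`, because coarse inactive basis functions are
supported there, and `‖r‖ ≤ ‖u‖`. So everything rests on one good `w`, with `v - w` estimated in
`L²(D)`.

Take for `w` the nodal interpolant of `v` at the coarse inactive nodes, with value zero at all other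
vertices. On an element of the numerical interior this is the full nodal interpolant of `v`, and the
error is of order `h²` times the local second derivatives (`Mesh.abs_rep_sub_le`). On the numerical
boundary only `|v - w| ≤ 2 sup |v|` is available; with the embedding of `H²` into bounded functions
this costs the square root of the measure (`Mesh.l2Norm_indicator_rep_sub_le`). The embedding
constant is taken on the base mesh, and the coarse mesh size is at most `h_j / fl`.

Nodal values need a continuous representative `rep`. It is the locally uniform limit of
mollifications of the zero extension of `v`; convergence, embedding and interpolation all come from
one averaged Taylor estimate. Expand about `x`, evaluate at `y`, and average over `x` in a subset of
a convex body. The remainder carries a weight `t`, while contracting towards `y` and Cauchy-Schwarz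
cost `t ^ (-d / 2)`; for `d ≤ 3` the product is integrable at `0`.

The remaining point is a vertex `P` on the boundary, where `w = 0` but `rep` is not defined by
continuity. No Lipschitz property of the boundary is available, so `exists_abs_rep_le_near_boundary`
scales towards `P`. If `|rep| > δ` inside the element near `P`, shrink a ball of the element and a
ball of the exterior by the factor `l`. Translating the zero extension of `v` from one ball to the
other gives `δ l ^ d ≲ l ∫ |∇v|` over a ball of radius of order `l`. Since `∇v` is itself in `H¹`,
that integral is `O(l ^ (d - 3 / 4))`, which contradicts `l → 0`. -/

lemma sq_lintegral_mul_le {α : Type*} [MeasurableSpace α] {μ : Measure α} {w g : α → ℝ≥0∞}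
    (hw : AEMeasurable w μ) (hg : AEMeasurable g μ) :
    (∫⁻ a, w a * g a ∂μ) ^ 2 ≤ (∫⁻ a, w a ∂μ) * ∫⁻ a, w a * g a ^ 2 ∂μ := by
  have h := ENNReal.lintegral_mul_le_Lp_mul_Lq μ Real.HolderConjugate.two_two
    (f := fun a => w a ^ (1 / 2 : ℝ)) (g := fun a => w a ^ (1 / 2 : ℝ) * g a)
    (hw.pow_const _) ((hw.pow_const _).mul hg)
  have e : ∀ x : ℝ≥0∞, x ^ (1 / 2 : ℝ) * x ^ (1 / 2 : ℝ) = x := fun x => by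
    rw [← ENNReal.rpow_add_of_nonneg _ _ (by norm_num) (by norm_num)]; norm_num
  have e1 : ∀ x : ℝ≥0∞, (x ^ (1 / 2 : ℝ)) ^ (2 : ℝ) = x := fun x => by
    rw [← ENNReal.rpow_mul]; norm_num
  simp only [Pi.mul_apply, ← mul_assoc, e, e1, ENNReal.mul_rpow_of_nonneg _ _ zero_le_two] at h
  calc _ ≤ _ := pow_le_pow_left' h 2
    _ = _ := by
      rw [mul_pow, ← ENNReal.rpow_natCast, ← ENNReal.rpow_mul, ← ENNReal.rpow_natCast,
        ← ENNReal.rpow_mul]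
      norm_num

lemma eLpNorm_two_sq {α : Type*} [MeasurableSpace α] {μ : Measure α} (f : α → ℝ) :
    eLpNorm f 2 μ ^ 2 = ∫⁻ a, ‖f a‖ₑ ^ 2 ∂μ := by
  have := eLpNorm_nnreal_pow_eq_lintegral (f := f) (μ := μ) (p := 2) two_ne_zero
  norm_num at this
  exact_mod_cast this

/-- The bump of radius about `1 / (n + 1)` used for mollification. -/
def mollBump (n : ℕ) : ContDiffBump (0 : Pt d) :=
  ⟨1 / (2 * ((n : ℝ) + 1)), 1 / ((n : ℝ) + 1), by positivity, by
    gcongr; nlinarith [(n.cast_nonneg : (0 : ℝ) ≤ n)]⟩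

/-- Mollification at scale `1 / (n + 1)`. -/
def moll (n : ℕ) (f : Pt d → ℝ) : Pt d → ℝ :=
  (mollBump n).normed volume ⋆[lsmul ℝ ℝ, volume] f

lemma moll_apply (n : ℕ) (f : Pt d → ℝ) (x : Pt d) :
    moll n f x = ∫ t, (mollBump n).normed volume t * f (x - t) := rfl

lemma moll_apply' (n : ℕ) (f : Pt d → ℝ) (x : Pt d) :
    moll n f x = ∫ t, (mollBump n).normed volume (x - t) * f t := by
  rw [moll, convolution_eq_swap]; rfl

lemma tendsto_mollBump_rOut :
    Tendsto (fun n => (mollBump n : ContDiffBump (0 : Pt d)).rOut) atTop (𝓝 0) :=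
  tendsto_one_div_add_atTop_nhds_zero_nat

lemma moll_contDiff (n : ℕ) {f : Pt d → ℝ} (hf : LocallyIntegrable f volume) :
    ContDiff ℝ ∞ (moll n f) :=
  (ContDiffBump.hasCompactSupport_normed _).contDiff_convolution_left _
    (ContDiffBump.contDiff_normed _) hf

lemma moll_integrable (n : ℕ) {f : Pt d → ℝ} (hf : LocallyIntegrable f volume) (x : Pt d) :
    Integrable (fun t => (mollBump n).normed volume t * f (x - t)) volume :=
  (ContDiffBump.hasCompactSupport_normed (mollBump n)).convolutionExists_left (lsmul ℝ ℝ)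
    (ContDiffBump.continuous_normed _) hf x

lemma moll_sub (n : ℕ) {f g : Pt d → ℝ} (hf : LocallyIntegrable f volume)
    (hg : LocallyIntegrable g volume) : moll n (f - g) = moll n f - moll n g := by
  ext x
  simp only [moll_apply, Pi.sub_apply, mul_sub]
  exact integral_sub (moll_integrable n hf x) (moll_integrable n hg x)

lemma lintegral_mollBump (n : ℕ) :
    ∫⁻ t : Pt d, ‖(mollBump n).normed volume t‖ₑ = 1 := by
  have h := ContDiffBump.integral_normed (mollBump n : ContDiffBump (0 : Pt d)) (μ := volume)
  have h2 := ofReal_integral_eq_lintegral_ofReal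
    (ContDiffBump.integrable_normed (mollBump n : ContDiffBump (0 : Pt d)) (μ := volume))
    (Eventually.of_forall (ContDiffBump.nonneg_normed _))
  rw [h] at h2
  rw [← ENNReal.ofReal_one, h2]
  refine lintegral_congr fun t => ?_
  exact Real.enorm_of_nonneg (ContDiffBump.nonneg_normed _ _)

/-- The kernel has mass one, so Cauchy-Schwarz moves the square inside the average; Fubini and
translation invariance then remove the kernel. -/
lemma eLpNorm_moll_le (n : ℕ) {f : Pt d → ℝ} (hf : AEStronglyMeasurable f volume) :
    eLpNorm (moll n f) 2 volume ≤ eLpNorm f 2 volume := by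
  rw [← ENNReal.pow_le_pow_left_iff two_ne_zero, eLpNorm_two_sq, eLpNorm_two_sq]
  set w : Pt d → ℝ≥0∞ := fun t => ‖(mollBump n).normed volume t‖ₑ with hw
  have hwm : Measurable w := (ContDiffBump.continuous_normed _).measurable.enorm
  have hF : AEMeasurable (fun z : Pt d × Pt d => ‖f (z.1 - z.2)‖ₑ) (volume.prod volume) :=
    (hf.comp_quasiMeasurePreserving
      (quasiMeasurePreserving_sub (volume : Measure (Pt d)) volume)).enorm
  have hFx : ∀ x : Pt d, AEMeasurable (fun t => ‖f (x - t)‖ₑ) volume := fun x =>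
    (hf.comp_quasiMeasurePreserving (quasiMeasurePreserving_sub_left volume x)).enorm
  calc ∫⁻ x, ‖moll n f x‖ₑ ^ 2
      ≤ ∫⁻ x, ∫⁻ t, w t * ‖f (x - t)‖ₑ ^ 2 := by
        refine lintegral_mono fun x => ?_
        calc ‖moll n f x‖ₑ ^ 2 ≤ (∫⁻ t, w t * ‖f (x - t)‖ₑ) ^ 2 := by
              gcongr
              rw [moll_apply]
              refine (enorm_integral_le_lintegral_enorm _).trans_eq ?_
              simp [hw, enorm_mul]
          _ ≤ (∫⁻ t, w t) * ∫⁻ t, w t * ‖f (x - t)‖ₑ ^ 2 :=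
              sq_lintegral_mul_le hwm.aemeasurable (hFx x)
          _ = _ := by rw [lintegral_mollBump, one_mul]
    _ = ∫⁻ t, ∫⁻ x, w t * ‖f (x - t)‖ₑ ^ 2 := by
        refine lintegral_lintegral_swap ?_
        exact (hwm.comp measurable_snd).aemeasurable.mul (hF.pow_const 2)
    _ = ∫⁻ t, w t * ∫⁻ x, ‖f x‖ₑ ^ 2 := by
        refine lintegral_congr fun t => ?_
        rw [lintegral_const_mul' _ _ (by simp [hw]),
          lintegral_sub_right_eq_self (fun x => ‖f x‖ₑ ^ 2) t]
    _ = _ := by rw [lintegral_mul_const _ hwm, lintegral_mollBump, one_mul]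

/-- All mollification radii are at most `1`, so the differences live in one fixed ball, where
uniform convergence implies `L²` convergence. -/
lemma tendsto_eLpNorm_moll_sub_of_continuous {g : Pt d → ℝ} (hg : Continuous g)
    (hgc : HasCompactSupport g) :
    Tendsto (fun n => eLpNorm (moll n g - g) 2 volume) atTop (𝓝 0) := by
  obtain ⟨R, hR⟩ := hgc.isBounded.subset_closedBall 0
  set B : Set (Pt d) := Metric.closedBall 0 (R + 1)
  have hB : volume B ≠ ⊤ := measure_closedBall_lt_top.ne
  have hu := hgc.uniformContinuous_of_continuous hg
  have hout : ∀ n, ∀ x ∉ B, moll n g x - g x = 0 := by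
    intro n x hx
    have hx' : R + 1 < ‖x‖ := by simpa [B] using hx
    have g0 : ∀ y, R < ‖y‖ → g y = 0 := fun y hy =>
      image_eq_zero_of_notMem_tsupport fun hy' => by
        have := hR hy'; simp at this; linarith
    rw [g0 x (by linarith), sub_zero, moll_apply]
    refine integral_eq_zero_of_ae (Eventually.of_forall fun t => ?_)
    by_cases ht : ‖t‖ < 1 / ((n : ℝ) + 1)
    · have : (1 : ℝ) / ((n : ℝ) + 1) ≤ 1 := by
        rw [div_le_one (by positivity)]; linarith [(n.cast_nonneg : (0 : ℝ) ≤ n)]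
      have := norm_sub_norm_le x t
      simp [g0 (x - t) (by linarith)]
    · have : t ∉ Function.support ((mollBump n).normed volume) := by
        rw [ContDiffBump.support_normed_eq]
        simpa [mollBump] using ht
      simp [Function.notMem_support.1 this]
  rw [ENNReal.tendsto_nhds_zero]
  intro ε hε
  obtain ⟨δ, hδ, hδε⟩ : ∃ δ : ℝ, 0 < δ ∧ ENNReal.ofReal δ * volume B ^ (1 / 2 : ℝ) ≤ ε := by
    rcases eq_or_ne ε ⊤ with rfl | he
    · exact ⟨1, one_pos, le_top⟩
    set m := volume B ^ (1 / 2 : ℝ)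
    have hm : m ≠ ⊤ := ENNReal.rpow_ne_top_of_nonneg (by norm_num) hB
    refine ⟨ε.toReal / (m.toReal + 1), div_pos (ENNReal.toReal_pos hε.ne' he) (by positivity), ?_⟩
    rw [← ENNReal.ofReal_toReal hm, ← ENNReal.ofReal_mul (by positivity)]
    refine ENNReal.ofReal_le_of_le_toReal ?_
    rw [ENNReal.ofReal_toReal hm, div_mul_eq_mul_div, div_le_iff₀ (by positivity)]
    nlinarith [ENNReal.toReal_nonneg (a := ε)]
  obtain ⟨η, hη, hηg⟩ := Metric.uniformContinuous_iff.1 hu δ hδ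
  filter_upwards [tendsto_mollBump_rOut (d := d) |>.eventually (gt_mem_nhds hη)] with n hn
  have hsup : ∀ x, ‖moll n g x - g x‖ ≤ δ := fun x => by
    rw [← dist_eq_norm]
    refine ContDiffBump.dist_normed_convolution_le hg.aestronglyMeasurable ?_
    intro y hy
    exact (hηg ((Metric.mem_ball.1 hy).trans hn)).le
  calc eLpNorm (moll n g - g) 2 volume
      = eLpNorm (moll n g - g) 2 (volume.restrict B) := by
        rw [← eLpNorm_indicator_eq_eLpNorm_restrict Metric.isClosed_closedBall.measurableSet]
        congr 1
        ext x
        by_cases hx : x ∈ B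
        · rw [indicator_of_mem hx]
        · rw [indicator_of_notMem hx, Pi.sub_apply, hout n x hx]
    _ ≤ _ := eLpNorm_le_of_ae_bound (Eventually.of_forall hsup)
    _ ≤ ε := by
        rw [mul_comm] 
        simpa using hδε

lemma tendsto_eLpNorm_moll_sub {f : Pt d → ℝ} (hf : MemLp f 2 volume) :
    Tendsto (fun n => eLpNorm (moll n f - f) 2 volume) atTop (𝓝 0) := by
  rw [ENNReal.tendsto_nhds_zero]
  intro ε hε
  obtain ⟨g, hgc, hfg, hg, hgL⟩ := hf.exists_hasCompactSupport_eLpNorm_sub_le (by norm_num)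
    (ε := ε / 3) (by simpa using hε.ne')
  filter_upwards [ENNReal.tendsto_nhds_zero.1 (tendsto_eLpNorm_moll_sub_of_continuous hg hgc)
    (ε / 3) (ENNReal.div_pos hε.ne' (by norm_num))] with n hn
  have hfl := hf.locallyIntegrable (by norm_num)
  have hgl := hgL.locallyIntegrable (by norm_num)
  have e : moll n f - f = (moll n (f - g) + (moll n g - g)) - (f - g) := by
    rw [moll_sub n hfl hgl]; abel
  have hm := (moll_contDiff n (hfl.sub hgl)).continuous.aestronglyMeasurable (μ := volume)
  have hm2 := ((moll_contDiff n hgl).continuous.sub hg).aestronglyMeasurable (μ := volume)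
  have hm3 := (hf.sub hgL).aestronglyMeasurable
  calc _ ≤ eLpNorm (moll n (f - g) + (moll n g - g)) 2 volume + eLpNorm (f - g) 2 volume := by
        rw [e]; exact eLpNorm_sub_le (hm.add hm2) hm3 (by norm_num)
    _ ≤ eLpNorm (moll n (f - g)) 2 volume + eLpNorm (moll n g - g) 2 volume
          + eLpNorm (f - g) 2 volume := by
        gcongr; exact eLpNorm_add_le hm hm2 (by norm_num)
    _ ≤ ε / 3 + ε / 3 + ε / 3 := by
        gcongr
        exact (eLpNorm_moll_le n hm3).trans hfg
    _ = ε := ENNReal.add_thirds ε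

lemma ae_tendsto_moll {f : Pt d → ℝ} (hf : LocallyIntegrable f volume) :
    ∀ᵐ x, Tendsto (fun n => moll n f x) atTop (𝓝 (f x)) := by
  -- The outer radius is always twice the inner one; such a fixed ratio is what Lebesgue
  -- differentiation with these kernels requires.
  refine ContDiffBump.ae_convolution_tendsto_right_of_locallyIntegrable (K := 2)
    tendsto_mollBump_rOut (Eventually.of_forall fun n => le_of_eq ?_) hf
  simp only [mollBump]
  field_simp

/-- Mollification commutes with weak differentiation away from the boundary. -/
lemma hasFDerivAt_moll {Ω : Set (Pt d)} (hΩ : MeasurableSet Ω) {v : Pt d → ℝ}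
    (hv : MemLp v 2 (volume.restrict Ω)) {g : Fin d → Pt d → ℝ}
    (hg : ∀ i, HasWeakPartial Ω i v (g i)) {n : ℕ} {x : Pt d}
    (hx : Metric.closedBall x (1 / ((n : ℝ) + 1)) ⊆ Ω) :
    ∃ L : Pt d →L[ℝ] ℝ, HasFDerivAt (moll n (Ω.indicator v)) L x ∧
      ∀ i, L (EuclideanSpace.single i 1) = moll n (Ω.indicator (g i)) x := by
  have hvL : LocallyIntegrable (Ω.indicator v) volume :=
    ((memLp_indicator_iff_restrict hΩ).2 hv).locallyIntegrable (by norm_num)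
  -- The factors are swapped so that the derivative falls on the smooth kernel.
  have hmoll : moll n (Ω.indicator v)
      = Ω.indicator v ⋆[lsmul ℝ ℝ, volume] ((mollBump n).normed volume) := by
    ext y
    rw [moll_apply']
    simp only [convolution, lsmul_apply, smul_eq_mul, mul_comm]
  have hd := HasCompactSupport.hasFDerivAt_convolution_right (lsmul ℝ ℝ)
    (ContDiffBump.hasCompactSupport_normed (mollBump n) (μ := volume)) hvL
    (ContDiffBump.contDiff_normed (mollBump n)) x
  rw [← hmoll] at hd
  refine ⟨_, hd, fun i => ?_⟩
  set ρ : Pt d → ℝ := (mollBump n).normed volume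
  have hρ : ContDiff ℝ ∞ ρ := ContDiffBump.contDiff_normed _
  have hρc : HasCompactSupport ρ := ContDiffBump.hasCompactSupport_normed _
  -- The reflected kernel centred at `x` lives in the closed ball of `hx`, so it may be tested
  -- against the weak derivative.
  have hφ : IsTestFunction Ω (fun y => ρ (x - y)) := by
    refine ⟨hρ.comp (contDiff_const.sub contDiff_id),
      hρc.comp_homeomorph (Homeomorph.subLeft x), ?_⟩
    refine (closure_minimal ?_ Metric.isClosed_closedBall).trans hx
    intro y hy
    have : x - y ∈ Function.support ρ := hy
    rw [ContDiffBump.support_normed_eq] at this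
    rw [Metric.mem_closedBall, dist_comm, dist_eq_norm]
    have := mem_ball_zero_iff.1 this
    exact this.le
  have hder : ∀ y, fderiv ℝ (fun y => ρ (x - y)) y (EuclideanSpace.single i 1)
      = - fderiv ℝ ρ (x - y) (EuclideanSpace.single i 1) := fun y => by
    have h1 : HasFDerivAt ρ (fderiv ℝ ρ (x - y)) (x - y) :=
      ((hρ.differentiable (by simp)) _).hasFDerivAt
    have h2 := h1.comp y ((hasFDerivAt_id y).const_sub x)
    have := h2.fderiv
    simp only [Function.comp_def] at this
    rw [this]; simp
  have h := (hg i).2 _ hφ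
  rw [l2Inner, l2Inner] at h
  simp only [hder] at h
  rw [moll_apply', convolution_precompR_apply _ hvL (hρc.fderiv ℝ)
    (hρ.continuous_fderiv (by simp))]
  have e1 : ∀ f : Pt d → ℝ, (∫ t, ρ (x - t) * Ω.indicator f t) = ∫ t in Ω, f t * ρ (x - t) := by
    intro f
    rw [← integral_indicator hΩ]
    congr 1; ext t
    by_cases ht : t ∈ Ω <;> simp [ht, mul_comm]
  rw [e1, ← neg_inj, ← h, convolution, ← integral_neg, ← integral_indicator hΩ]
  congr 1; ext t
  by_cases ht : t ∈ Ω <;> simp [ht]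

end Mollification

section Taylor

/-! ### Averaged Taylor expansions of smooth functions -/

/-- `v` is differentiable at `z` with partial derivatives `p i z`. -/
def HasGradAt (v : Pt d → ℝ) (p : Fin d → Pt d → ℝ) (z : Pt d) : Prop :=
  ∃ L : Pt d →L[ℝ] ℝ, HasFDerivAt v L z ∧ ∀ i, L (EuclideanSpace.single i 1) = p i z

lemma HasGradAt.hasDerivAt_line {v : Pt d → ℝ} {p : Fin d → Pt d → ℝ} {x e : Pt d} {t : ℝ}
    (h : HasGradAt v p (x + t • e)) :
    HasDerivAt (fun s : ℝ => v (x + s • e)) (∑ i, p i (x + t • e) * e i) t := by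
  obtain ⟨L, hL, hp⟩ := h
  have h1 : HasDerivAt (fun s : ℝ => x + s • e) e t := by
    simpa using ((hasDerivAt_id t).smul_const e).const_add x
  have h2 := hL.comp_hasDerivAt t h1
  have he : ∑ i, e i • (EuclideanSpace.single i (1 : ℝ) : Pt d) = e := by
    simpa using (EuclideanSpace.basisFun (Fin d) ℝ).sum_repr e
  have hLe : L e = ∑ i, L (e i • (EuclideanSpace.single i (1 : ℝ) : Pt d)) := by
    rw [← map_sum, he]
  have hLe' : L e = ∑ i, p i (x + t • e) * e i := by
    rw [hLe]
    refine Finset.sum_congr rfl fun i _ => ?_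
    rw [map_smul, hp, smul_eq_mul, mul_comm]
  rw [← hLe']
  exact h2

lemma HasGradAt.sub {v w : Pt d → ℝ} {p q : Fin d → Pt d → ℝ} {z : Pt d}
    (hv : HasGradAt v p z) (hw : HasGradAt w q z) : HasGradAt (v - w) (p - q) z := by
  obtain ⟨L, hL, hp⟩ := hv
  obtain ⟨M, hM, hq⟩ := hw
  exact ⟨L - M, hL.sub hM, fun i => by simp [hp, hq]⟩

lemma lintegral_homothety_le {t : ℝ} (ht : 0 < t) (y : Pt d) {B K : Set (Pt d)}
    (hB : MeasurableSet B) (hK : MeasurableSet K) (hBK : ∀ x ∈ B, y + t • (x - y) ∈ K)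
    {f : Pt d → ℝ≥0∞} (hf : Measurable f) :
    ∫⁻ x in B, f (y + t • (x - y)) ≤ ENNReal.ofReal (t ^ d)⁻¹ * ∫⁻ x in K, f x := by
  have hF : Measurable (K.indicator f) := hf.indicator hK
  calc ∫⁻ x in B, f (y + t • (x - y))
      ≤ ∫⁻ x, K.indicator f (t • x + (y - t • y)) := by
        rw [← lintegral_indicator hB]
        refine lintegral_mono fun x => ?_
        by_cases hx : x ∈ B
        · have e : t • x + (y - t • y) = y + t • (x - y) := by rw [smul_sub]; abel
          simp only [indicator_of_mem hx]
          rw [e, indicator_of_mem (hBK x hx)]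
        · simp [hx]
    _ = ∫⁻ z, K.indicator f (z + (y - t • y)) ∂(Measure.map (fun x : Pt d => t • x) volume) := by
        rw [lintegral_map (by fun_prop) (by fun_prop)]
    _ = ENNReal.ofReal (t ^ d)⁻¹ * ∫⁻ x in K, f x := by
        rw [Measure.map_addHaar_smul _ ht.ne', lintegral_smul_measure, smul_eq_mul,
          lintegral_add_right_eq_self (K.indicator f), lintegral_indicator hK]
        simp [abs_of_pos ht]

lemma lintegral_enorm_le_eLpNorm_two {α : Type*} [MeasurableSpace α] {μ : Measure α} {f : α → ℝ}
    (hf : AEStronglyMeasurable f μ) (B : Set α) :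
    ∫⁻ x in B, ‖f x‖ₑ ∂μ ≤ μ B ^ (1 / 2 : ℝ) * eLpNorm f 2 (μ.restrict B) := by
  have := eLpNorm_le_eLpNorm_mul_rpow_measure_univ (μ := μ.restrict B) (p := 1) (q := 2)
    (by norm_num) hf.restrict
  rw [eLpNorm_one_eq_lintegral_enorm] at this
  refine this.trans_eq ?_
  rw [mul_comm]; norm_num

/-- The `L¹`-norm of a function composed with a contraction is bounded by its `L²`-norm. -/
lemma lintegral_enorm_homothety_le (hd : d ≤ 3) {t : ℝ} (ht : 0 < t) (ht1 : t ≤ 1) (y : Pt d)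
    {B K : Set (Pt d)} (hB : MeasurableSet B) (hK : MeasurableSet K)
    (hBK : ∀ x ∈ B, y + t • (x - y) ∈ K) {f : Pt d → ℝ} (hf : Continuous f) :
    ∫⁻ x in B, ‖f (y + t • (x - y))‖ₑ ≤
      ENNReal.ofReal (t ^ (-(3 / 2) : ℝ)) *
        (volume B ^ (1 / 2 : ℝ) * eLpNorm f 2 (volume.restrict K)) := by
  rw [← ENNReal.pow_le_pow_left_iff two_ne_zero, mul_pow, mul_pow, eLpNorm_two_sq]
  have h := sq_lintegral_mul_le (μ := volume.restrict B) (w := fun _ => 1)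
    (g := fun x => ‖f (y + t • (x - y))‖ₑ) aemeasurable_const
    (by fun_prop)
  simp only [one_mul, lintegral_const, Measure.restrict_apply MeasurableSet.univ, univ_inter] at h
  refine h.trans ?_
  have e1 : (volume B ^ (1 / 2 : ℝ)) ^ 2 = volume B := by
    rw [← ENNReal.rpow_natCast, ← ENNReal.rpow_mul]; norm_num
  -- The Jacobian `t ^ (-d)` of the contraction is at most `t ^ (-3)`, since `d ≤ 3` and `t ≤ 1`.
  have e2 : ENNReal.ofReal (t ^ d)⁻¹ ≤ ENNReal.ofReal (t ^ (-(3 / 2) : ℝ)) ^ 2 := by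
    rw [← ENNReal.ofReal_pow (by positivity)]
    refine ENNReal.ofReal_le_ofReal ?_
    rw [← Real.rpow_natCast (t ^ _), ← Real.rpow_mul ht.le, ← Real.rpow_natCast,
      ← Real.rpow_neg ht.le]
    refine Real.rpow_le_rpow_of_exponent_ge ht ht1 ?_
    have : (d : ℝ) ≤ 3 := by exact_mod_cast hd
    push_cast
    linarith
  have h2 := lintegral_homothety_le ht y hB hK hBK
    (f := fun x => ‖f x‖ₑ ^ 2) (by fun_prop)
  rw [e1]
  calc _ ≤ volume B * (ENNReal.ofReal (t ^ (-(3 / 2) : ℝ)) ^ 2 * ∫⁻ x in K, ‖f x‖ₑ ^ 2) := by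
        gcongr
        exact h2.trans (by gcongr)
    _ = _ := by ring

/-- The exponent `-3/4` serves two estimates: it dominates the `t ^ (-1/2)` of the Taylor remainder,
and it is half of the `-3/2` in the ray estimate. -/
lemma lintegral_rpow_Ioc :
    ∫⁻ t in Ioc (0 : ℝ) 1, ENNReal.ofReal (t ^ (-(3 / 4) : ℝ)) = ENNReal.ofReal 4 := by
  rw [← ofReal_integral_eq_lintegral_ofReal]
  · rw [← intervalIntegral.integral_of_le zero_le_one, integral_rpow (Or.inl (by norm_num))]
    norm_num
  · have := intervalIntegral.intervalIntegrable_rpow' (a := 0) (b := 1) (r := -(3 / 4))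
      (by norm_num)
    exact (intervalIntegrable_iff_integrableOn_Ioc_of_le zero_le_one).1 this
  · filter_upwards [ae_restrict_mem measurableSet_Ioc] with t ht
    exact Real.rpow_nonneg ht.1.le _

lemma abs_apply_le_norm (e : Pt d) (i : Fin d) : |e i| ≤ ‖e‖ := by
  simpa using PiLp.norm_apply_le e i

lemma enorm_sum_mul_le {ι : Type*} (s : Finset ι) (a b : ι → ℝ) {h : ℝ} (hb : ∀ i ∈ s, |b i| ≤ h) :
    ‖∑ i ∈ s, a i * b i‖ₑ ≤ ENNReal.ofReal h * ∑ i ∈ s, ‖a i‖ₑ := by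
  refine (enorm_sum_le _ _).trans ?_
  rw [Finset.mul_sum]
  refine Finset.sum_le_sum fun i hi => ?_
  rw [enorm_mul, mul_comm]
  gcongr
  rw [Real.enorm_eq_ofReal_abs]
  exact ENNReal.ofReal_le_ofReal (hb i hi)

/-- The fundamental theorem of calculus along a segment. -/
lemma enorm_sub_le_lintegral_line {f : Pt d → ℝ} {g : Fin d → Pt d → ℝ}
    (hg : ∀ i, Continuous (g i)) {x e : Pt d} {a b : ℝ} (hab : a ≤ b)
    (h : ∀ t ∈ Icc a b, HasGradAt f g (x + t • e)) {r : ℝ} (hr : ‖e‖ ≤ r) :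
    ‖f (x + b • e) - f (x + a • e)‖ₑ ≤
      ∫⁻ t in Ioc a b, ENNReal.ofReal r * ∑ i, ‖g i (x + t • e)‖ₑ := by
  have hc : Continuous fun t : ℝ => ∑ i, g i (x + t • e) * e i := by fun_prop
  have := intervalIntegral.integral_eq_sub_of_hasDerivAt (a := a) (b := b)
    (f := fun s : ℝ => f (x + s • e)) (f' := fun t => ∑ i, g i (x + t • e) * e i)
    (fun t ht => (h t (by rwa [uIcc_of_le hab] at ht)).hasDerivAt_line)
    (hc.intervalIntegrable _ _)
  rw [← this, intervalIntegral.integral_of_le hab]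
  refine (enorm_integral_le_lintegral_enorm _).trans (lintegral_mono fun t => ?_)
  exact enorm_sum_mul_le _ _ _ fun i _ => (abs_apply_le_norm e i).trans hr

/-- The pointwise Taylor expansion with integral remainder. -/
lemma enorm_taylor_le {v : Pt d → ℝ} {p : Fin d → Pt d → ℝ} {P : Fin d → Fin d → Pt d → ℝ}
    (hP : ∀ i k, Continuous (P i k)) {x y : Pt d}
    (h1 : ∀ t ∈ Icc (0 : ℝ) 1, HasGradAt v p (y + t • (x - y)))
    (h2 : ∀ t ∈ Icc (0 : ℝ) 1, ∀ i, HasGradAt (p i) (P i) (y + t • (x - y)))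
    {h : ℝ} (hh : ‖x - y‖ ≤ h) :
    ‖v y - v x - ∑ i, p i x * (y i - x i)‖ₑ ≤
      ∫⁻ t in Ioc (0 : ℝ) 1, ENNReal.ofReal t * (ENNReal.ofReal (h ^ 2) *
        ∑ i, ∑ k, ‖P i k (y + t • (x - y))‖ₑ) := by
  set e := x - y with he
  have hc : Continuous fun t : ℝ => t * ∑ i, (∑ k, P i k (y + t • e) * e k) * e i := by fun_prop
  -- With `e = x - y`, the function `t ∂ₑv - v` along the segment has derivative `t ∂ₑ²v`; its
  -- values at `1` and `0` assemble the Taylor error. This replaces an integration by parts.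
  have key : ∀ t ∈ uIcc (0 : ℝ) 1, HasDerivAt
      (fun s : ℝ => s * (∑ i, p i (y + s • e) * e i) - v (y + s • e))
      (t * ∑ i, (∑ k, P i k (y + t • e) * e k) * e i) t := by
    intro t ht
    rw [uIcc_of_le zero_le_one] at ht
    have a1 := (h1 t ht).hasDerivAt_line
    have a2 : HasDerivAt (fun s : ℝ => ∑ i, p i (y + s • e) * e i)
        (∑ i, (∑ k, P i k (y + t • e) * e k) * e i) t :=
      HasDerivAt.fun_sum fun i _ => ((h2 t ht i).hasDerivAt_line).mul_const _
    have := ((hasDerivAt_id t).mul a2).sub a1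
    refine this.congr_deriv ?_
    simp
  have := intervalIntegral.integral_eq_sub_of_hasDerivAt key (hc.intervalIntegrable _ _)
  have hxe : y + (1 : ℝ) • e = x := by simp [he]
  have eq : v y - v x - ∑ i, p i x * (y i - x i)
      = ∫ t in (0 : ℝ)..1, t * ∑ i, (∑ k, P i k (y + t • e) * e k) * e i := by
    rw [this]
    simp only [hxe, zero_smul, add_zero, one_mul, zero_mul]
    have : ∑ i, p i x * e i = -∑ i, p i x * (y i - x i) := by
      rw [← Finset.sum_neg_distrib]
      refine Finset.sum_congr rfl fun i _ => ?_
      simp [he]; ring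
    rw [this]; ring
  rw [eq, intervalIntegral.integral_of_le zero_le_one]
  refine (enorm_integral_le_lintegral_enorm _).trans (setLIntegral_mono' measurableSet_Ioc
    fun t ht => ?_)
  rw [enorm_mul, Real.enorm_of_nonneg ht.1.le]
  gcongr
  have hh0 : 0 ≤ h := (norm_nonneg _).trans hh
  refine (enorm_sum_mul_le _ _ _ fun i _ => (abs_apply_le_norm e i).trans hh).trans ?_
  rw [pow_two, ENNReal.ofReal_mul hh0, mul_assoc]
  gcongr
  rw [Finset.mul_sum]
  gcongr
  exact enorm_sum_mul_le _ _ _ fun k _ => (abs_apply_le_norm e k).trans hh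

/-- The averaged Taylor estimate in dimension at most three. -/
lemma lintegral_taylor_le (hd : d ≤ 3) {v : Pt d → ℝ} {p : Fin d → Pt d → ℝ}
    {P : Fin d → Fin d → Pt d → ℝ} (hP : ∀ i k, Continuous (P i k)) {B K : Set (Pt d)} (hB : MeasurableSet B) (hK : MeasurableSet K) (hKc : Convex ℝ K)
    (hBK : B ⊆ K) {y : Pt d} (hy : y ∈ K)
    (h1 : ∀ z ∈ K, HasGradAt v p z) (h2 : ∀ z ∈ K, ∀ i, HasGradAt (p i) (P i) z)
    {h : ℝ} (hh : ∀ x ∈ B, ‖x - y‖ ≤ h) :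
    ∫⁻ x in B, ‖v y - v x - ∑ i, p i x * (y i - x i)‖ₑ ≤
      ENNReal.ofReal (4 * h ^ 2) * (volume B ^ (1 / 2 : ℝ) *
        ∑ i, ∑ k, eLpNorm (P i k) 2 (volume.restrict K)) := by
  have hseg : ∀ x ∈ B, ∀ t ∈ Icc (0 : ℝ) 1, y + t • (x - y) ∈ K := fun x hx t ht =>
    hKc.add_smul_sub_mem hy (hBK hx) ht
  have hPm : ∀ i k, Measurable (P i k) := fun i k => (hP i k).measurable
  set M := volume B ^ (1 / 2 : ℝ) * ∑ i, ∑ k, eLpNorm (P i k) 2 (volume.restrict K) with hM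
  calc ∫⁻ x in B, ‖v y - v x - ∑ i, p i x * (y i - x i)‖ₑ
      ≤ ∫⁻ x in B, ∫⁻ t in Ioc (0 : ℝ) 1, ENNReal.ofReal t * (ENNReal.ofReal (h ^ 2) *
          ∑ i, ∑ k, ‖P i k (y + t • (x - y))‖ₑ) :=
        setLIntegral_mono' hB fun x hx => enorm_taylor_le hP
          (fun t ht => h1 _ (hseg x hx t ht)) (fun t ht => h2 _ (hseg x hx t ht)) (hh x hx)
    _ = ∫⁻ t in Ioc (0 : ℝ) 1, ∫⁻ x in B, ENNReal.ofReal t * (ENNReal.ofReal (h ^ 2) *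
          ∑ i, ∑ k, ‖P i k (y + t • (x - y))‖ₑ) := by
        refine lintegral_lintegral_swap (Measurable.aemeasurable ?_)
        simp only [Function.uncurry_def]
        fun_prop
    _ ≤ ∫⁻ t in Ioc (0 : ℝ) 1, ENNReal.ofReal (t ^ (-(3 / 4) : ℝ)) *
          (ENNReal.ofReal (h ^ 2) * M) := by
        refine setLIntegral_mono' measurableSet_Ioc fun t ht => ?_
        rw [lintegral_const_mul _ (by fun_prop), lintegral_const_mul _ (by fun_prop),
          lintegral_finsetSum _ (by fun_prop)]
        have hsum : ∀ i, ∫⁻ x in B, ∑ k, ‖P i k (y + t • (x - y))‖ₑ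
            = ∑ k, ∫⁻ x in B, ‖P i k (y + t • (x - y))‖ₑ := fun i =>
          lintegral_finsetSum _ (by fun_prop)
        simp_rw [hsum]
        have : ∑ i, ∑ k, ∫⁻ x in B, ‖P i k (y + t • (x - y))‖ₑ
            ≤ ENNReal.ofReal (t ^ (-(3 / 2) : ℝ)) * M := by
          rw [hM]
          simp only [Finset.mul_sum]
          gcongr with i _ k _
          exact lintegral_enorm_homothety_le hd ht.1 ht.2 y hB hK
            (fun x hx => hseg x hx t ⟨ht.1.le, ht.2⟩) (hP i k)
        -- The remainder weight `t` turns the singularity `t ^ (-3/2)` into `t ^ (-1/2)`, which is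
        -- weakened to the integrable `t ^ (-3/4)`.
        have ht2 : ENNReal.ofReal t * ENNReal.ofReal (t ^ (-(3 / 2) : ℝ))
            ≤ ENNReal.ofReal (t ^ (-(3 / 4) : ℝ)) := by
          rw [← ENNReal.ofReal_mul ht.1.le]
          refine ENNReal.ofReal_le_ofReal ?_
          nth_rewrite 1 [← Real.rpow_one t]
          rw [← Real.rpow_add ht.1]
          exact Real.rpow_le_rpow_of_exponent_ge ht.1 ht.2 (by norm_num)
        calc _ ≤ ENNReal.ofReal t * (ENNReal.ofReal (h ^ 2) *
                (ENNReal.ofReal (t ^ (-(3 / 2) : ℝ)) * M)) := by gcongr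
          _ = (ENNReal.ofReal t * ENNReal.ofReal (t ^ (-(3 / 2) : ℝ))) *
                (ENNReal.ofReal (h ^ 2) * M) := by ring
          _ ≤ _ := by gcongr
    _ = _ := by
        rw [lintegral_mul_const _ (by fun_prop), lintegral_rpow_Ioc,
          ENNReal.ofReal_mul (by norm_num), mul_assoc]

/-- The growth of the mean of a function along rays towards a point is controlled by the
`L²`-norm of its gradient. -/
lemma lintegral_ray_le (hd : d ≤ 3) {g : Pt d → ℝ} {G : Fin d → Pt d → ℝ}
    (hg : Continuous g) (hG : ∀ i, Continuous (G i)) {A K : Set (Pt d)} (hA : MeasurableSet A)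
    (hK : MeasurableSet K) {P : Pt d} {l : ℝ} (hl : 0 < l) (hl1 : l ≤ 1)
    (hAK : ∀ x ∈ A, ∀ s ∈ Icc l 1, P + s • (x - P) ∈ K) (hgrad : ∀ z ∈ K, HasGradAt g G z)
    {h : ℝ} (hh : ∀ x ∈ A, ‖x - P‖ ≤ h) :
    ∫⁻ x in A, ‖g (P + l • (x - P))‖ₑ ≤ (∫⁻ x in A, ‖g x‖ₑ) +
      ENNReal.ofReal (4 * l ^ (-(3 / 4) : ℝ) * h) *
        (volume A ^ (1 / 2 : ℝ) * ∑ i, eLpNorm (G i) 2 (volume.restrict K)) := by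
  have hGm : ∀ i, Measurable (G i) := fun i => (hG i).measurable
  set M := volume A ^ (1 / 2 : ℝ) * ∑ i, eLpNorm (G i) 2 (volume.restrict K) with hM
  have hlp : 0 ≤ l ^ (-(3 / 4) : ℝ) := by positivity
  have h1 : ∫⁻ x in A, ‖g (P + (1 : ℝ) • (x - P)) - g (P + l • (x - P))‖ₑ ≤
      ENNReal.ofReal (4 * l ^ (-(3 / 4) : ℝ) * h) * M := by
    calc _ ≤ ∫⁻ x in A, ∫⁻ s in Ioc l 1, ENNReal.ofReal h * ∑ i, ‖G i (P + s • (x - P))‖ₑ :=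
          setLIntegral_mono' hA fun x hx => enorm_sub_le_lintegral_line hG hl1
            (fun t ht => hgrad _ (hAK x hx t ht)) (hh x hx)
      _ = ∫⁻ s in Ioc l 1, ∫⁻ x in A, ENNReal.ofReal h * ∑ i, ‖G i (P + s • (x - P))‖ₑ := by
          refine lintegral_lintegral_swap (Measurable.aemeasurable ?_)
          simp only [Function.uncurry_def]
          fun_prop
      _ ≤ ∫⁻ s in Ioc l 1, ENNReal.ofReal (s ^ (-(3 / 4) : ℝ)) *
            (ENNReal.ofReal (l ^ (-(3 / 4) : ℝ)) * ENNReal.ofReal h * M) := by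
          refine setLIntegral_mono' measurableSet_Ioc fun s hs => ?_
          have hs0 : 0 < s := hl.trans hs.1
          rw [lintegral_const_mul _ (by fun_prop), lintegral_finsetSum _ (by fun_prop)]
          have : ∑ i, ∫⁻ x in A, ‖G i (P + s • (x - P))‖ₑ
              ≤ ENNReal.ofReal (s ^ (-(3 / 2) : ℝ)) * M := by
            rw [hM]
            simp only [Finset.mul_sum]
            gcongr with i _
            exact lintegral_enorm_homothety_le hd hs0 hs.2 P hA hK
              (fun x hx => hAK x hx s ⟨hs.1.le, hs.2⟩) (hG i)
          -- Here no factor `s` helps and `s ^ (-3/2)` is not integrable at `0`. Half of the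
          -- exponent is frozen at the lower end `l`, the other half is integrated.
          have hs2 : ENNReal.ofReal (s ^ (-(3 / 2) : ℝ)) ≤
              ENNReal.ofReal (s ^ (-(3 / 4) : ℝ)) * ENNReal.ofReal (l ^ (-(3 / 4) : ℝ)) := by
            rw [← ENNReal.ofReal_mul (by positivity)]
            refine ENNReal.ofReal_le_ofReal ?_
            have e : s ^ (-(3 / 2) : ℝ) = s ^ (-(3 / 4) : ℝ) * s ^ (-(3 / 4) : ℝ) := by
              rw [← Real.rpow_add hs0]; norm_num
            rw [e]
            exact mul_le_mul_of_nonneg_left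
              (Real.rpow_le_rpow_of_nonpos hl hs.1.le (by norm_num)) (by positivity)
          calc _ ≤ ENNReal.ofReal h * ((ENNReal.ofReal (s ^ (-(3 / 4) : ℝ)) *
                  ENNReal.ofReal (l ^ (-(3 / 4) : ℝ))) * M) := by
                gcongr
                exact this.trans (by gcongr)
            _ = _ := by ring
      _ ≤ ∫⁻ s in Ioc (0 : ℝ) 1, ENNReal.ofReal (s ^ (-(3 / 4) : ℝ)) *
            (ENNReal.ofReal (l ^ (-(3 / 4) : ℝ)) * ENNReal.ofReal h * M) :=
          lintegral_mono_set (Ioc_subset_Ioc_left hl.le)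
      _ = _ := by
          rw [lintegral_mul_const _ (by fun_prop), lintegral_rpow_Ioc,
            ENNReal.ofReal_mul (by positivity), ENNReal.ofReal_mul (by positivity)]
          ring
  calc ∫⁻ x in A, ‖g (P + l • (x - P))‖ₑ
      ≤ ∫⁻ x in A, (‖g x‖ₑ + ‖g (P + (1 : ℝ) • (x - P)) - g (P + l • (x - P))‖ₑ) := by
        refine lintegral_mono fun x => ?_
        have e : g (P + l • (x - P)) = g x - (g (P + (1 : ℝ) • (x - P)) - g (P + l • (x - P))) := by
          simp
        conv_lhs => rw [e]
        exact enorm_sub_le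
    _ = _ := lintegral_add_left (by fun_prop) _
    _ ≤ _ := by gcongr

/-- The `L¹`-norm of a difference is controlled by the gradient on the swept set. -/
lemma lintegral_translate_sub_le {g : Pt d → ℝ} {G : Fin d → Pt d → ℝ}
    (hG : ∀ i, Continuous (G i)) {A K : Set (Pt d)} (hA : MeasurableSet A)
    (hK : MeasurableSet K) {e : Pt d} (hAK : ∀ x ∈ A, ∀ s ∈ Icc (0 : ℝ) 1, x + s • e ∈ K)
    (hgrad : ∀ z, HasGradAt g G z) :
    ∫⁻ x in A, ‖g (x + e) - g x‖ₑ ≤ ENNReal.ofReal ‖e‖ * ∑ i, ∫⁻ x in K, ‖G i x‖ₑ := by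
  have hGm : ∀ i, Measurable (G i) := fun i => (hG i).measurable
  calc ∫⁻ x in A, ‖g (x + e) - g x‖ₑ
      ≤ ∫⁻ x in A, ∫⁻ s in Ioc (0 : ℝ) 1, ENNReal.ofReal ‖e‖ * ∑ i, ‖G i (x + s • e)‖ₑ := by
        refine lintegral_mono fun x => ?_
        simpa using enorm_sub_le_lintegral_line (f := g) hG (x := x) (e := e) zero_le_one
          (fun t _ => hgrad _) le_rfl
    _ = ∫⁻ s in Ioc (0 : ℝ) 1, ∫⁻ x in A, ENNReal.ofReal ‖e‖ * ∑ i, ‖G i (x + s • e)‖ₑ := by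
        refine lintegral_lintegral_swap (Measurable.aemeasurable ?_)
        simp only [Function.uncurry_def]
        fun_prop
    _ ≤ ∫⁻ s in Ioc (0 : ℝ) 1, ENNReal.ofReal ‖e‖ * ∑ i, ∫⁻ x in K, ‖G i x‖ₑ := by
        refine setLIntegral_mono' measurableSet_Ioc fun s hs => ?_
        rw [lintegral_const_mul _ (by fun_prop), lintegral_finsetSum _ (by fun_prop)]
        refine mul_le_mul_right (Finset.sum_le_sum fun i _ => ?_) _
        rw [← lintegral_indicator hA, ← lintegral_indicator hK,
          ← lintegral_add_right_eq_self (K.indicator fun x => ‖G i x‖ₑ) (s • e)]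
        refine lintegral_mono fun x => ?_
        by_cases hx : x ∈ A
        · simp [hx, hAK x hx s ⟨hs.1.le, hs.2⟩]
        · simp [hx]
    _ = _ := by simp

end Taylor

section WeakHessian

/-! ### Weak derivatives of second order -/

/-- `g` is the weak gradient and `G` the weak Hessian of `v`. -/
structure HasWeakHessian (Ω : Set (Pt d)) (v : Pt d → ℝ) (g : Fin d → Pt d → ℝ)
    (G : Fin d → Fin d → Pt d → ℝ) : Prop where
  memLp : MemLp v 2 (volume.restrict Ω)
  grad : ∀ i, HasWeakPartial Ω i v (g i)
  hess : ∀ i k, HasWeakPartial Ω k (g i) (G i k)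

lemma IsTestFunction.partial {Ω : Set (Pt d)} {φ : Pt d → ℝ} (h : IsTestFunction Ω φ)
    (e : Pt d) : IsTestFunction Ω (fun x => fderiv ℝ φ x e) :=
  ⟨(h.1.fderiv_right (m := ∞) (by simp)).clm_apply contDiff_const,
    h.2.1.fderiv_apply ℝ e,
    (tsupport_fderiv_apply_subset ℝ e).trans h.2.2⟩

lemma fderiv_fderiv_apply_comm {φ : Pt d → ℝ} (h : ContDiff ℝ ∞ φ) (x a b : Pt d) :
    fderiv ℝ (fun y => fderiv ℝ φ y a) x b = fderiv ℝ (fun y => fderiv ℝ φ y b) x a := by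
  have hd : DifferentiableAt ℝ (fderiv ℝ φ) x :=
    (h.fderiv_right (m := ∞) (by simp)).differentiable (by simp) x
  have e : ∀ a b : Pt d, fderiv ℝ (fun y => fderiv ℝ φ y a) x b = fderiv ℝ (fderiv ℝ φ) x b a := by
    intro a b
    rw [fderiv_clm_apply hd (differentiableAt_const a)]
    simp
  rw [e, e]
  exact (h.contDiffAt.isSymmSndFDerivAt (by rw [minSmoothness_of_isRCLikeNormedField]; exact WithTop.coe_le_coe.2 (le_top : (2 : ℕ∞) ≤ ⊤))) b a

lemma weakPartial_spec {Ω : Set (Pt d)} {i : Fin d} {v : Pt d → ℝ}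
    (h : ∃ g, HasWeakPartial Ω i v g) : HasWeakPartial Ω i v (weakPartial Ω i v) := by
  rw [weakPartial, dif_pos h]
  exact h.choose_spec

/-- Both orders of differentiation are moved onto the test function, where they commute. -/
lemma HasWeakPartial.symm {Ω : Set (Pt d)} {i k : Fin d} {v p q r : Pt d → ℝ}
    (hp : HasWeakPartial Ω i v p) (hq : HasWeakPartial Ω k v q) (hr : HasWeakPartial Ω i q r) :
    HasWeakPartial Ω k p r := by
  refine ⟨hr.1, fun φ hφ => ?_⟩
  have h1 := hp.2 _ (hφ.partial (EuclideanSpace.single k 1))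
  have h2 := hq.2 _ (hφ.partial (EuclideanSpace.single i 1))
  have h3 := hr.2 _ hφ
  simp only [fderiv_fderiv_apply_comm hφ.1 _ (EuclideanSpace.single k 1)] at h1
  linarith

lemma le_sqrt_sum_sq (a : ℝ) (b : Fin d → ℝ) (c : Fin d → Fin d → ℝ) :
    a ≤ √(a ^ 2 + ∑ i, b i ^ 2 + ∑ i, ∑ k ∈ Finset.univ.filter (i ≤ ·), c i k ^ 2) ∧
    (∀ i, b i ≤ √(a ^ 2 + ∑ i, b i ^ 2 + ∑ i, ∑ k ∈ Finset.univ.filter (i ≤ ·), c i k ^ 2)) ∧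
    ∀ i k, i ≤ k →
      c i k ≤ √(a ^ 2 + ∑ i, b i ^ 2 + ∑ i, ∑ k ∈ Finset.univ.filter (i ≤ ·), c i k ^ 2) := by
  have n0 := sq_nonneg a
  have n1 : 0 ≤ ∑ i, b i ^ 2 := Finset.sum_nonneg fun _ _ => sq_nonneg _
  have n3 : ∀ i, 0 ≤ ∑ k ∈ Finset.univ.filter (i ≤ ·), c i k ^ 2 := fun i =>
    Finset.sum_nonneg fun _ _ => sq_nonneg _
  have n2 : 0 ≤ ∑ i, ∑ k ∈ Finset.univ.filter (i ≤ ·), c i k ^ 2 :=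
    Finset.sum_nonneg fun i _ => n3 i
  refine ⟨Real.le_sqrt_of_sq_le (by linarith), fun i => Real.le_sqrt_of_sq_le ?_,
    fun i k hik => Real.le_sqrt_of_sq_le ?_⟩
  · have := Finset.single_le_sum (f := fun i => b i ^ 2) (fun _ _ => sq_nonneg _)
      (Finset.mem_univ i)
    linarith
  · have h1 := Finset.single_le_sum (s := Finset.univ.filter (i ≤ ·)) (f := fun k => c i k ^ 2)
      (fun _ _ => sq_nonneg _) (a := k) (by simpa using hik)
    have h2 := Finset.single_le_sum (f := fun i => ∑ k ∈ Finset.univ.filter (i ≤ ·), c i k ^ 2)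
      (fun i _ => n3 i) (Finset.mem_univ i)
    linarith

/-- The norm `h2Norm` contains mixed derivatives only for `i ≤ k`. The other half of the Hessian is
filled in by symmetry, so that every entry is bounded by the norm. -/
lemma MemH2.exists_hasWeakHessian {Ω : Set (Pt d)} {v : Pt d → ℝ} (h : MemH2 Ω v) :
    ∃ G, HasWeakHessian Ω v (fun i => weakPartial Ω i v) G ∧ l2Norm Ω v ≤ h2Norm Ω v ∧
      (∀ i, l2Norm Ω (weakPartial Ω i v) ≤ h2Norm Ω v) ∧ ∀ i k, l2Norm Ω (G i k) ≤ h2Norm Ω v := by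
  have hw := fun i => weakPartial_spec (h.1.2 i)
  have hww := fun i k => weakPartial_spec ((h.2 i).2 k)
  obtain ⟨k0, k1, k2⟩ := le_sqrt_sum_sq (l2Norm Ω v) (fun i => l2Norm Ω (weakPartial Ω i v))
    (fun i k => l2Norm Ω (weakPartial Ω k (weakPartial Ω i v)))
  refine ⟨fun i k => if i ≤ k then weakPartial Ω k (weakPartial Ω i v) else
    weakPartial Ω i (weakPartial Ω k v), ⟨h.1.1, hw, fun i k => ?_⟩, k0, k1, fun i k => ?_⟩
  · split_ifs
    · exact hww i k
    · exact (hw i).symm (hw k) (hww k i)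
  · dsimp only
    split_ifs with hik
    · exact k2 i k hik
    · exact k2 k i (not_le.1 hik).le

/-! ### The continuous representative -/

lemma eventually_closedBall_subset {K Ω : Set (Pt d)} (hK : IsCompact K) (hΩ : IsOpen Ω)
    (hKΩ : K ⊆ Ω) : ∀ᶠ n : ℕ in atTop, ∀ z ∈ K, Metric.closedBall z (1 / ((n : ℝ) + 1)) ⊆ Ω := by
  obtain ⟨δ, hδ, h⟩ := hK.exists_cthickening_subset_open hΩ hKΩ
  filter_upwards [tendsto_one_div_add_atTop_nhds_zero_nat.eventually (gt_mem_nhds hδ)] with n hn z hz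
  exact (Metric.closedBall_subset_closedBall hn.le).trans
    ((Metric.closedBall_subset_cthickening hz δ).trans h)

lemma eventually_hasGradAt_moll {K Ω : Set (Pt d)} (hK : IsCompact K) (hΩ : IsOpen Ω)
    (hKΩ : K ⊆ Ω) {v : Pt d → ℝ} (hv : MemLp v 2 (volume.restrict Ω)) {g : Fin d → Pt d → ℝ}
    (hg : ∀ i, HasWeakPartial Ω i v (g i)) :
    ∀ᶠ n : ℕ in atTop, ∀ z ∈ K,
      HasGradAt (moll n (Ω.indicator v)) (fun i => moll n (Ω.indicator (g i))) z := by
  filter_upwards [eventually_closedBall_subset hK hΩ hKΩ] with n hn z hz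
  exact hasFDerivAt_moll hΩ.measurableSet hv hg (hn z hz)

lemma memLp_indicator {Ω : Set (Pt d)} (hΩ : IsOpen Ω) {v : Pt d → ℝ}
    (hv : MemLp v 2 (volume.restrict Ω)) : MemLp (Ω.indicator v) 2 volume :=
  (memLp_indicator_iff_restrict hΩ.measurableSet).2 hv

lemma continuous_moll_indicator {Ω : Set (Pt d)} (hΩ : IsOpen Ω) {v : Pt d → ℝ}
    (hv : MemLp v 2 (volume.restrict Ω)) (n : ℕ) : Continuous (moll n (Ω.indicator v)) :=
  (moll_contDiff n ((memLp_indicator hΩ hv).locallyIntegrable (by norm_num))).continuous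

lemma tendsto_eLpNorm_moll_restrict {Ω : Set (Pt d)} (hΩ : IsOpen Ω) {v : Pt d → ℝ}
    (hv : MemLp v 2 (volume.restrict Ω)) {K : Set (Pt d)} (hK : MeasurableSet K) (hKΩ : K ⊆ Ω) :
    Tendsto (fun n => eLpNorm (moll n (Ω.indicator v)) 2 (volume.restrict K)) atTop
      (𝓝 (eLpNorm v 2 (volume.restrict K))) := by
  have hm := memLp_indicator hΩ hv
  have h0 := tendsto_eLpNorm_moll_sub hm
  have e : eLpNorm v 2 (volume.restrict K) = eLpNorm (Ω.indicator v) 2 (volume.restrict K) := by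
    refine eLpNorm_congr_ae ?_
    filter_upwards [ae_restrict_mem hK] with x hx
    simp [hKΩ hx]
  rw [e]
  have hfin : eLpNorm (Ω.indicator v) 2 (volume.restrict K) ≠ ⊤ := (hm.restrict K).2.ne
  have hc := fun n => (continuous_moll_indicator hΩ hv n).aestronglyMeasurable
    (μ := volume.restrict K)
  refine tendsto_of_tendsto_of_tendsto_of_le_of_le
    (g := fun n => eLpNorm (Ω.indicator v) 2 (volume.restrict K)
      - eLpNorm (moll n (Ω.indicator v) - Ω.indicator v) 2 volume)
    (h := fun n => eLpNorm (Ω.indicator v) 2 (volume.restrict K)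
      + eLpNorm (moll n (Ω.indicator v) - Ω.indicator v) 2 volume) ?_ ?_ ?_ ?_
  · simpa using ENNReal.Tendsto.sub tendsto_const_nhds h0 (Or.inl hfin)
  · simpa using tendsto_const_nhds.add h0
  · intro n
    refine tsub_le_iff_right.2 ?_
    have := eLpNorm_sub_le (μ := volume.restrict K) (p := 2) (hc n)
      (((hc n).sub hm.1.restrict)) (by norm_num)
    rw [sub_sub_cancel] at this
    exact this.trans (add_le_add le_rfl (eLpNorm_restrict_le _ _ _ _))
  · intro n
    have := eLpNorm_add_le (μ := volume.restrict K) (p := 2) hm.1.restrict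
      (((hc n).sub hm.1.restrict)) (by norm_num)
    rw [add_sub_cancel] at this
    exact this.trans (add_le_add le_rfl (eLpNorm_restrict_le _ _ _ _))

/-- This is Fatou's lemma in the form that carries estimates from mollifications to the function
itself. -/
lemma lintegral_le_of_tendsto_ae {α : Type*} [MeasurableSpace α] {μ : Measure α}
    {F : ℕ → α → ℝ≥0∞} {f : α → ℝ≥0∞} {R : ℕ → ℝ≥0∞} {r : ℝ≥0∞} (hF : ∀ n, AEMeasurable (F n) μ)
    (hFf : ∀ᵐ x ∂μ, Tendsto (fun n => F n x) atTop (𝓝 (f x)))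
    (hR : ∀ᶠ n in atTop, ∫⁻ x, F n x ∂μ ≤ R n) (hr : Tendsto R atTop (𝓝 r)) :
    ∫⁻ x, f x ∂μ ≤ r :=
  calc ∫⁻ x, f x ∂μ = ∫⁻ x, liminf (fun n => F n x) atTop ∂μ :=
        lintegral_congr_ae (hFf.mono fun _ hx => hx.liminf_eq.symm)
    _ ≤ liminf (fun n => ∫⁻ x, F n x ∂μ) atTop := lintegral_liminf_le' hF
    _ ≤ liminf R atTop := liminf_le_liminf hR
    _ = r := hr.liminf_eq

/-- Averaging the constant `c` over `B` turns a bound on the mean Taylor error at `y` into a bound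
on the single value `c`, at the cost of the `L²` norms of `v` and of its gradient. -/
lemma volume_mul_enorm_le {B : Set (Pt d)} (hB : MeasurableSet B) {c : ℝ} {v : Pt d → ℝ}
    {p : Fin d → Pt d → ℝ} {y : Pt d} (hv : AEStronglyMeasurable v (volume.restrict B))
    (hp : ∀ i, AEStronglyMeasurable (p i) (volume.restrict B)) {h : ℝ} (hh : ∀ x ∈ B, ‖x - y‖ ≤ h)
    {R : ℝ≥0∞} (hR : ∫⁻ x in B, ‖c - v x - ∑ i, p i x * (y i - x i)‖ₑ ≤ R) :
    volume B * ‖c‖ₑ ≤ R + volume B ^ (1 / 2 : ℝ) * (eLpNorm v 2 (volume.restrict B) +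
      ENNReal.ofReal h * ∑ i, eLpNorm (p i) 2 (volume.restrict B)) := by
  have l2 : ∀ {f : Pt d → ℝ}, AEStronglyMeasurable f (volume.restrict B) →
      ∫⁻ x in B, ‖f x‖ₑ ≤ volume B ^ (1 / 2 : ℝ) * eLpNorm f 2 (volume.restrict B) := fun hf => by
    simpa using lintegral_enorm_le_eLpNorm_two hf univ
  calc volume B * ‖c‖ₑ = ∫⁻ x in B, ‖c‖ₑ := by simp [mul_comm]
    _ ≤ ∫⁻ x in B, (‖c - v x - ∑ i, p i x * (y i - x i)‖ₑ + (‖v x‖ₑ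
          + ENNReal.ofReal h * ∑ i, ‖p i x‖ₑ)) := by
        refine setLIntegral_mono' hB fun x hx => ?_
        have e : c = (c - v x - ∑ i, p i x * (y i - x i)) + (v x + ∑ i, p i x * (y i - x i)) := by
          ring
        conv_lhs => rw [e]
        refine (enorm_add_le _ _).trans ?_
        gcongr
        refine (enorm_add_le _ _).trans ?_
        gcongr
        refine enorm_sum_mul_le _ _ _ fun i _ => ?_
        have := abs_apply_le_norm (x - y) i
        rw [abs_sub_comm]
        exact (by simpa using this : |x i - y i| ≤ ‖x - y‖).trans (hh x hx)
    _ = (∫⁻ x in B, ‖c - v x - ∑ i, p i x * (y i - x i)‖ₑ) + ((∫⁻ x in B, ‖v x‖ₑ)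
          + ENNReal.ofReal h * ∑ i, ∫⁻ x in B, ‖p i x‖ₑ) := by
        have hpm : AEMeasurable (fun x => ∑ i, ‖p i x‖ₑ) (volume.restrict B) :=
          Finset.aemeasurable_fun_sum _ fun i _ => (hp i).enorm
        have hm : AEMeasurable (fun x => ‖v x‖ₑ + ENNReal.ofReal h * ∑ i, ‖p i x‖ₑ)
            (volume.restrict B) := hv.enorm.add (hpm.const_mul _)
        rw [lintegral_add_right' _ hm, lintegral_add_left' hv.enorm,
          lintegral_const_mul'' _ hpm, lintegral_finsetSum' _ fun i _ => (hp i).enorm]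
    _ ≤ _ := by
        rw [mul_add, mul_left_comm, Finset.mul_sum (a := volume B ^ (1 / 2 : ℝ))]
        gcongr with i _
        · exact l2 hv
        · exact l2 (hp i)

/-- The continuous representative of an `H²`-function, the limit of its mollifications. -/
def rep (Ω : Set (Pt d)) (v : Pt d → ℝ) (x : Pt d) : ℝ :=
  limUnder atTop fun n => moll n (Ω.indicator v) x

variable {Ω : Set (Pt d)} {v : Pt d → ℝ} {g : Fin d → Pt d → ℝ} {G : Fin d → Fin d → Pt d → ℝ}

/-- The averaged Taylor estimate is applied to the difference of two mollifications. It bounds that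
difference pointwise by `L²` norms of differences of orders zero to two, all of which tend to zero.
-/
lemma HasWeakHessian.uniformCauchySeqOn (hd : d ≤ 3) (hΩ : IsOpen Ω)
    (H : HasWeakHessian Ω v g G) {x : Pt d} {r : ℝ} (hr : 0 < r)
    (hx : Metric.closedBall x r ⊆ Ω) :
    UniformCauchySeqOn (fun n => moll n (Ω.indicator v)) atTop (Metric.closedBall x r) := by
  set B := Metric.closedBall x r
  have hB : MeasurableSet B := Metric.isClosed_closedBall.measurableSet
  have hB0 : volume B ≠ 0 := (Metric.measure_closedBall_pos _ _ hr).ne'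
  have hBt : volume B ≠ ⊤ := measure_closedBall_lt_top.ne
  have hBc : IsCompact B := isCompact_closedBall _ _
  let δ : (Pt d → ℝ) → ℕ → ℝ≥0∞ := fun f n =>
    eLpNorm (moll n (Ω.indicator f) - Ω.indicator f) 2 volume
  let e : ℕ → ℝ≥0∞ := fun n => ENNReal.ofReal (4 * (2 * r) ^ 2) * ∑ i, ∑ k, δ (G i k) n +
    (δ v n + ENNReal.ofReal (2 * r) * ∑ i, δ (g i) n)
  have hδ : ∀ {f}, MemLp f 2 (volume.restrict Ω) → Tendsto (δ f) atTop (𝓝 0) := fun hf =>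
    tendsto_eLpNorm_moll_sub (memLp_indicator hΩ hf)
  have he : Tendsto e atTop (𝓝 0) := by
    have t1 : Tendsto (fun n => ∑ i, ∑ k, δ (G i k) n) atTop (𝓝 (∑ i : Fin d, ∑ k : Fin d, 0)) :=
      tendsto_finsetSum _ fun i _ => tendsto_finsetSum _ fun k _ => hδ (H.hess i k).1
    have t2 : Tendsto (fun n => ∑ i, δ (g i) n) atTop (𝓝 (∑ i : Fin d, 0)) :=
      tendsto_finsetSum _ fun i _ => hδ (H.grad i).1
    have := (ENNReal.Tendsto.const_mul (a := ENNReal.ofReal (4 * (2 * r) ^ 2)) t1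
      (Or.inr ENNReal.ofReal_ne_top)).add ((hδ H.memLp).add
      (ENNReal.Tendsto.const_mul (a := ENNReal.ofReal (2 * r)) t2 (Or.inr ENNReal.ofReal_ne_top)))
    simpa [e] using this
  have hdiff : ∀ {f}, MemLp f 2 (volume.restrict Ω) → ∀ n m,
      eLpNorm (moll n (Ω.indicator f) - moll m (Ω.indicator f)) 2 (volume.restrict B)
        ≤ δ f n + δ f m := by
    intro f hf n m
    have hm := (memLp_indicator hΩ hf).1
    have hc := fun n => (continuous_moll_indicator hΩ hf n).aestronglyMeasurable (μ := volume)
    have eq : moll n (Ω.indicator f) - moll m (Ω.indicator f) =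
      (moll n (Ω.indicator f) - Ω.indicator f) - (moll m (Ω.indicator f) - Ω.indicator f) := by
      abel
    rw [eq]
    exact (eLpNorm_restrict_le _ _ _ _).trans
      (eLpNorm_sub_le ((hc n).sub hm) ((hc m).sub hm) (by norm_num))
  set s := volume B ^ (1 / 2 : ℝ) with hs
  have hss : s * s = volume B := by
    rw [hs, ← ENNReal.rpow_add_of_nonneg _ _ (by norm_num) (by norm_num)]; norm_num
  have hs0 : s ≠ 0 := by intro h; rw [h, zero_mul] at hss; exact hB0 hss.symm
  have hst : s ≠ ⊤ := ENNReal.rpow_ne_top_of_nonneg (by norm_num) hBt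
  -- The Taylor and value bounds on the ball carry the factor `s = √|B|` on the right and `s²` on
  -- the left; one factor cancels and `s⁻¹` remains.
  have main : ∀ᶠ n in atTop, ∀ m, (∀ z ∈ B, HasGradAt (moll m (Ω.indicator v))
      (fun i => moll m (Ω.indicator (g i))) z) → (∀ i, ∀ z ∈ B,
      HasGradAt (moll m (Ω.indicator (g i))) (fun k => moll m (Ω.indicator (G i k))) z) →
      ∀ y ∈ B, ‖moll n (Ω.indicator v) y - moll m (Ω.indicator v) y‖ₑ ≤ s⁻¹ * (e n + e m) := by
    filter_upwards [eventually_hasGradAt_moll hBc hΩ hx H.memLp H.grad,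
      eventually_all.2 fun i =>
        eventually_hasGradAt_moll hBc hΩ hx (H.grad i).1 (H.hess i)] with n h1 h2 m h1' h2' y hy
    have hh : ∀ x ∈ B, ‖x - y‖ ≤ 2 * r := fun z hz => by
      have a := Metric.mem_closedBall.1 hz
      have b := Metric.mem_closedBall'.1 hy
      rw [← dist_eq_norm]
      linarith [dist_triangle z x y]
    have T := lintegral_taylor_le hd
      (v := moll n (Ω.indicator v) - moll m (Ω.indicator v))
      (p := (fun i => moll n (Ω.indicator (g i))) - fun i => moll m (Ω.indicator (g i)))
      (P := fun i => (fun k => moll n (Ω.indicator (G i k))) - fun k => moll m (Ω.indicator (G i k)))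
      (fun i k => (continuous_moll_indicator hΩ (H.hess i k).1 n).sub
        (continuous_moll_indicator hΩ (H.hess i k).1 m))
      hB hB (convex_closedBall _ _) Subset.rfl hy
      (fun z hz => (h1 z hz).sub (h1' z hz)) (fun z hz i => (h2 i z hz).sub (h2' i z hz)) hh
    have T2 := volume_mul_enorm_le hB
      ((continuous_moll_indicator hΩ H.memLp n).sub
        (continuous_moll_indicator hΩ H.memLp m)).aestronglyMeasurable
      (fun i => ((continuous_moll_indicator hΩ (H.grad i).1 n).sub
        (continuous_moll_indicator hΩ (H.grad i).1 m)).aestronglyMeasurable) hh T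
    rw [← hs, ← hss] at T2
    simp only [Pi.sub_apply] at T2
    have T3 : s * (s * ‖moll n (Ω.indicator v) y - moll m (Ω.indicator v) y‖ₑ) ≤
        s * (e n + e m) := by
      rw [← mul_assoc]
      refine T2.trans ?_
      rw [mul_left_comm, ← mul_add]
      refine mul_le_mul_right ?_ s
      calc _ ≤ ENNReal.ofReal (4 * (2 * r) ^ 2) * ∑ i, ∑ k, (δ (G i k) n + δ (G i k) m)
            + ((δ v n + δ v m) + ENNReal.ofReal (2 * r) * ∑ i, (δ (g i) n + δ (g i) m)) := by
            gcongr with i _ k _ i _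
            · exact hdiff (H.hess i k).1 n m
            · exact hdiff H.memLp n m
            · exact hdiff (H.grad i).1 n m
        _ = _ := by
            simp only [e, Finset.sum_add_distrib]
            ring
    rw [ENNReal.mul_le_mul_iff_right hs0 hst] at T3
    rw [← ENNReal.div_eq_inv_mul, ENNReal.le_div_iff_mul_le (Or.inl hs0) (Or.inl hst), mul_comm]
    exact T3
  rw [Metric.uniformCauchySeqOn_iff]
  intro ε hε
  have he2 : Tendsto (fun n => s⁻¹ * e n) atTop (𝓝 0) := by
    simpa using ENNReal.Tendsto.const_mul he (Or.inr (ENNReal.inv_ne_top.2 hs0))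
  have hε2 : (0 : ℝ≥0∞) < ENNReal.ofReal (ε / 2) := by simpa using hε
  have ev := main.and ((eventually_hasGradAt_moll hBc hΩ hx H.memLp H.grad).and
    ((eventually_all.2 fun i =>
        eventually_hasGradAt_moll hBc hΩ hx (H.grad i).1 (H.hess i)).and
      (he2.eventually (gt_mem_nhds hε2))))
  obtain ⟨N, hN⟩ := eventually_atTop.1 ev
  refine ⟨N, fun m hm n hn y hy => ?_⟩
  obtain ⟨a1, -, -, a4⟩ := hN m hm
  obtain ⟨-, b2, b3, b4⟩ := hN n hn
  have := a1 n b2 b3 y hy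
  have h5 : ‖moll m (Ω.indicator v) y - moll n (Ω.indicator v) y‖ₑ < ENNReal.ofReal ε := by
    refine this.trans_lt ?_
    rw [mul_add]
    refine (ENNReal.add_lt_add a4 b4).trans_eq ?_
    rw [← ENNReal.ofReal_add (by positivity) (by positivity)]
    congr 1; ring
  rw [Real.enorm_eq_ofReal_abs, ENNReal.ofReal_lt_ofReal_iff hε] at h5
  rwa [Real.dist_eq]

lemma HasWeakHessian.tendsto_rep (hd : d ≤ 3) (hΩ : IsOpen Ω) (H : HasWeakHessian Ω v g G)
    {x : Pt d} (hx : x ∈ Ω) :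
    Tendsto (fun n => moll n (Ω.indicator v) x) atTop (𝓝 (rep Ω v x)) := by
  obtain ⟨r, hr, hrΩ⟩ := Metric.nhds_basis_closedBall.mem_iff.1 (hΩ.mem_nhds hx)
  have h := H.uniformCauchySeqOn hd hΩ hr hrΩ
  exact (h.cauchy_map (Metric.mem_closedBall_self hr.le)).le_nhds_lim

lemma HasWeakHessian.continuousOn_rep (hd : d ≤ 3) (hΩ : IsOpen Ω) (H : HasWeakHessian Ω v g G) :
    ContinuousOn (rep Ω v) Ω := by
  intro x hx
  obtain ⟨r, hr, hrΩ⟩ := Metric.nhds_basis_closedBall.mem_iff.1 (hΩ.mem_nhds hx)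
  have h := (H.uniformCauchySeqOn hd hΩ hr hrΩ).tendstoUniformlyOn_of_tendsto
    fun y hy => H.tendsto_rep hd hΩ (hrΩ hy)
  have hc := h.continuousOn (Frequently.of_forall fun n =>
    (continuous_moll_indicator hΩ H.memLp n).continuousOn)
  exact (hc.continuousAt (Metric.closedBall_mem_nhds x hr)).continuousWithinAt

lemma HasWeakHessian.rep_ae_eq (hd : d ≤ 3) (hΩ : IsOpen Ω) (H : HasWeakHessian Ω v g G) :
    ∀ᵐ x, x ∈ Ω → rep Ω v x = v x := by
  filter_upwards [ae_tendsto_moll ((memLp_indicator hΩ H.memLp).locallyIntegrable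
    (by norm_num))] with x hx hxΩ
  rw [indicator_of_mem hxΩ] at hx
  exact tendsto_nhds_unique (H.tendsto_rep hd hΩ hxΩ) hx

lemma ae_tendsto_moll_indicator (hΩ : IsOpen Ω) {f : Pt d → ℝ}
    (hf : MemLp f 2 (volume.restrict Ω)) :
    ∀ᵐ x, x ∈ Ω → Tendsto (fun n => moll n (Ω.indicator f) x) atTop (𝓝 (f x)) := by
  filter_upwards [ae_tendsto_moll ((memLp_indicator hΩ hf).locallyIntegrable
    (by norm_num))] with x hx hxΩ
  rwa [indicator_of_mem hxΩ] at hx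

/-- The averaged Taylor estimate for the continuous representative. -/
lemma HasWeakHessian.lintegral_taylor_le (hd : d ≤ 3) (hΩ : IsOpen Ω)
    (H : HasWeakHessian Ω v g G) {B K : Set (Pt d)} (hB : MeasurableSet B) (hK : IsCompact K)
    (hKc : Convex ℝ K) (hBK : B ⊆ K) (hKΩ : K ⊆ Ω) {y : Pt d} (hy : y ∈ K) {h : ℝ}
    (hh : ∀ x ∈ B, ‖x - y‖ ≤ h) :
    ∫⁻ x in B, ‖rep Ω v y - v x - ∑ i, g i x * (y i - x i)‖ₑ ≤
      ENNReal.ofReal (4 * h ^ 2) * (volume B ^ (1 / 2 : ℝ) *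
        ∑ i, ∑ k, eLpNorm (G i k) 2 (volume.restrict K)) := by
  have hBt : volume B ^ (1 / 2 : ℝ) ≠ ⊤ := ENNReal.rpow_ne_top_of_nonneg (by norm_num)
    ((measure_mono hBK).trans_lt hK.measure_lt_top).ne
  refine lintegral_le_of_tendsto_ae (F := fun n x => ‖moll n (Ω.indicator v) y
      - moll n (Ω.indicator v) x - ∑ i, moll n (Ω.indicator (g i)) x * (y i - x i)‖ₑ)
    (R := fun n => ENNReal.ofReal (4 * h ^ 2) * (volume B ^ (1 / 2 : ℝ) *
        ∑ i, ∑ k, eLpNorm (moll n (Ω.indicator (G i k))) 2 (volume.restrict K))) ?_ ?_ ?_ ?_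
  · intro n
    have c1 := continuous_moll_indicator hΩ H.memLp n
    have c2 := fun i => continuous_moll_indicator hΩ (H.grad i).1 n
    refine Measurable.aemeasurable (Continuous.measurable ?_)
    fun_prop
  · rw [ae_restrict_iff' hB]
    filter_upwards [ae_tendsto_moll_indicator hΩ H.memLp,
      ae_all_iff.2 fun i => ae_tendsto_moll_indicator hΩ (H.grad i).1] with x h1 h2 hx
    refine Tendsto.enorm ?_
    refine ((H.tendsto_rep hd hΩ (hKΩ hy)).sub (h1 (hKΩ (hBK hx)))).sub ?_
    exact tendsto_finsetSum _ fun i _ => (h2 i (hKΩ (hBK hx))).mul_const _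
  · filter_upwards [eventually_hasGradAt_moll hK hΩ hKΩ H.memLp H.grad,
      eventually_all.2 fun i =>
        eventually_hasGradAt_moll hK hΩ hKΩ (H.grad i).1 (H.hess i)] with n h1 h2
    exact TwoGrid.lintegral_taylor_le hd
      (fun i k => continuous_moll_indicator hΩ (H.hess i k).1 n) hB hK.measurableSet hKc hBK hy
      h1 (fun z hz i => h2 i z hz) hh
  · refine ENNReal.Tendsto.const_mul (ENNReal.Tendsto.const_mul ?_ (Or.inr hBt))
      (Or.inr ENNReal.ofReal_ne_top)
    exact tendsto_finsetSum _ fun i _ => tendsto_finsetSum _ fun k _ =>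
      tendsto_eLpNorm_moll_restrict hΩ (H.hess i k).1 hK.measurableSet hKΩ

end WeakHessian

section ConvexBody

/-! ### Estimates on convex bodies -/

lemma finrank_pt : Module.finrank ℝ (Pt d) = d := by simp

/-- Mollifications have the right derivatives only on compact subsets of `Ω`; this hull is the
compact convex set on which Taylor expansion from `B` to `y` takes place. -/
lemma IsCompact.convexHull_insert {B : Set (Pt d)} (hB : IsCompact B) (hBc : Convex ℝ B)
    (hne : B.Nonempty) (y : Pt d) : IsCompact (convexHull ℝ (insert y B)) := by
  rw [_root_.convexHull_insert hne, hBc.convexHull_eq]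
  have : convexJoin ℝ {y} B = (fun p : ℝ × Pt d => y + p.1 • (p.2 - y)) '' (Icc 0 1 ×ˢ B) := by
    ext z
    simp only [mem_convexJoin, mem_singleton_iff, exists_eq_left, segment_eq_image', mem_image,
      mem_prod, Prod.exists]
    constructor
    · rintro ⟨b, hb, t, ht, rfl⟩
      exact ⟨t, b, ⟨ht, hb⟩, rfl⟩
    · rintro ⟨t, b, ⟨ht, hb⟩, rfl⟩
      exact ⟨b, hb, t, ht, rfl⟩
  rw [this]
  exact (isCompact_Icc.prod hB).image (by fun_prop)

/-- A homothety of ratio `1/2` about an interior point moves the body into its interior and keeps a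
fixed fraction of its volume, so averages over `B` are comparable to averages over `K`. -/
lemma exists_shrunk_body {K : Set (Pt d)} (hK : IsCompact K) (hKc : Convex ℝ K)
    (hne : (interior K).Nonempty) : ∃ B : Set (Pt d), IsCompact B ∧ Convex ℝ B ∧ B.Nonempty ∧
      B ⊆ interior K ∧ volume B = ENNReal.ofReal ((1 / 2) ^ d) * volume K := by
  obtain ⟨x₀, hx₀⟩ := hne
  refine ⟨AffineMap.homothety x₀ (1 / 2 : ℝ) '' K, hK.image ?_, hKc.affine_image _,
    Set.Nonempty.image _ ⟨x₀, interior_subset hx₀⟩, ?_, ?_⟩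
  · exact AffineMap.homothety_continuous _ _
  · rintro _ ⟨z, hz, rfl⟩
    have := hKc.add_smul_sub_mem_interior hz hx₀ (t := 1 / 2) ⟨by norm_num, by norm_num⟩
    convert this using 1
    rw [AffineMap.homothety_apply, vsub_eq_sub, vadd_eq_add]
    module
  · rw [Measure.addHaar_image_homothety, finrank_pt, abs_of_nonneg (by positivity)]

variable {Ω : Set (Pt d)} {v : Pt d → ℝ} {g : Fin d → Pt d → ℝ} {G : Fin d → Fin d → Pt d → ℝ}

lemma HasWeakHessian.lintegral_taylor_interior_le (hd : d ≤ 3) (hΩ : IsOpen Ω)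
    (H : HasWeakHessian Ω v g G) {B K : Set (Pt d)} (hB : IsCompact B) (hBc : Convex ℝ B)
    (hne : B.Nonempty) (hKc : Convex ℝ K) (hBK : B ⊆ interior K) (hKΩ : interior K ⊆ Ω) {y : Pt d}
    (hy : y ∈ interior K) {h : ℝ} (hh : ∀ x ∈ K, ∀ y ∈ K, ‖x - y‖ ≤ h) :
    ∫⁻ x in B, ‖rep Ω v y - v x - ∑ i, g i x * (y i - x i)‖ₑ ≤
      ENNReal.ofReal (4 * h ^ 2) * (volume B ^ (1 / 2 : ℝ) *
        ∑ i, ∑ k, eLpNorm (G i k) 2 (volume.restrict (interior K))) := by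
  have hsub : convexHull ℝ (insert y B) ⊆ interior K :=
    convexHull_min (insert_subset hy hBK) hKc.interior
  refine (H.lintegral_taylor_le hd hΩ hB.measurableSet (IsCompact.convexHull_insert hB hBc hne y)
    (convex_convexHull ℝ _) ((subset_insert y B).trans (subset_convexHull ℝ _))
    (hsub.trans hKΩ) (subset_convexHull ℝ _ (mem_insert y B))
    (fun x hx => hh x (interior_subset (hBK hx)) y (interior_subset hy))).trans ?_
  gcongr

/-- The ratio of the two roots is `2 ^ (d / 2) ≤ √8 < 3`. -/
lemma sqrt_volume_le (hd : d ≤ 3) {B K : Set (Pt d)}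
    (hBK : volume B = ENNReal.ofReal ((1 / 2) ^ d) * volume K) :
    √(volume K).toReal ≤ 3 * √(volume B).toReal := by
  rw [hBK, ENNReal.toReal_mul, ENNReal.toReal_ofReal (by positivity)]
  have : (1 / 9 : ℝ) ≤ (1 / 2) ^ d := by
    calc (1 / 9 : ℝ) ≤ (1 / 2) ^ 3 := by norm_num
      _ ≤ _ := pow_le_pow_of_le_one (by norm_num) (by norm_num) hd
  refine Real.sqrt_le_iff.2 ⟨by positivity, ?_⟩
  rw [mul_pow, Real.sq_sqrt (by positivity)]
  nlinarith [ENNReal.toReal_nonneg (a := volume K)]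

lemma rpow_half_toReal (a : ℝ≥0∞) : (a ^ (1 / 2 : ℝ)).toReal = √a.toReal := by
  rw [← ENNReal.toReal_rpow, Real.sqrt_eq_rpow]

lemma interior_pos_measure {K : Set (Pt d)} (hne : (interior K).Nonempty) : volume K ≠ 0 := by
  intro h0
  have := measure_mono_null interior_subset h0
  exact hne.ne_empty ((isOpen_interior.measure_eq_zero_iff _).1 this)

/-- On a convex body, an `H²`-function is close to an affine function in the sup norm. -/
lemma HasWeakHessian.exists_affine (hd : d ≤ 3) (hΩ : IsOpen Ω) (H : HasWeakHessian Ω v g G)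
    {K : Set (Pt d)} (hK : IsCompact K) (hKc : Convex ℝ K) (hne : (interior K).Nonempty)
    (hKΩ : interior K ⊆ Ω) {h : ℝ} (hh : ∀ x ∈ K, ∀ y ∈ K, ‖x - y‖ ≤ h) :
    ∃ (c : ℝ) (a : Fin d → ℝ), ∀ y ∈ interior K,
      |rep Ω v y - (c + ∑ i, a i * y i)| * √(volume K).toReal ≤
        12 * h ^ 2 * ∑ i, ∑ k, l2Norm (interior K) (G i k) := by
  obtain ⟨B, hB, hBc, hBne, hBK, hBv⟩ := exists_shrunk_body hK hKc hne
  have hBt : volume B ≠ ⊤ := hB.measure_lt_top.ne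
  have hB0 : volume B ≠ 0 := by
    rw [hBv]
    exact mul_ne_zero (by simp) (interior_pos_measure hne)
  set b := (volume B).toReal with hb
  have hbpos : 0 < b := ENNReal.toReal_pos hB0 hBt
  have hBΩ : B ⊆ Ω := hBK.trans hKΩ
  have int : ∀ {f : Pt d → ℝ}, MemLp f 2 (volume.restrict Ω) → IntegrableOn f B := fun hf =>
    haveI : IsFiniteMeasure (volume.restrict B) := ⟨by simpa using hB.measure_lt_top⟩
    (hf.mono_measure (Measure.restrict_mono hBΩ le_rfl)).integrable (by norm_num)
  have intmul : ∀ {f : Pt d → ℝ}, MemLp f 2 (volume.restrict Ω) → ∀ i : Fin d,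
      IntegrableOn (fun x => f x * x i) B := fun hf i =>
    (int hf).mul_continuousOn (by fun_prop) hB
  -- This is the average over `x ∈ B` of the first-order Taylor polynomial at `x`, sorted by powers
  -- of `y`; it does not depend on `y`.
  refine ⟨b⁻¹ * ∫ x in B, (v x - ∑ i, g i x * x i), fun i => b⁻¹ * ∫ x in B, g i x,
    fun y hy => ?_⟩
  have T := H.lintegral_taylor_interior_le hd hΩ hB hBc hBne hKc hBK hKΩ hy hh
  have fin : ∀ i k, eLpNorm (G i k) 2 (volume.restrict (interior K)) ≠ ⊤ := fun i k =>
    (((H.hess i k).1).mono_measure (Measure.restrict_mono hKΩ le_rfl)).2.ne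
  have e1 : ∫ x in B, (rep Ω v y - v x - ∑ i, g i x * (y i - x i))
      = b * (rep Ω v y - (b⁻¹ * (∫ x in B, (v x - ∑ i, g i x * x i))
        + ∑ i, b⁻¹ * (∫ x in B, g i x) * y i)) := by
    have i1 := int H.memLp
    have i2 : IntegrableOn (fun x => ∑ i, g i x * x i) B :=
      integrable_finsetSum _ fun i _ => intmul (H.grad i).1 i
    have i3 : IntegrableOn (fun x => ∑ i, g i x * y i) B :=
      integrable_finsetSum _ fun i _ => (int (H.grad i).1).mul_const _
    have ptw : ∀ x, rep Ω v y - v x - ∑ i, g i x * (y i - x i)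
        = rep Ω v y - ((v x - ∑ i, g i x * x i) + ∑ i, g i x * y i) := fun x => by
      simp only [mul_sub, Finset.sum_sub_distrib]; ring
    simp_rw [ptw]
    have i0 : IntegrableOn (fun _ => rep Ω v y) B := integrableOn_const hBt
    have i12 : IntegrableOn (fun x => v x - ∑ i, g i x * x i) B := i1.sub i2
    have i123 : IntegrableOn (fun x => (v x - ∑ i, g i x * x i) + ∑ i, g i x * y i) B :=
      i12.add i3
    rw [integral_sub i0 i123, integral_add i12 i3, integral_finsetSum _ fun i _ => (int (H.grad i).1).mul_const _]
    simp only [integral_mul_const, setIntegral_const, smul_eq_mul, Measure.real, ← hb]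
    simp only [mul_assoc, ← Finset.mul_sum]
    field_simp
  have e2 := (enorm_integral_le_lintegral_enorm (μ := volume.restrict B)
    (fun x => rep Ω v y - v x - ∑ i, g i x * (y i - x i))).trans T
  rw [e1] at e2
  have e3 := ENNReal.toReal_mono (ENNReal.mul_ne_top ENNReal.ofReal_ne_top (ENNReal.mul_ne_top
    (ENNReal.rpow_ne_top_of_nonneg (by norm_num) hBt)
    (ENNReal.sum_ne_top.2 fun i _ => ENNReal.sum_ne_top.2 fun k _ => fin i k))) e2
  rw [ENNReal.toReal_mul, ENNReal.toReal_mul, ENNReal.toReal_ofReal (by positivity),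
    rpow_half_toReal, ENNReal.toReal_sum fun i _ => ENNReal.sum_ne_top.2 fun k _ => fin i k,
    toReal_enorm, norm_mul, Real.norm_of_nonneg hbpos.le, Real.norm_eq_abs] at e3
  simp_rw [ENNReal.toReal_sum fun k _ => fin _ k] at e3
  simp only [l2Norm]
  set E := ∑ i, ∑ k, (eLpNorm (G i k) 2 (volume.restrict (interior K))).toReal
  set D := |rep Ω v y - (b⁻¹ * (∫ x in B, (v x - ∑ i, g i x * x i))
        + ∑ i, b⁻¹ * (∫ x in B, g i x) * y i)|
  have hD : 0 ≤ D := abs_nonneg _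
  have hs : 0 < √b := Real.sqrt_pos.2 hbpos
  have hsb : √b * √b = b := Real.mul_self_sqrt hbpos.le
  have e4 : √b * D ≤ 4 * h ^ 2 * E := by
    have : √b * (√b * D) ≤ √b * (4 * h ^ 2 * E) := by
      rw [← mul_assoc, hsb]; rw [← hb] at e3; linarith
    exact le_of_mul_le_mul_left this hs
  -- Passing from `√|B|` to `√|K|` costs the factor `3`, which makes `12` out of the Taylor constant
  -- `4`.
  have e5 := mul_le_mul_of_nonneg_left (sqrt_volume_le hd hBv) hD
  rw [← hb] at e5
  linarith

/-- The Sobolev embedding on a convex body. -/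
lemma HasWeakHessian.abs_rep_le (hd : d ≤ 3) (hΩ : IsOpen Ω) (H : HasWeakHessian Ω v g G)
    {K : Set (Pt d)} (hK : IsCompact K) (hKc : Convex ℝ K) (hne : (interior K).Nonempty)
    (hKΩ : interior K ⊆ Ω) {h : ℝ} (hh : ∀ x ∈ K, ∀ y ∈ K, ‖x - y‖ ≤ h) {y : Pt d}
    (hy : y ∈ interior K) :
      |rep Ω v y| * √(volume K).toReal ≤
        3 * (4 * h ^ 2 * ∑ i, ∑ k, l2Norm Ω (G i k) + (l2Norm Ω v + h * ∑ i, l2Norm Ω (g i))) := by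
  obtain ⟨B, hB, hBc, hBne, hBK, hBv⟩ := exists_shrunk_body hK hKc hne
  have hBt : volume B ≠ ⊤ := hB.measure_lt_top.ne
  have hB0 : volume B ≠ 0 := by
    rw [hBv]
    exact mul_ne_zero (by simp) (interior_pos_measure hne)
  have hh0 : 0 ≤ h := (norm_nonneg _).trans
    (hh y (interior_subset hy) y (interior_subset hy))
  set b := (volume B).toReal with hb
  have hbpos : 0 < b := ENNReal.toReal_pos hB0 hBt
  have hBΩ : B ⊆ Ω := hBK.trans hKΩ
  have mB : volume.restrict B ≤ volume.restrict Ω := Measure.restrict_mono hBΩ le_rfl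
  have mK : volume.restrict (interior K) ≤ volume.restrict Ω := Measure.restrict_mono hKΩ le_rfl
  have T := H.lintegral_taylor_interior_le hd hΩ hB hBc hBne hKc hBK hKΩ hy hh
  have T2 := volume_mul_enorm_le hB.measurableSet (H.memLp.mono_measure mB).1
    (fun i => ((H.grad i).1.mono_measure mB).1)
    (fun x hx => hh x (interior_subset (hBK hx)) y (interior_subset hy)) T
  have T3 : volume B * ‖rep Ω v y‖ₑ ≤ ENNReal.ofReal (4 * h ^ 2) * (volume B ^ (1 / 2 : ℝ) *
        ∑ i, ∑ k, eLpNorm (G i k) 2 (volume.restrict Ω)) +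
      volume B ^ (1 / 2 : ℝ) * (eLpNorm v 2 (volume.restrict Ω) +
      ENNReal.ofReal h * ∑ i, eLpNorm (g i) 2 (volume.restrict Ω)) := by
    refine T2.trans ?_
    gcongr
  have hs' : volume B ^ (1 / 2 : ℝ) ≠ ⊤ := ENNReal.rpow_ne_top_of_nonneg (by norm_num) hBt
  have f1 : ∀ i ∈ Finset.univ, ∑ k, eLpNorm (G i k) 2 (volume.restrict Ω) ≠ ⊤ := fun i _ =>
    ENNReal.sum_ne_top.2 fun k _ => (H.hess i k).1.2.ne
  have f2 : ∀ i ∈ Finset.univ, eLpNorm (g i) 2 (volume.restrict Ω) ≠ ⊤ := fun i _ =>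
    (H.grad i).1.2.ne
  have f3 := ENNReal.sum_ne_top.2 f1
  have f4 := ENNReal.sum_ne_top.2 f2
  have f5 := H.memLp.2.ne
  have e3 := ENNReal.toReal_mono (by finiteness) T3
  rw [ENNReal.toReal_add (by finiteness) (by finiteness), ENNReal.toReal_mul, ENNReal.toReal_mul,
    ENNReal.toReal_mul, ENNReal.toReal_mul, ENNReal.toReal_add (by finiteness) (by finiteness),
    ENNReal.toReal_mul, ENNReal.toReal_ofReal (by positivity), ENNReal.toReal_ofReal hh0,
    rpow_half_toReal, ENNReal.toReal_sum f1, ENNReal.toReal_sum f2, toReal_enorm,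
    Real.norm_eq_abs, ← hb] at e3
  simp_rw [ENNReal.toReal_sum fun k _ => (H.hess _ k).1.2.ne] at e3
  simp only [l2Norm]
  set E := ∑ i, ∑ k, (eLpNorm (G i k) 2 (volume.restrict Ω)).toReal
  set F := ∑ i, (eLpNorm (g i) 2 (volume.restrict Ω)).toReal
  have hs : 0 < √b := Real.sqrt_pos.2 hbpos
  have hsb : √b * √b = b := Real.mul_self_sqrt hbpos.le
  have e4 : √b * |rep Ω v y| ≤ 4 * h ^ 2 * E +
      ((eLpNorm v 2 (volume.restrict Ω)).toReal + h * F) := by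
    have : √b * (√b * |rep Ω v y|) ≤ √b * (4 * h ^ 2 * E +
      ((eLpNorm v 2 (volume.restrict Ω)).toReal + h * F)) := by
      rw [← mul_assoc, hsb]; linarith
    exact le_of_mul_le_mul_left this hs
  have e5 := mul_le_mul_of_nonneg_left (sqrt_volume_le hd hBv) (abs_nonneg (rep Ω v y))
  rw [← hb] at e5
  linarith

/-- Decay of the mass of an `H¹`-function near a point of a convex body. -/
lemma lintegral_enorm_scaled_le (hd : d ≤ 3) (hΩ : IsOpen Ω) {f : Pt d → ℝ}
    {F : Fin d → Pt d → ℝ} (hf : MemLp f 2 (volume.restrict Ω))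
    (hF : ∀ k, HasWeakPartial Ω k f (F k)) {K : Set (Pt d)} (hK : IsCompact K)
    (hKc : Convex ℝ K) (hKΩ : interior K ⊆ Ω) {P : Pt d} (hP : P ∈ K) :
    ∃ C : ℝ≥0∞, C ≠ ⊤ ∧ ∀ l : ℝ, 0 < l → l ≤ 1 → ∀ A' : Set (Pt d), IsOpen A' →
      (∀ z ∈ A', P + l⁻¹ • (z - P) ∈ interior K) →
      ∫⁻ z in A', ‖f z‖ₑ ≤ ENNReal.ofReal (l ^ d * l ^ (-(3 / 4) : ℝ)) * C := by
  obtain ⟨R, hR⟩ := hK.isBounded.subset_closedBall P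
  set h : ℝ := max R 0
  have hhR : ∀ x ∈ K, ‖x - P‖ ≤ h := fun x hx =>
    (by simpa [dist_eq_norm] using hR hx : ‖x - P‖ ≤ R).trans (le_max_left _ _)
  set I := interior K with hI
  have hIt : volume I ≠ ⊤ := ((measure_mono interior_subset).trans_lt hK.measure_lt_top).ne
  set c₁ : ℝ≥0∞ := volume I ^ (1 / 2 : ℝ) * eLpNorm f 2 (volume.restrict I) with hc₁
  set c₂ : ℝ≥0∞ := volume I ^ (1 / 2 : ℝ) * ∑ k, eLpNorm (F k) 2 (volume.restrict I) with hc₂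
  have mI : volume.restrict I ≤ volume.restrict Ω := Measure.restrict_mono hKΩ le_rfl
  have hIs : volume I ^ (1 / 2 : ℝ) ≠ ⊤ := ENNReal.rpow_ne_top_of_nonneg (by norm_num) hIt
  have hc₁t : c₁ ≠ ⊤ := ENNReal.mul_ne_top hIs (hf.mono_measure mI).2.ne
  have hc₂t : c₂ ≠ ⊤ := ENNReal.mul_ne_top hIs
    (ENNReal.sum_ne_top.2 fun k _ => ((hF k).1.mono_measure mI).2.ne)
  refine ⟨c₁ + ENNReal.ofReal (4 * h) * c₂, by finiteness, fun l hl hl1 A' hA' hA'I => ?_⟩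
  have hlinv : 0 < l⁻¹ := inv_pos.2 hl
  -- Compact pieces `Z` of `A'` are needed, since the gradients of mollifications are controlled
  -- only on compact subsets of `Ω`; the constant must not depend on `Z`.
  have compactCase : ∀ Z : Set (Pt d), IsCompact Z → Z ⊆ A' → ∫⁻ z in Z, ‖f z‖ₑ ≤
      ENNReal.ofReal (l ^ d * l ^ (-(3 / 4) : ℝ)) * (c₁ + ENNReal.ofReal (4 * h) * c₂) := by
    intro Z hZ hZA
    set A : Set (Pt d) := (fun z => P + l⁻¹ • (z - P)) '' Z with hAdef
    have hA : IsCompact A := hZ.image (by fun_prop)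
    have hAI : A ⊆ I := by
      rintro _ ⟨z, hz, rfl⟩
      exact hA'I z (hZA hz)
    -- `S` is swept out by the segments that join each dilated point of `A` to its original in `Z`;
    -- it stays in the interior of `K` by convexity, even if `P` is on the boundary of `K`.
    set S : Set (Pt d) := (fun p : ℝ × Pt d => P + p.1 • (p.2 - P)) '' (Icc l 1 ×ˢ A) with hSdef
    have hS : IsCompact S := (isCompact_Icc.prod hA).image (by fun_prop)
    have hSI : S ⊆ I := by
      rintro _ ⟨⟨s, x⟩, ⟨hs, hx⟩, rfl⟩
      exact hKc.add_smul_sub_mem_interior hP (hAI hx) ⟨hl.trans_le hs.1, hs.2⟩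
    have hAS : A ⊆ S := fun x hx => ⟨(1, x), ⟨⟨hl1, le_rfl⟩, hx⟩, by simp⟩
    have hZS : Z ⊆ S := fun z hz => ⟨(l, P + l⁻¹ • (z - P)), ⟨⟨le_rfl, hl1⟩, z, hz, rfl⟩, by
      simp [smul_smul, hl.ne']⟩
    have hZΩ : Z ⊆ Ω := hZS.trans (hSI.trans hKΩ)
    have hAt : volume A ^ (1 / 2 : ℝ) ≠ ⊤ :=
      ENNReal.rpow_ne_top_of_nonneg (by norm_num) hA.measure_lt_top.ne
    have key : ∫⁻ z in Z, ‖f z‖ₑ ≤ ENNReal.ofReal (l ^ d) *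
        (volume A ^ (1 / 2 : ℝ) * eLpNorm f 2 (volume.restrict A) +
        ENNReal.ofReal (4 * l ^ (-(3 / 4) : ℝ) * h) *
        (volume A ^ (1 / 2 : ℝ) * ∑ k, eLpNorm (F k) 2 (volume.restrict S))) := by
      refine lintegral_le_of_tendsto_ae (F := fun n z => ‖moll n (Ω.indicator f) z‖ₑ)
        (R := fun n => ENNReal.ofReal (l ^ d) *
        (volume A ^ (1 / 2 : ℝ) * eLpNorm (moll n (Ω.indicator f)) 2 (volume.restrict A) +
        ENNReal.ofReal (4 * l ^ (-(3 / 4) : ℝ) * h) * (volume A ^ (1 / 2 : ℝ) *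
          ∑ k, eLpNorm (moll n (Ω.indicator (F k))) 2 (volume.restrict S)))) ?_ ?_ ?_ ?_
      · exact fun n => (continuous_moll_indicator hΩ hf n).enorm.measurable.aemeasurable
      · rw [ae_restrict_iff' hZ.measurableSet]
        filter_upwards [ae_tendsto_moll_indicator hΩ hf] with x hx hxZ
        exact (hx (hZΩ hxZ)).enorm
      · filter_upwards [eventually_hasGradAt_moll hS hΩ (hSI.trans hKΩ) hf hF] with n hn
        have cf := continuous_moll_indicator hΩ hf n
        have h1 := lintegral_homothety_le hlinv P hZ.measurableSet hA.measurableSet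
          (fun z hz => ⟨z, hz, rfl⟩)
          (f := fun x => ‖moll n (Ω.indicator f) (P + l • (x - P))‖ₑ)
          (Continuous.measurable (by fun_prop))
        simp only [add_sub_cancel_left, smul_smul, mul_inv_cancel₀ hl.ne', one_smul,
          add_sub_cancel, inv_pow, inv_inv] at h1
        refine h1.trans ?_
        gcongr
        refine (lintegral_ray_le hd cf (fun k => continuous_moll_indicator hΩ (hF k).1 n)
          hA.measurableSet hS.measurableSet hl hl1
          (fun x hx s hs => ⟨(s, x), ⟨hs, hx⟩, rfl⟩) hn
          (fun x hx => hhR x (interior_subset (hAI hx)))).trans ?_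
        gcongr
        exact lintegral_enorm_le_eLpNorm_two cf.aestronglyMeasurable A
      · have t1 := tendsto_eLpNorm_moll_restrict hΩ hf hA.measurableSet (hAI.trans hKΩ)
        have t2 : Tendsto (fun n => ∑ k,
            eLpNorm (moll n (Ω.indicator (F k))) 2 (volume.restrict S)) atTop
            (𝓝 (∑ k, eLpNorm (F k) 2 (volume.restrict S))) :=
          tendsto_finsetSum _ fun k _ => tendsto_eLpNorm_moll_restrict hΩ (hF k).1
            hS.measurableSet (hSI.trans hKΩ)
        exact ENNReal.Tendsto.const_mul ((ENNReal.Tendsto.const_mul t1 (Or.inr hAt)).add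
          (ENNReal.Tendsto.const_mul (ENNReal.Tendsto.const_mul t2 (Or.inr hAt))
            (Or.inr ENNReal.ofReal_ne_top))) (Or.inr ENNReal.ofReal_ne_top)
    -- The term without gradient is also allowed this growth, which gives both terms a common
    -- factor.
    have hl34 : 1 ≤ l ^ (-(3 / 4) : ℝ) :=
      Real.one_le_rpow_of_pos_of_le_one_of_nonpos hl hl1 (by norm_num)
    calc _ ≤ _ := key
      _ ≤ ENNReal.ofReal (l ^ d) * (c₁ + ENNReal.ofReal (4 * l ^ (-(3 / 4) : ℝ) * h) * c₂) := by
          rw [hc₁, hc₂]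
          gcongr
      _ ≤ ENNReal.ofReal (l ^ d) * (ENNReal.ofReal (l ^ (-(3 / 4) : ℝ)) *
            (c₁ + ENNReal.ofReal (4 * h) * c₂)) := by
          refine mul_le_mul_right ?_ _
          rw [mul_add]
          refine add_le_add ?_ (le_of_eq ?_)
          · exact le_mul_of_one_le_left zero_le (by simpa using hl34)
          · have : ENNReal.ofReal (4 * l ^ (-(3 / 4) : ℝ) * h) =
                ENNReal.ofReal (l ^ (-(3 / 4) : ℝ)) * ENNReal.ofReal (4 * h) := by
              rw [← ENNReal.ofReal_mul (by positivity)]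
              congr 1; ring
            rw [this, mul_assoc]
      _ = _ := by rw [ENNReal.ofReal_mul (p := l ^ d) (by positivity), mul_assoc]
  have hAK : A' ⊆ I := by
    intro z hz
    have := hKc.add_smul_sub_mem_interior hP (hA'I z hz) (t := l) ⟨hl, hl1⟩
    simpa [smul_smul, hl.ne'] using this
  obtain ⟨Z, hZc, hZA, hZU, hZm⟩ := hA'.exists_iUnion_isClosed
  rw [← hZU, setLIntegral_iUnion_of_directed _ hZm.directed_le]
  exact iSup_le fun n => compactCase _
    (hK.of_isClosed_subset (hZc n) ((hZA n).trans (hAK.trans interior_subset))) (hZA n)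

end ConvexBody

section Boundary

/-! ### Local cones -/

/-- Near `P`, the set `K` contains with a point also its dilations centred at `P`. -/
def IsConicNear (K : Set (Pt d)) (P : Pt d) : Prop :=
  ∀ᶠ z in 𝓝 P, ∀ l : ℝ, 0 < l → l ≤ 1 → P + l • (z - P) ∈ K → z ∈ K

/-- On a ray from `P` an affine function is interpolated between `f P` and `f z`. If `f P ≠ 0`, its
sign persists near `P`; if `f P = 0`, dilation only multiplies `f` by a positive factor. -/
lemma isConicNear_halfSpace (f : Pt d →ᵃ[ℝ] ℝ) (P : Pt d) : IsConicNear {x | 0 ≤ f x} P := by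
  have hc : Continuous f := f.continuous_of_finiteDimensional
  have hf : ∀ (z : Pt d) (l : ℝ), f (P + l • (z - P)) = (1 - l) * f P + l * f z := fun z l => by
    have : P + l • (z - P) = AffineMap.lineMap P z l := by
      rw [AffineMap.lineMap_apply]; simp [add_comm]
    rw [this, f.apply_lineMap, AffineMap.lineMap_apply]
    simp only [vsub_eq_sub, vadd_eq_add, smul_eq_mul]; ring
  rcases lt_trichotomy (f P) 0 with h | h | h
  · filter_upwards [hc.continuousAt.eventually (gt_mem_nhds h)] with z hz l hl hl1 hzl
    have hzl' : 0 ≤ f (P + l • (z - P)) := hzl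
    rw [hf] at hzl'
    nlinarith
  · refine Eventually.of_forall fun z l hl hl1 hzl => ?_
    have hzl' : 0 ≤ f (P + l • (z - P)) := hzl
    rw [hf, h] at hzl'
    exact nonneg_of_mul_nonneg_right (by simpa using hzl') hl
  · filter_upwards [hc.continuousAt.eventually (lt_mem_nhds h)] with z hz l hl hl1 hzl
    exact hz.le

lemma IsConicNear.iInter {ι : Type*} [Finite ι] {K : ι → Set (Pt d)} {P : Pt d}
    (h : ∀ i, IsConicNear (K i) P) : IsConicNear (⋂ i, K i) P := by
  filter_upwards [eventually_all.2 h] with z hz l hl hl1 hzl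
  exact mem_iInter.2 fun i => hz i l hl hl1 (mem_iInter.1 hzl i)

lemma IsConicNear.biUnion {ι : Type*} {S : Finset ι} {K : ι → Set (Pt d)} {P : Pt d}
    (h : ∀ i ∈ S, IsConicNear (K i) P) : IsConicNear (⋃ i ∈ S, K i) P := by
  have h' : ∀ᶠ z in 𝓝 P, ∀ i ∈ S, ∀ l : ℝ, 0 < l → l ≤ 1 → P + l • (z - P) ∈ K i → z ∈ K i :=
    (Filter.eventually_all_finset S).2 h
  filter_upwards [h'] with z hz l hl hl1 hzl
  obtain ⟨i, hi, hzi⟩ := mem_iUnion₂.1 hzl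
  exact mem_iUnion₂.2 ⟨i, hi, hz i hi l hl hl1 hzi⟩

variable {Ω : Set (Pt d)}

/-- If `P ∈ K`, conicity says that dilating the part of `K` in the small ball by `l⁻¹` stays in `K`,
so the scaled estimate applies. If `P ∉ K`, small balls miss `K`. -/
lemma eventually_lintegral_ball_interior_le (hd : d ≤ 3) (hΩ : IsOpen Ω) {f : Pt d → ℝ}
    {F : Fin d → Pt d → ℝ} (hf : MemLp f 2 (volume.restrict Ω))
    (hF : ∀ k, HasWeakPartial Ω k f (F k)) {K : Set (Pt d)} (hK : IsCompact K)
    (hKc : Convex ℝ K) (hKΩ : interior K ⊆ Ω) {P : Pt d} (hKP : IsConicNear K P) :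
    ∀ᶠ ε in 𝓝[>] (0 : ℝ), ∃ C : ℝ≥0∞, C ≠ ⊤ ∧ ∀ l : ℝ, 0 < l → l ≤ 1 →
      ∫⁻ z in Metric.ball P (l * ε) ∩ interior K, ‖f z‖ₑ ≤
        ENNReal.ofReal (l ^ d * l ^ (-(3 / 4) : ℝ)) * C := by
  by_cases hP : P ∈ K
  · obtain ⟨C, hC, h⟩ := lintegral_enorm_scaled_le hd hΩ hf hF hK hKc hKΩ hP
    obtain ⟨ε₀, hε₀, hball⟩ := Metric.eventually_nhds_iff_ball.1 hKP
    filter_upwards [Ioo_mem_nhdsGT hε₀] with ε hε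
    refine ⟨C, hC, fun l hl hl1 => h l hl hl1 _ (Metric.isOpen_ball.inter isOpen_interior) ?_⟩
    rintro z hz
    set φ : Pt d → Pt d := fun z => P + l⁻¹ • (z - P)
    -- Conicity only gives membership in `K`; openness of the dilated set upgrades it to the
    -- interior.
    have hopen : IsOpen (φ '' (Metric.ball P (l * ε) ∩ interior K)) := by
      have : φ '' (Metric.ball P (l * ε) ∩ interior K)
          = (fun w => P + l • (w - P)) ⁻¹' (Metric.ball P (l * ε) ∩ interior K) := by
        refine congrFun (image_eq_preimage_of_inverse ?_ ?_) _
        · intro z; simp [φ, smul_smul, hl.ne']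
        · intro z; simp [φ, smul_smul, hl.ne']
      rw [this]
      exact (Metric.isOpen_ball.inter isOpen_interior).preimage (by fun_prop)
    refine interior_maximal ?_ hopen ⟨z, hz, rfl⟩
    rintro _ ⟨w, ⟨hw1, hw2⟩, rfl⟩
    refine hball _ ?_ l hl hl1 ?_
    · rw [Metric.mem_ball, dist_eq_norm] at hw1 ⊢
      simp only [φ, add_sub_cancel_left, norm_smul, Real.norm_eq_abs, abs_of_pos (inv_pos.2 hl)]
      rw [inv_mul_lt_iff₀ hl]
      nlinarith [hε.2]
    · simpa [φ, smul_smul, hl.ne'] using interior_subset hw2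
  · have hPc : Kᶜ ∈ 𝓝 P := hK.isClosed.isOpen_compl.mem_nhds hP
    obtain ⟨ε₀, hε₀, hball⟩ := Metric.mem_nhds_iff.1 hPc
    filter_upwards [Ioo_mem_nhdsGT hε₀] with ε hε
    refine ⟨0, by simp, fun l hl hl1 => ?_⟩
    have : Metric.ball P (l * ε) ∩ interior K = ∅ := by
      refine eq_empty_iff_forall_notMem.2 fun z hz => ?_
      refine hball ?_ (interior_subset hz.2)
      refine Metric.ball_subset_ball ?_ hz.1
      nlinarith [hε.1, hε.2]
    simp [this]

/-- Decay of the mass of an `H¹`-function near a point, on a finite union of convex bodies. -/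
lemma eventually_lintegral_ball_le (hd : d ≤ 3) (hΩ : IsOpen Ω) {f : Pt d → ℝ}
    {F : Fin d → Pt d → ℝ} (hf : MemLp f 2 (volume.restrict Ω))
    (hF : ∀ k, HasWeakPartial Ω k f (F k)) {ι : Type*} {S : Finset ι} {K : ι → Set (Pt d)}
    (hK : ∀ i ∈ S, IsCompact (K i)) (hKc : ∀ i ∈ S, Convex ℝ (K i))
    (hKΩ : ∀ i ∈ S, interior (K i) ⊆ Ω) (hcov : Ω ⊆ ⋃ i ∈ S, K i) {P : Pt d}
    (hKP : ∀ i ∈ S, IsConicNear (K i) P) :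
    ∀ᶠ ε in 𝓝[>] (0 : ℝ), ∃ C : ℝ≥0∞, C ≠ ⊤ ∧ ∀ l : ℝ, 0 < l → l ≤ 1 →
      ∫⁻ z in Metric.ball P (l * ε) ∩ Ω, ‖f z‖ₑ ≤
        ENNReal.ofReal (l ^ d * l ^ (-(3 / 4) : ℝ)) * C := by
  have h := (Filter.eventually_all_finset S).2 fun i hi =>
    eventually_lintegral_ball_interior_le hd hΩ hf hF (hK i hi) (hKc i hi) (hKΩ i hi) (hKP i hi)
  filter_upwards [h] with ε hε
  choose! C hC hle using hε
  refine ⟨∑ i ∈ S, C i, ENNReal.sum_ne_top.2 hC, fun l hl hl1 => ?_⟩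
  -- Frontiers of convex sets are null, so the interiors alone cover almost all of `Ω`.
  have hnull : volume (⋃ i ∈ S, frontier (K i)) = 0 :=
    (measure_biUnion_null_iff S.countable_toSet).2 fun i hi => (hKc i hi).addHaar_frontier _
  have hsub : (Metric.ball P (l * ε) ∩ Ω : Set (Pt d)) ≤ᵐ[volume]
      ⋃ i : S, Metric.ball P (l * ε) ∩ interior (K i) := by
    have : ∀ᵐ x, x ∉ ⋃ i ∈ S, frontier (K i) := measure_eq_zero_iff_ae_notMem.1 hnull
    filter_upwards [this] with x hx hxb
    obtain ⟨i, hi, hxi⟩ := mem_iUnion₂.1 (hcov hxb.2)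
    refine mem_iUnion.2 ⟨⟨i, hi⟩, hxb.1, ?_⟩
    by_contra hint
    exact hx (mem_iUnion₂.2 ⟨i, hi, subset_closure hxi, hint⟩)
  calc _ ≤ ∫⁻ z in ⋃ i : S, Metric.ball P (l * ε) ∩ interior (K i), ‖f z‖ₑ :=
        lintegral_mono_set' hsub
    _ ≤ ∑' i : S, ∫⁻ z in Metric.ball P (l * ε) ∩ interior (K i), ‖f z‖ₑ :=
        lintegral_iUnion_le _ _
    _ = ∑ i ∈ S, ∫⁻ z in Metric.ball P (l * ε) ∩ interior (K i), ‖f z‖ₑ := by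
        rw [tsum_fintype, Finset.sum_coe_sort S fun i =>
          ∫⁻ z in Metric.ball P (l * ε) ∩ interior (K i), ‖f z‖ₑ]
    _ ≤ ∑ i ∈ S, ENNReal.ofReal (l ^ d * l ^ (-(3 / 4) : ℝ)) * C i :=
        Finset.sum_le_sum fun i hi => hle i hi l hl hl1
    _ = _ := by rw [Finset.mul_sum]

/-! ### Functions with zero boundary values -/

lemma integrable_mul_testFunction {f φ : Pt d → ℝ} (hf : MemLp f 2 (volume.restrict Ω))
    (hφ : IsTestFunction Ω φ) : Integrable (fun x => f x * φ x) (volume.restrict Ω) :=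
  hf.integrable_mul
    (hφ.1.continuous.memLp_of_hasCompactSupport (p := 2) (μ := volume.restrict Ω) hφ.2.1)

/-- The function `weakPartial` is a choice; uniqueness lets the chosen derivative of `v - φ` be
replaced by the difference of the derivatives. -/
lemma HasWeakPartial.ae_eq (hΩ : IsOpen Ω) {i : Fin d} {v p q : Pt d → ℝ}
    (hp : HasWeakPartial Ω i v p) (hq : HasWeakPartial Ω i v q) :
    p =ᵐ[volume.restrict Ω] q := by
  have := hΩ.ae_eq_zero_of_integral_contDiff_smul_eq_zero (μ := volume) (f := fun x => p x - q x)
    (locallyIntegrableOn_of_locallyIntegrable_restrict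
      ((hp.1.sub hq.1).locallyIntegrable (by norm_num))) ?_
  · rw [EventuallyEq, ae_restrict_iff' hΩ.measurableSet]
    filter_upwards [this] with x hx hxΩ
    exact sub_eq_zero.1 (hx hxΩ)
  · intro φ h1 h2 h3
    have hφ : IsTestFunction Ω φ := ⟨h1, h2, h3⟩
    rw [← setIntegral_eq_integral_of_forall_compl_eq_zero (s := Ω)]
    · have e := (neg_inj.1 ((hp.2 φ hφ).symm.trans (hq.2 φ hφ)))
      rw [l2Inner, l2Inner] at e
      simp only [smul_eq_mul, mul_comm (φ _), sub_mul]
      rw [integral_sub (integrable_mul_testFunction hp.1 hφ) (integrable_mul_testFunction hq.1 hφ),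
        e, sub_self]
    · intro x hx
      rw [image_eq_zero_of_notMem_tsupport fun h => hx (h3 h), zero_smul]

lemma IsTestFunction.hasWeakPartial {φ : Pt d → ℝ} (hφ : IsTestFunction Ω φ) (i : Fin d) :
    HasWeakPartial Ω i φ (fun x => fderiv ℝ φ x (EuclideanSpace.single i 1)) := by
  have hd := hφ.partial (EuclideanSpace.single i 1)
  refine ⟨hd.1.continuous.memLp_of_hasCompactSupport hd.2.1, fun ψ hψ => ?_⟩
  have hdψ := hψ.partial (EuclideanSpace.single i 1)
  have int : ∀ {a b : Pt d → ℝ}, IsTestFunction Ω a → IsTestFunction Ω b →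
      Integrable (fun x => a x * b x) volume := fun ha hb =>
    (ha.1.continuous.mul hb.1.continuous).integrable_of_hasCompactSupport ha.2.1.mul_right
  have key := integral_mul_fderiv_eq_neg_fderiv_mul_of_integrable (μ := (volume : Measure (Pt d)))
    (int hd hψ) (int hφ hdψ) (int hφ hψ) (fun x _ => hφ.1.differentiable (by simp) x)
    (fun x _ => hψ.1.differentiable (by simp) x)
  have out : ∀ {a : Pt d → ℝ}, IsTestFunction Ω a → ∀ x ∉ Ω, a x = 0 := fun ha x hx =>
    image_eq_zero_of_notMem_tsupport fun h => hx (ha.2.2 h)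
  rw [l2Inner, l2Inner, setIntegral_eq_integral_of_forall_compl_eq_zero,
    setIntegral_eq_integral_of_forall_compl_eq_zero, key]
  · intro x hx; rw [out hψ x hx, mul_zero]
  · intro x hx; rw [out hφ x hx, zero_mul]

lemma HasWeakPartial.sub {i : Fin d} {v w p q : Pt d → ℝ} (hv : MemLp v 2 (volume.restrict Ω))
    (hw : MemLp w 2 (volume.restrict Ω)) (hp : HasWeakPartial Ω i v p)
    (hq : HasWeakPartial Ω i w q) :
    HasWeakPartial Ω i (fun x => v x - w x) (fun x => p x - q x) := by
  refine ⟨hp.1.sub hq.1, fun φ hφ => ?_⟩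
  have h1 := hp.2 φ hφ
  have h2 := hq.2 φ hφ
  have hd := hφ.partial (EuclideanSpace.single i 1)
  rw [l2Inner, l2Inner] at h1 h2 ⊢
  simp only [sub_mul]
  rw [integral_sub (integrable_mul_testFunction hv hd) (integrable_mul_testFunction hw hd),
    integral_sub (integrable_mul_testFunction hp.1 hφ) (integrable_mul_testFunction hq.1 hφ),
    h1, h2]
  ring

lemma eLpNorm_le_ofReal_of_l2Norm_le {f : Pt d → ℝ} (hf : MemLp f 2 (volume.restrict Ω)) {ε : ℝ}
    (h : l2Norm Ω f ≤ ε) : eLpNorm f 2 (volume.restrict Ω) ≤ ENNReal.ofReal ε := by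
  rw [← ENNReal.ofReal_toReal hf.2.ne]
  exact ENNReal.ofReal_le_ofReal h

/-- `H¹₀`-functions are approximated by test functions. -/
lemma MemH10.exists_testFunction (hΩ : IsOpen Ω) {v : Pt d → ℝ} (hv : MemH10 Ω v) {ε : ℝ}
    (hε : 0 < ε) : ∃ φ, IsTestFunction Ω φ ∧
      eLpNorm (fun x => v x - φ x) 2 (volume.restrict Ω) ≤ ENNReal.ofReal ε ∧
      ∀ i, eLpNorm (fun x => weakPartial Ω i v x - fderiv ℝ φ x (EuclideanSpace.single i 1)) 2
        (volume.restrict Ω) ≤ ENNReal.ofReal ε := by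
  obtain ⟨φ, hφ, h⟩ := hv.2 ε hε
  have hφL : MemLp φ 2 (volume.restrict Ω) :=
    hφ.1.continuous.memLp_of_hasCompactSupport hφ.2.1
  have hw := fun i => (weakPartial_spec (hv.1.2 i)).sub hv.1.1 hφL (hφ.hasWeakPartial i)
  -- With vanishing second-order entries the `H²` expression becomes the `H¹` norm.
  obtain ⟨k0, k1, -⟩ := le_sqrt_sum_sq (l2Norm Ω fun x => v x - φ x)
    (fun i => l2Norm Ω (weakPartial Ω i fun x => v x - φ x)) (fun _ _ => 0)
  have e : h1Norm Ω (fun x => v x - φ x) = √(l2Norm Ω (fun x => v x - φ x) ^ 2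
      + ∑ i, l2Norm Ω (weakPartial Ω i fun x => v x - φ x) ^ 2
      + ∑ i : Fin d, ∑ k ∈ Finset.univ.filter (i ≤ ·), (0 : ℝ) ^ 2) := by
    simp [h1Norm]
  rw [← e] at k0
  simp_rw [← e] at k1
  refine ⟨φ, hφ, eLpNorm_le_ofReal_of_l2Norm_le (hv.1.1.sub hφL) (k0.trans h.le), fun i => ?_⟩
  have hs := weakPartial_spec ⟨_, hw i⟩
  rw [eLpNorm_congr_ae ((hw i).ae_eq hΩ hs)]
  exact eLpNorm_le_ofReal_of_l2Norm_le hs.1 ((k1 i).trans h.le)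

/-- This is where zero boundary values enter. Test functions are smooth across the boundary after
extension by zero, so the fundamental theorem of calculus may cross it; the estimate survives the
`H¹` limit although the segments may leave `Ω`. -/
lemma MemH10.lintegral_translate_sub_le (hΩ : IsOpen Ω) {v : Pt d → ℝ} (hv : MemH10 Ω v)
    {A K : Set (Pt d)} (hA : MeasurableSet A) (hK : MeasurableSet K) (hAt : volume A ≠ ⊤)
    (hKt : volume K ≠ ⊤) {e : Pt d} (hAK : ∀ x ∈ A, ∀ s ∈ Icc (0 : ℝ) 1, x + s • e ∈ K) :
    ∫⁻ x in A, ‖Ω.indicator v (x + e) - Ω.indicator v x‖ₑ ≤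
      ENNReal.ofReal ‖e‖ * ∑ i, ∫⁻ x in K ∩ Ω, ‖weakPartial Ω i v x‖ₑ := by
  set R := ENNReal.ofReal ‖e‖ * ∑ i, ∫⁻ x in K ∩ Ω, ‖weakPartial Ω i v x‖ₑ
  set c : ℝ≥0∞ := ENNReal.ofReal ‖e‖ * ∑ _i : Fin d, volume K ^ (1 / 2 : ℝ)
    + (volume A ^ (1 / 2 : ℝ) + volume A ^ (1 / 2 : ℝ)) with hc
  have hsA : volume A ^ (1 / 2 : ℝ) ≠ ⊤ := ENNReal.rpow_ne_top_of_nonneg (by norm_num) hAt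
  have hsK : volume K ^ (1 / 2 : ℝ) ≠ ⊤ := ENNReal.rpow_ne_top_of_nonneg (by norm_num) hKt
  have hct : c ≠ ⊤ := by
    have : ∑ _i : Fin d, volume K ^ (1 / 2 : ℝ) ≠ ⊤ := ENNReal.sum_ne_top.2 fun _ _ => hsK
    finiteness
  have hvL := hv.1.1
  have hvI := memLp_indicator hΩ hvL
  have main : ∀ ε : ℝ, 0 < ε → ∫⁻ x in A, ‖Ω.indicator v (x + e) - Ω.indicator v x‖ₑ ≤
      R + c * ENNReal.ofReal ε := by
    intro ε hε
    obtain ⟨φ, hφ, h0, h1⟩ := hv.exists_testFunction hΩ hε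
    have out : ∀ {a : Pt d → ℝ}, IsTestFunction Ω a → ∀ x ∉ Ω, a x = 0 := fun ha x hx =>
      image_eq_zero_of_notMem_tsupport fun h => hx (ha.2.2 h)
    set w : Pt d → ℝ := fun x => Ω.indicator v x - φ x with hw
    have hwm : AEStronglyMeasurable w volume :=
      hvI.1.sub hφ.1.continuous.aestronglyMeasurable
    have hwn : eLpNorm w 2 volume ≤ ENNReal.ofReal ε := by
      refine le_trans (le_of_eq ?_) h0
      rw [← eLpNorm_indicator_eq_eLpNorm_restrict hΩ.measurableSet]
      congr 1
      ext x
      by_cases hx : x ∈ Ω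
      · simp [hw, hx]
      · simp [hw, hx, out hφ x hx]
    have l2 : ∀ {f : Pt d → ℝ}, AEStronglyMeasurable f volume → eLpNorm f 2 volume ≤
        ENNReal.ofReal ε → ∫⁻ x in A, ‖f x‖ₑ ≤ volume A ^ (1 / 2 : ℝ) * ENNReal.ofReal ε :=
      fun hf h => (lintegral_enorm_le_eLpNorm_two hf A).trans
        (by gcongr; exact (eLpNorm_restrict_le _ _ _ _).trans h)
    have hmp : MeasurePreserving (fun x : Pt d => x + e) volume volume :=
      measurePreserving_add_right volume e
    have hwe : AEStronglyMeasurable (fun x => w (x + e)) volume := hwm.comp_measurePreserving hmp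
    have hwen : eLpNorm (fun x => w (x + e)) 2 volume ≤ ENNReal.ofReal ε := by
      have := eLpNorm_comp_measurePreserving (p := 2) hwm hmp
      exact this.trans_le hwn
    have hφe : Measurable fun x => ‖φ (x + e) - φ x‖ₑ := by
      have := hφ.1.continuous
      exact Continuous.measurable (by fun_prop)
    calc _ ≤ ∫⁻ x in A, (‖φ (x + e) - φ x‖ₑ + (‖w (x + e)‖ₑ + ‖w x‖ₑ)) := by
          refine lintegral_mono fun x => ?_
          have eq : Ω.indicator v (x + e) - Ω.indicator v x
              = (φ (x + e) - φ x) + (w (x + e) - w x) := by simp only [hw]; ring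
          rw [eq]
          exact (enorm_add_le _ _).trans (add_le_add le_rfl enorm_sub_le)
      _ = (∫⁻ x in A, ‖φ (x + e) - φ x‖ₑ) +
            ((∫⁻ x in A, ‖w (x + e)‖ₑ) + ∫⁻ x in A, ‖w x‖ₑ) := by
          rw [lintegral_add_left hφe, lintegral_add_left' hwe.restrict.enorm]
      _ ≤ ENNReal.ofReal ‖e‖ * (∑ i, ∫⁻ x in K, ‖fderiv ℝ φ x (EuclideanSpace.single i 1)‖ₑ) +
            (volume A ^ (1 / 2 : ℝ) * ENNReal.ofReal ε +
              volume A ^ (1 / 2 : ℝ) * ENNReal.ofReal ε) := by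
          refine add_le_add ?_ (add_le_add (l2 hwe hwen) (l2 hwm hwn))
          exact TwoGrid.lintegral_translate_sub_le
            (fun i => (hφ.partial (EuclideanSpace.single i 1)).1.continuous) hA hK hAK
            fun z => ⟨fderiv ℝ φ z, (hφ.1.differentiable (by simp) z).hasFDerivAt, fun _ => rfl⟩
      _ ≤ ENNReal.ofReal ‖e‖ * ∑ i, ((∫⁻ x in K ∩ Ω, ‖weakPartial Ω i v x‖ₑ) +
              volume K ^ (1 / 2 : ℝ) * ENNReal.ofReal ε) +
            (volume A ^ (1 / 2 : ℝ) * ENNReal.ofReal ε +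
              volume A ^ (1 / 2 : ℝ) * ENNReal.ofReal ε) := by
          refine add_le_add (mul_le_mul_right (Finset.sum_le_sum fun i _ => ?_) _) le_rfl
          set ψ : Pt d → ℝ := fun x => fderiv ℝ φ x (EuclideanSpace.single i 1)
          have hψ : IsTestFunction Ω ψ := hφ.partial (EuclideanSpace.single i 1)
          have hgm := (weakPartial_spec (hv.1.2 i)).1.1
          have hrr : (volume.restrict (K ∩ Ω) : Measure (Pt d)) = (volume.restrict Ω).restrict K :=
            (Measure.restrict_restrict hK).symm
          have e1 : ∫⁻ x in K, ‖ψ x‖ₑ = ∫⁻ x in K ∩ Ω, ‖ψ x‖ₑ := by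
            rw [← lintegral_indicator hK, ← lintegral_indicator (hK.inter hΩ.measurableSet)]
            congr 1; ext x
            by_cases hxK : x ∈ K <;> by_cases hx : x ∈ Ω
            · simp [hxK, hx]
            · simp [hxK, hx, out hψ x hx]
            · simp [hxK]
            · simp [hxK]
          have hgK : AEMeasurable (fun x => ‖weakPartial Ω i v x‖ₑ)
              (volume.restrict (K ∩ Ω)) := by
            rw [hrr]; exact hgm.restrict.enorm
          have hdm : AEStronglyMeasurable (fun x => weakPartial Ω i v x - ψ x)
            (volume.restrict Ω) := hgm.sub hψ.1.continuous.aestronglyMeasurable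
          calc ∫⁻ x in K, ‖ψ x‖ₑ = ∫⁻ x in K ∩ Ω, ‖ψ x‖ₑ := e1
            _ ≤ ∫⁻ x in K ∩ Ω, (‖weakPartial Ω i v x‖ₑ + ‖weakPartial Ω i v x - ψ x‖ₑ) := by
                refine lintegral_mono fun x => ?_
                have eq : ψ x = weakPartial Ω i v x - (weakPartial Ω i v x - ψ x) := by ring
                conv_lhs => rw [eq]
                exact enorm_sub_le
            _ = _ := lintegral_add_left' hgK _
            _ ≤ _ := by
                refine add_le_add le_rfl ?_
                rw [hrr]
                refine (lintegral_enorm_le_eLpNorm_two hdm K).trans ?_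
                refine mul_le_mul' (ENNReal.rpow_le_rpow (Measure.restrict_apply_le _ _)
                  (by norm_num)) ((eLpNorm_restrict_le _ _ _ _).trans (h1 i))
      _ = R + c * ENNReal.ofReal ε := by
          rw [hc, Finset.sum_add_distrib, mul_add, add_mul, add_mul, ← Finset.sum_mul]
          ring
  have lim : Tendsto (fun n : ℕ => R + c * ENNReal.ofReal (1 / ((n : ℝ) + 1))) atTop
      (𝓝 (R + c * ENNReal.ofReal 0)) :=
    tendsto_const_nhds.add (ENNReal.Tendsto.const_mul
      (ENNReal.tendsto_ofReal tendsto_one_div_add_atTop_nhds_zero_nat) (Or.inr hct))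
  have := ge_of_tendsto lim (Eventually.of_forall fun n => main _ (by positivity))
  simpa using this

/-- The continuous representative of a function of `H² ∩ H¹₀` accumulates at `0` at every
boundary point of a convex body contained in the domain. -/
lemma exists_abs_rep_le_near_boundary (hd : d ≤ 3) (hΩ : IsOpen Ω)
    (hint : interior (closure Ω) = Ω) {v : Pt d → ℝ}
    {G : Fin d → Fin d → Pt d → ℝ} (H : HasWeakHessian Ω v (fun i => weakPartial Ω i v) G)
    (hv : MemH10 Ω v) {ι : Type*} {S : Finset ι} {K : ι → Set (Pt d)}
    (hK : ∀ i ∈ S, IsCompact (K i)) (hKc : ∀ i ∈ S, Convex ℝ (K i))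
    (hcov : ⋃ i ∈ S, K i = closure Ω) {P : Pt d} (hKP : ∀ i ∈ S, IsConicNear (K i) P)
    (hP : P ∉ Ω) {i₀ : ι} (hi₀ : i₀ ∈ S) (hne : (interior (K i₀)).Nonempty) (hPi : P ∈ K i₀)
    {δ η : ℝ} (hδ : 0 < δ) (hη : 0 < η) :
    ∃ y ∈ interior (K i₀), dist y P < η ∧ |rep Ω v y| ≤ δ := by
  have hKΩ : ∀ i ∈ S, interior (K i) ⊆ Ω := fun i hi => by
    rw [← hint]
    exact interior_mono ((subset_biUnion_of_mem (u := K) hi).trans hcov.subset)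
  have hcov' : Ω ⊆ ⋃ i ∈ S, K i := subset_closure.trans hcov.symm.subset
  by_contra! hcon
  have hcl : IsConicNear (closure Ω) P := by
    rw [← hcov]; exact IsConicNear.biUnion hKP
  obtain ⟨ε₀, hε₀, hball⟩ := Metric.eventually_nhds_iff_ball.1 hcl
  have hdec : ∀ᶠ ε in 𝓝[>] (0 : ℝ), ∀ k, ∃ C : ℝ≥0∞, C ≠ ⊤ ∧ ∀ l : ℝ, 0 < l → l ≤ 1 →
      ∫⁻ z in Metric.ball P (l * ε) ∩ Ω, ‖weakPartial Ω k v z‖ₑ ≤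
        ENNReal.ofReal (l ^ d * l ^ (-(3 / 4) : ℝ)) * C :=
    eventually_all.2 fun k => eventually_lintegral_ball_le hd hΩ (H.grad k).1 (H.hess k)
      hK hKc hKΩ hcov' hKP
  obtain ⟨ε, hε, hε0, hεlt⟩ := (hdec.and (Ioo_mem_nhdsGT hε₀)).exists
  choose C hC hCle using hε
  have hcl0 : P ∈ closure (interior (K i₀)) := by
    rw [(hKc i₀ hi₀).closure_interior_eq_closure_of_nonempty_interior hne]
    exact subset_closure hPi
  obtain ⟨b, hbI, hbP⟩ := Metric.mem_closure_iff.1 hcl0 ε hε0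
  -- Because `Ω` is the interior of its closure, a point outside `Ω` is a limit of exterior points;
  -- slits and punctures are excluded here.
  obtain ⟨x₁, hx₁, hx₁P⟩ : ∃ x₁ ∈ (closure Ω)ᶜ, dist P x₁ < ε := by
    have : P ∈ closure (closure Ω)ᶜ := by
      rw [closure_compl, hint]; exact hP
    exact Metric.mem_closure_iff.1 this ε hε0
  obtain ⟨r, hr, hr1, hr2⟩ : ∃ r > 0, Metric.ball b r ⊆ interior (K i₀) ∩ Metric.ball P ε ∧
      Metric.ball x₁ r ⊆ (closure Ω)ᶜ ∩ Metric.ball P ε := by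
    have hb : b ∈ interior (K i₀) ∩ Metric.ball P ε := ⟨hbI, Metric.mem_ball'.2 hbP⟩
    have hx : x₁ ∈ (closure Ω)ᶜ ∩ Metric.ball P ε := ⟨hx₁, Metric.mem_ball'.2 hx₁P⟩
    obtain ⟨r₁, h1, h1'⟩ := Metric.isOpen_iff.1 (isOpen_interior.inter Metric.isOpen_ball) b hb
    obtain ⟨r₂, h2, h2'⟩ := Metric.isOpen_iff.1
      (isClosed_closure.isOpen_compl.inter Metric.isOpen_ball) x₁ hx
    exact ⟨min r₁ r₂, lt_min h1 h2, (Metric.ball_subset_ball (min_le_left _ _)).trans h1',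
      (Metric.ball_subset_ball (min_le_right _ _)).trans h2'⟩
  set e := x₁ - b with he
  -- Let `A` be the ball about `b` shrunk by `l` towards `P`. On `A` the function exceeds `δ`, and
  -- the shift by `l • e` leads out of `Ω`. The powers of `l` are `l ^ d` on the left and `l · l ^ d
  -- · l ^ (-3/4)` on the right, which leaves `l ^ (1/4)`.
  have main : ∀ l : ℝ, 0 < l → l ≤ 1 → l * ε < η →
      ENNReal.ofReal δ * volume (Metric.ball b r) ≤
        ENNReal.ofReal (l ^ (1 / 4 : ℝ)) * (ENNReal.ofReal ‖e‖ * ∑ k, C k) := by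
    intro l hl hl1 hlη
    set A : Set (Pt d) := (fun z => P + l⁻¹ • (z - P)) ⁻¹' Metric.ball b r with hA
    have hAo : IsOpen A := Metric.isOpen_ball.preimage (by fun_prop)
    have hAe : A = AffineMap.homothety P l '' Metric.ball b r := by
      have : (AffineMap.homothety P l '' Metric.ball b r) =
          (fun z => P + l⁻¹ • (z - P)) ⁻¹' Metric.ball b r := by
        refine congrFun (image_eq_preimage_of_inverse ?_ ?_) _
        · intro z; simp [AffineMap.homothety_apply, smul_smul, hl.ne']
        · intro z; simp [AffineMap.homothety_apply, smul_smul, hl.ne']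
      rw [hA, this]
    have hvA : volume A = ENNReal.ofReal (l ^ d) * volume (Metric.ball b r) := by
      rw [hAe, Measure.addHaar_image_homothety, finrank_pt, abs_of_nonneg (by positivity)]
    have hback : ∀ z : Pt d, P + l • ((P + l⁻¹ • (z - P)) - P) = z := fun z => by
      simp [smul_smul, hl.ne']
    have hAI : ∀ z ∈ A, z ∈ interior (K i₀) := fun z hz => by
      have := (hKc i₀ hi₀).add_smul_sub_mem_interior hPi (hr1 hz).1 ⟨hl, hl1⟩
      rwa [hback] at this
    have hsegball : ∀ w ∈ Metric.ball P ε, P + l • (w - P) ∈ Metric.ball P (l * ε) := by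
      intro w hw
      rw [Metric.mem_ball, dist_eq_norm] at hw ⊢
      rw [add_sub_cancel_left, norm_smul, Real.norm_of_nonneg hl.le]
      gcongr
    have hshift : ∀ (z : Pt d) (s : ℝ), z + s • (l • e) =
        P + l • ((P + l⁻¹ • (z - P)) + s • e - P) := fun z s => by
      have := hback z
      rw [smul_comm s l e]
      calc z + l • s • e = (P + l • ((P + l⁻¹ • (z - P)) - P)) + l • s • e := by rw [this]
        _ = _ := by module
    have hend : ∀ w ∈ Metric.ball b r, w + e ∈ Metric.ball x₁ r := fun w hw => by
      rw [Metric.mem_ball, dist_eq_norm] at hw ⊢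
      rwa [he, show w + (x₁ - b) - x₁ = w - b by abel]
    have hAK : ∀ x ∈ A, ∀ s ∈ Icc (0 : ℝ) 1, x + s • (l • e) ∈ Metric.ball P (l * ε) := by
      intro x hx s hs
      rw [hshift]
      refine hsegball _ ?_
      have h1 := (hr1 hx).2
      have h2 := (hr2 (hend _ hx)).2
      have := (convex_ball P ε).add_smul_sub_mem h1 h2 hs
      simpa using this
    -- If the shrunken exterior point were in `Ω`, conicity of `closure Ω` near `P` would put the
    -- unshrunken one into `closure Ω`.
    have hout : ∀ x ∈ A, x + l • e ∉ Ω := by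
      intro x hx hxΩ
      have h2 := hr2 (hend _ hx)
      have h3 := hshift x 1
      simp only [one_smul] at h3
      rw [h3] at hxΩ
      refine h2.1 (hball _ ?_ l hl hl1 (subset_closure hxΩ))
      exact Metric.ball_subset_ball hεlt.le h2.2
    have T := hv.lintegral_translate_sub_le hΩ hAo.measurableSet
      (Metric.isOpen_ball (x := P) (ε := l * ε)).measurableSet
      (by rw [hvA]; exact ENNReal.mul_ne_top ENNReal.ofReal_ne_top measure_ball_lt_top.ne)
      measure_ball_lt_top.ne hAK
    have lower : ENNReal.ofReal δ * volume A ≤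
        ∫⁻ x in A, ‖Ω.indicator v (x + l • e) - Ω.indicator v x‖ₑ := by
      rw [← setLIntegral_const]
      refine lintegral_mono_ae ?_
      rw [ae_restrict_iff' hAo.measurableSet]
      filter_upwards [H.rep_ae_eq hd hΩ] with x hx hxA
      have hxI := hAI x hxA
      have hxΩ := hKΩ i₀ hi₀ hxI
      rw [indicator_of_notMem (hout x hxA), indicator_of_mem hxΩ, ← hx hxΩ, zero_sub, enorm_neg,
        Real.enorm_eq_ofReal_abs]
      refine ENNReal.ofReal_le_ofReal (hcon x hxI ?_).le
      have := hAK x hxA 0 (by simp)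
      rw [zero_smul, add_zero, Metric.mem_ball] at this
      linarith
    have T2 : ENNReal.ofReal δ * (ENNReal.ofReal (l ^ d) * volume (Metric.ball b r)) ≤
        ENNReal.ofReal (l * ‖e‖) *
          ∑ k, ENNReal.ofReal (l ^ d * l ^ (-(3 / 4) : ℝ)) * C k := by
      rw [← hvA]
      refine lower.trans (T.trans ?_)
      rw [norm_smul, Real.norm_of_nonneg hl.le]
      exact mul_le_mul_right (Finset.sum_le_sum fun k _ => hCle k l hl hl1) _
    have hld : ENNReal.ofReal (l ^ d) ≠ 0 := by simpa using pow_pos hl d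
    rw [← ENNReal.mul_le_mul_iff_right hld ENNReal.ofReal_ne_top]
    calc _ = ENNReal.ofReal δ * (ENNReal.ofReal (l ^ d) * volume (Metric.ball b r)) := by ring
      _ ≤ _ := T2
      _ = _ := by
        rw [← Finset.mul_sum, ENNReal.ofReal_mul hl.le,
          ENNReal.ofReal_mul (p := l ^ d) (by positivity)]
        have : ENNReal.ofReal (l ^ (1 / 4 : ℝ)) =
            ENNReal.ofReal l * ENNReal.ofReal (l ^ (-(3 / 4) : ℝ)) := by
          rw [← ENNReal.ofReal_mul hl.le]
          congr 1
          nth_rewrite 2 [← Real.rpow_one l]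
          rw [← Real.rpow_add hl]; norm_num
        rw [this]
        ring
  have lim : Tendsto (fun n : ℕ => ENNReal.ofReal ((1 / ((n : ℝ) + 1)) ^ (1 / 4 : ℝ)) *
      (ENNReal.ofReal ‖e‖ * ∑ k, C k)) atTop (𝓝 (ENNReal.ofReal ((0 : ℝ) ^ (1 / 4 : ℝ)) *
        (ENNReal.ofReal ‖e‖ * ∑ k, C k))) := by
    refine ENNReal.Tendsto.mul_const (ENNReal.tendsto_ofReal
      (tendsto_one_div_add_atTop_nhds_zero_nat.rpow_const (Or.inr (by norm_num)))) (Or.inr ?_)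
    exact ENNReal.mul_ne_top ENNReal.ofReal_ne_top (ENNReal.sum_ne_top.2 fun k _ => hC k)
  have hle := ge_of_tendsto lim (b := ENNReal.ofReal δ * volume (Metric.ball b r)) (by
    have ev : ∀ᶠ n : ℕ in atTop, (1 / ((n : ℝ) + 1)) < η / ε :=
      tendsto_one_div_add_atTop_nhds_zero_nat.eventually (gt_mem_nhds (by positivity))
    filter_upwards [ev] with n hn
    refine main _ (by positivity) ?_ ((lt_div_iff₀ hε0).1 hn)
    rw [div_le_one (by positivity)]
    linarith [(n.cast_nonneg : (0 : ℝ) ≤ n)])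
  rw [Real.zero_rpow (by norm_num), ENNReal.ofReal_zero, zero_mul, nonpos_iff_eq_zero,
    mul_eq_zero] at hle
  rcases hle with h | h
  · rw [ENNReal.ofReal_eq_zero] at h; linarith
  · exact (Metric.measure_ball_pos volume b hr).ne' h

end Boundary

section Elements

/-! ### Geometry of the elements -/

lemma isCompact_cell (s : Finset (Pt d)) : IsCompact (cell s) :=
  s.finite_toSet.isCompact_convexHull ℝ

lemma convex_cell (s : Finset (Pt d)) : Convex ℝ (cell s) := convex_convexHull ℝ _

lemma mem_cell {s : Finset (Pt d)} {P : Pt d} (h : P ∈ s) : P ∈ cell s :=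
  subset_convexHull ℝ _ h

/-- Both kinds of elements reproduce affine functions, so interpolation leaves the averaged Taylor
polynomial unchanged. -/
lemma affine_mem_localSpace (kind : MeshKind) (c : ℝ) (a : Fin d → ℝ) :
    (fun x : Pt d => c + ∑ k, a k * x k) ∈ kind.localSpace := by
  cases kind with
  | simplicial => exact Submodule.subset_span ⟨c, a, rfl⟩
  | rectangular =>
    have h1 : (fun _ : Pt d => (1 : ℝ)) ∈ MeshKind.rectangular.localSpace :=
      Submodule.subset_span ⟨fun _ => 1, fun _ => 0, by ext; simp⟩
    have h2 : ∀ j : Fin d, (fun x : Pt d => x j) ∈ MeshKind.rectangular.localSpace := fun j =>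
      Submodule.subset_span ⟨fun k => if k = j then 0 else 1, fun k => if k = j then 1 else 0, by
        ext x
        rw [Finset.prod_eq_single j (fun k _ hk => by simp [hk]) (by simp)]
        simp⟩
    have e : (fun x : Pt d => c + ∑ k, a k * x k)
        = c • (fun _ : Pt d => (1 : ℝ)) + ∑ k, a k • (fun x : Pt d => x k) := by
      ext x; simp
    rw [e]
    exact add_mem (Submodule.smul_mem _ _ h1)
      (Submodule.sum_mem _ fun k _ => Submodule.smul_mem _ _ (h2 k))

lemma IsBoxVertexSet.cell_subset {s : Finset (Pt d)} {a b : Pt d} (hab : ∀ i, a i < b i)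
    (hs : (s : Set (Pt d)) = {x | ∀ i, x i = a i ∨ x i = b i}) :
    cell s ⊆ {x | ∀ i, a i ≤ x i ∧ x i ≤ b i} := by
  refine convexHull_min ?_ ?_
  · rw [hs]
    intro x hx i
    rcases hx i with h | h <;> rw [h] <;> exact ⟨by linarith [hab i], by linarith [hab i]⟩
  · intro x hx y hy α β hα hβ hαβ i
    obtain ⟨h1, h2⟩ := hx i
    obtain ⟨h3, h4⟩ := hy i
    simp only [PiLp.add_apply, PiLp.smul_apply, smul_eq_mul]
    have : β = 1 - α := by linarith
    subst this
    constructor <;> nlinarith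

/-- Multilinear interpolation: the corner weights of a point of a box. -/
lemma IsBoxVertexSet.exists_weights {s : Finset (Pt d)} {a b : Pt d} (hab : ∀ i, a i < b i)
    (hs : (s : Set (Pt d)) = {x | ∀ i, x i = a i ∨ x i = b i}) {x : Pt d}
    (hx : ∀ i, a i ≤ x i ∧ x i ≤ b i) :
    ∃ w : Pt d → ℝ, (∀ P ∈ s, 0 ≤ w P) ∧ ∀ α β : Fin d → ℝ,
      ∏ k, (α k + β k * x k) = ∑ P ∈ s, w P * ∏ k, (α k + β k * P k) := by
  classical
  set t : Fin d → ℝ := fun k => (x k - a k) / (b k - a k) with ht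
  have hba : ∀ k, 0 < b k - a k := fun k => by linarith [hab k]
  have ht0 : ∀ k, 0 ≤ t k := fun k => div_nonneg (by linarith [(hx k).1]) (hba k).le
  have ht1 : ∀ k, t k ≤ 1 := fun k => by
    rw [ht, div_le_one (hba k)]; linarith [(hx k).2]
  set corner : Finset (Fin d) → Pt d := fun S =>
    WithLp.toLp 2 fun k => if k ∈ S then a k else b k with hcorner
  set W : Finset (Fin d) → ℝ := fun S => (∏ k ∈ S, (1 - t k)) * ∏ k ∈ Finset.univ \ S, t k with hW
  have hmem : ∀ S, corner S ∈ s := fun S => by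
    rw [← Finset.mem_coe, hs]
    intro i
    by_cases h : i ∈ S <;> simp [hcorner, h]
  -- The weights are collected over the fibres of `corner`, which makes its injectivity irrelevant.
  refine ⟨fun P => ∑ S ∈ Finset.univ.filter (fun S => corner S = P), W S, fun P _ =>
    Finset.sum_nonneg fun S _ => mul_nonneg (Finset.prod_nonneg fun k _ => by linarith [ht1 k])
      (Finset.prod_nonneg fun k _ => ht0 k), fun α β => ?_⟩
  have e1 : ∀ k, α k + β k * x k = (1 - t k) * (α k + β k * a k) + t k * (α k + β k * b k) := by
    intro k
    have : t k * (b k - a k) = x k - a k := div_mul_cancel₀ _ (hba k).ne'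
    linear_combination (-β k) * this
  -- Each factor is a convex combination of its two endpoint values; expanding the product indexes
  -- the terms by the set `S` of coordinates at the lower endpoint.
  have e2 : ∏ k, (α k + β k * x k) = ∑ S : Finset (Fin d), W S *
      ∏ k, (α k + β k * corner S k) := by
    simp_rw [e1]
    rw [Finset.prod_add, Finset.powerset_univ]
    refine Finset.sum_congr rfl fun S _ => ?_
    rw [Finset.prod_mul_distrib, Finset.prod_mul_distrib, hW,
      ← Finset.prod_sdiff (Finset.subset_univ S) (f := fun k => α k + β k * corner S k)]
    have p1 : ∏ k ∈ S, (α k + β k * corner S k) = ∏ k ∈ S, (α k + β k * a k) :=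
      Finset.prod_congr rfl fun k hk => by simp [hcorner, hk]
    have p2 : ∏ k ∈ Finset.univ \ S, (α k + β k * corner S k)
        = ∏ k ∈ Finset.univ \ S, (α k + β k * b k) :=
      Finset.prod_congr rfl fun k hk => by
        have : k ∉ S := by simpa using hk
        simp [hcorner, this]
    rw [p1, p2]; ring
  rw [e2, ← Finset.sum_fiberwise_of_maps_to (g := corner) (t := s) fun S _ => hmem S]
  refine Finset.sum_congr rfl fun P _ => ?_
  rw [Finset.sum_mul]
  refine Finset.sum_congr rfl fun S hS => ?_
  rw [(Finset.mem_filter.1 hS).2]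

/-- Every point of an element carries nonnegative vertex weights that reproduce the local space. -/
lemma MeshKind.IsVertexSet.exists_weights {kind : MeshKind} {s : Finset (Pt d)}
    (hs : kind.IsVertexSet s) {x : Pt d} (hx : x ∈ cell s) :
    ∃ w : Pt d → ℝ, (∀ P ∈ s, 0 ≤ w P) ∧ ∑ P ∈ s, w P = 1 ∧
      ∀ p ∈ (kind.localSpace : Submodule ℝ (Pt d → ℝ)), p x = ∑ P ∈ s, w P * p P := by
  suffices h : ∃ w : Pt d → ℝ, (∀ P ∈ s, 0 ≤ w P) ∧
      ∀ p ∈ (kind.localSpace : Submodule ℝ (Pt d → ℝ)), p x = ∑ P ∈ s, w P * p P by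
    obtain ⟨w, h0, h1⟩ := h
    refine ⟨w, h0, ?_, h1⟩
    have := h1 _ (affine_mem_localSpace kind 1 0)
    simpa using this.symm
  cases kind with
  | simplicial =>
    obtain ⟨w, h0, h1, h2⟩ := Finset.mem_convexHull.1 hx
    rw [Finset.centerMass_eq_of_sum_1 _ _ h1] at h2
    refine ⟨w, h0, fun p hp => ?_⟩
    induction hp using Submodule.span_induction with
    | mem p hp =>
      obtain ⟨c, a, rfl⟩ := hp
      have hk : ∀ k, x k = ∑ P ∈ s, w P * P k := fun k => by
        rw [← h2]; simp
      simp only [mul_add, Finset.sum_add_distrib, ← Finset.sum_mul, h1, one_mul, hk,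
        Finset.mul_sum]
      rw [Finset.sum_comm]
      congr 1
      exact Finset.sum_congr rfl fun P _ => Finset.sum_congr rfl fun k _ => by ring
    | zero => simp
    | add p q _ _ hp hq => simp only [Pi.add_apply, hp, hq, mul_add, Finset.sum_add_distrib]
    | smul c p _ hp =>
      simp only [Pi.smul_apply, smul_eq_mul, hp, Finset.mul_sum]
      exact Finset.sum_congr rfl fun P _ => by ring
  | rectangular =>
    obtain ⟨a, b, hab, hsab⟩ := hs
    obtain ⟨w, h0, h1⟩ := IsBoxVertexSet.exists_weights hab hsab
      (IsBoxVertexSet.cell_subset hab hsab hx)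
    refine ⟨w, h0, fun p hp => ?_⟩
    induction hp using Submodule.span_induction with
    | mem p hp =>
      obtain ⟨α, β, rfl⟩ := hp
      exact h1 α β
    | zero => simp
    | add p q _ _ hp hq => simp only [Pi.add_apply, hp, hq, mul_add, Finset.sum_add_distrib]
    | smul c p _ hp =>
      simp only [Pi.smul_apply, smul_eq_mul, hp, Finset.mul_sum]
      exact Finset.sum_congr rfl fun P _ => by ring

/-- A coordinate function is a product with all other factors equal to `1`. Hence the multilinear
weights also exhibit a point of the box as a convex combination of corners. -/
lemma IsBoxVertexSet.cell_eq {s : Finset (Pt d)} {a b : Pt d} (hab : ∀ i, a i < b i)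
    (hs : (s : Set (Pt d)) = {x | ∀ i, x i = a i ∨ x i = b i}) :
    cell s = {x | ∀ i, a i ≤ x i ∧ x i ≤ b i} := by
  refine (IsBoxVertexSet.cell_subset hab hs).antisymm fun x hx => ?_
  obtain ⟨w, h0, h1⟩ := IsBoxVertexSet.exists_weights hab hs hx
  have hsum : ∑ P ∈ s, w P = 1 := by simpa using (h1 (fun _ => 1) fun _ => 0).symm
  refine Finset.mem_convexHull.2 ⟨w, h0, hsum, ?_⟩
  rw [Finset.centerMass_eq_of_sum_1 _ _ hsum]
  ext j
  have := h1 (fun k => if k = j then 0 else 1) (fun k => if k = j then 1 else 0)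
  have e : ∀ y : Pt d, ∏ k, ((if k = j then (0 : ℝ) else 1) + (if k = j then 1 else 0) * y k)
      = y j := fun y => by
    rw [Finset.prod_eq_single j (fun k _ hk => by simp [hk]) (by simp)]
    simp
  simp only [e] at this
  simp [this]

lemma IsSimplexVertexSet.exists_affineBasis {s : Finset (Pt d)} (hs : IsSimplexVertexSet s) :
    ∃ b : AffineBasis s ℝ (Pt d), range b = (s : Set (Pt d)) := by
  refine ⟨⟨fun p : s => (p : Pt d), hs.1, ?_⟩, Subtype.range_coe⟩
  rw [hs.1.affineSpan_eq_top_iff_card_eq_finrank_add_one, finrank_pt, Fintype.card_coe, hs.2]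

/-- Every element is an intersection of half spaces, hence conic near every point. -/
lemma MeshKind.IsVertexSet.isConicNear {kind : MeshKind} {s : Finset (Pt d)}
    (hs : kind.IsVertexSet s) (P : Pt d) : IsConicNear (cell s) P := by
  cases kind with
  | simplicial =>
    obtain ⟨b, hr⟩ := IsSimplexVertexSet.exists_affineBasis hs
    have e : cell s = ⋂ i, {x | 0 ≤ b.coord i x} := by
      rw [cell, ← hr, b.convexHull_eq_nonneg_coord]
      ext x; simp
    rw [e]
    exact IsConicNear.iInter fun i => isConicNear_halfSpace _ P
  | rectangular =>
    obtain ⟨a, b, hab, hsab⟩ := hs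
    let coord : Fin d → (Pt d →ᵃ[ℝ] ℝ) := fun i =>
      ((EuclideanSpace.proj i : Pt d →L[ℝ] ℝ) : Pt d →ₗ[ℝ] ℝ).toAffineMap
    have e : cell s = ⋂ i : Fin d ⊕ Fin d, {x | 0 ≤ (Sum.elim
        (fun i => coord i - AffineMap.const ℝ (Pt d) (a i))
        (fun i => AffineMap.const ℝ (Pt d) (b i) - coord i) i : Pt d →ᵃ[ℝ] ℝ) x} := by
      rw [IsBoxVertexSet.cell_eq hab hsab]
      ext x
      simp [coord, forall_and]
    rw [e]
    exact IsConicNear.iInter fun i => isConicNear_halfSpace _ P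

/-- Equal cardinalities give a vertex of `s` outside `t`, and affine independence keeps it out of
the span of the others. -/
lemma IsSimplexVertexSet.affineSpan_inter_ne_top {s t : Finset (Pt d)}
    (hs : IsSimplexVertexSet s) (ht : IsSimplexVertexSet t) (hst : s ≠ t) :
    affineSpan ℝ ((s : Set (Pt d)) ∩ t) ≠ ⊤ := by
  classical
  obtain ⟨p, hp, hpt⟩ : ∃ p ∈ s, p ∉ t := by
    by_contra! h
    exact hst (Finset.eq_of_subset_of_card_le h (by rw [hs.2, ht.2]))
  intro htop
  have h1 : p ∈ affineSpan ℝ ((s : Set (Pt d)) ∩ t) := htop ▸ AffineSubspace.mem_top _ _ _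
  have h2 := hs.1.notMem_affineSpan_sdiff ⟨p, hp⟩ univ
  refine h2 (affineSpan_mono ℝ ?_ h1)
  rintro q ⟨hq, hqt⟩
  refine ⟨⟨q, hq⟩, ⟨mem_univ _, fun h => hpt ?_⟩, rfl⟩
  have : q = p := congrArg Subtype.val h
  exact this ▸ hqt

namespace Mesh

variable {Ω : Set (Pt d)} {kind : MeshKind}

/-- By conformity the intersection is the hull of the common vertices, which lies in a proper affine
subspace. For boxes, in a direction where the two intervals differ, they share at most one endpoint,
so that coordinate is constant on common corners. -/
lemma volume_cell_inter_cell (T : Mesh Ω kind) {s t : Finset (Pt d)} (hs : s ∈ T.elems)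
    (ht : t ∈ T.elems) (hst : s ≠ t) : volume (cell s ∩ cell t) = 0 := by
  classical
  rw [T.conforming s hs t ht]
  have hvs := T.isVertexSet s hs
  have hvt := T.isVertexSet t ht
  suffices h : affineSpan ℝ ((s : Set (Pt d)) ∩ t) ≠ ⊤ from
    measure_mono_null (convexHull_subset_affineSpan _) (Measure.addHaar_affineSubspace _ _ h)
  cases kind with
  | simplicial =>
    exact IsSimplexVertexSet.affineSpan_inter_ne_top hvs hvt hst
  | rectangular =>
    obtain ⟨a, b, hab, hsab⟩ := hvs
    obtain ⟨a', b', hab', hsab'⟩ := hvt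
    by_cases hall : ∀ i, a i = a' i ∧ b i = b' i
    · refine (hst ?_).elim
      rw [← Finset.coe_inj, hsab, hsab']
      ext x
      simp only [mem_ofPred_eq]
      exact forall_congr' fun i => by rw [(hall i).1, (hall i).2]
    · obtain ⟨i, hi⟩ := not_forall.1 hall
      have hconst : ∃ c : ℝ, ∀ x ∈ (s : Set (Pt d)) ∩ t, x i = c := by
        have key : ∀ x ∈ (s : Set (Pt d)) ∩ t, (x i = a i ∨ x i = b i) ∧
            (x i = a' i ∨ x i = b' i) := fun x hx => by
          rw [hsab, hsab'] at hx; exact ⟨hx.1 i, hx.2 i⟩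
        have h1 := hab i
        have h2 := hab' i
        by_cases ha : a i = a' i ∨ a i = b' i
        · refine ⟨a i, fun x hx => ?_⟩
          rcases key x hx with ⟨h3 | h3, h4⟩
          · exact h3
          · exfalso
            rcases ha with ha | ha <;> rcases h4 with h4 | h4
            · linarith
            · exact hi ⟨ha, by linarith⟩
            · linarith
            · linarith
        · refine ⟨b i, fun x hx => ?_⟩
          rcases key x hx with ⟨h3 | h3, h4⟩
          · exact (ha (by rcases h4 with h4 | h4 <;> [left; right] <;> linarith)).elim
          · exact h3
      obtain ⟨c, hc⟩ := hconst
      intro htop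
      let H : AffineSubspace ℝ (Pt d) :=
        { carrier := {x | x i = c}
          smul_vsub_vadd_mem' := by
            intro r x y z hx hy hz
            simp only [mem_ofPred_eq] at hx hy hz ⊢
            simp [hx, hy, hz] }
      have hle : affineSpan ℝ ((s : Set (Pt d)) ∩ t) ≤ H := affineSpan_le.2 fun x hx => hc x hx
      rw [htop] at hle
      have : (WithLp.toLp 2 fun _ => c + 1 : Pt d) ∈ H := hle (AffineSubspace.mem_top _ _ _)
      have h' : (c + 1 : ℝ) = c := this
      linarith

lemma norm_sub_le_size (T : Mesh Ω kind) {s : Finset (Pt d)} (hs : s ∈ T.elems) {x y : Pt d}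
    (hx : x ∈ cell s) (hy : y ∈ cell s) : ‖x - y‖ ≤ T.size := by
  rw [← dist_eq_norm]
  refine (Metric.dist_le_diam_of_mem (isCompact_cell s).isBounded hx hy).trans ?_
  exact le_ciSup (f := fun s : T.elems => Metric.diam (cell (s : Finset (Pt d))))
    (Set.finite_range _).bddAbove ⟨s, hs⟩

lemma interior_cell_subset (hint : interior (closure Ω) = Ω) (T : Mesh Ω kind)
    {s : Finset (Pt d)} (hs : s ∈ T.elems) : interior (cell s) ⊆ Ω := by
  rw [← hint, ← T.covers]
  exact interior_mono (subset_biUnion_of_mem (u := fun s => cell s) hs)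

lemma size_pos (hd : 1 ≤ d) (hne : Ω.Nonempty) (T : Mesh Ω kind) : 0 < T.size := by
  obtain ⟨x, hx⟩ := hne
  obtain ⟨s, hs, -⟩ := mem_iUnion₂.1 (T.covers.symm.subset (subset_closure hx))
  have h2 : ∃ p ∈ s, ∃ q ∈ s, p ≠ q := by
    have hv := T.isVertexSet s hs
    cases kind with
    | simplicial =>
      have : 1 < s.card := by rw [hv.2]; omega
      obtain ⟨p, hp, q, hq, h⟩ := Finset.one_lt_card.1 this
      exact ⟨p, hp, q, hq, h⟩
    | rectangular =>
      obtain ⟨a, b, hab, hsab⟩ := hv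
      refine ⟨a, ?_, b, ?_, ?_⟩
      · rw [← Finset.mem_coe, hsab]; exact fun i => Or.inl rfl
      · rw [← Finset.mem_coe, hsab]; exact fun i => Or.inr rfl
      · intro h
        have := hab ⟨0, hd⟩
        rw [h] at this
        exact lt_irrefl _ this
  obtain ⟨p, hp, q, hq, hpq⟩ := h2
  exact (norm_pos_iff.2 (sub_ne_zero.2 hpq)).trans_le
    (T.norm_sub_le_size hs (mem_cell hp) (mem_cell hq))

lemma interior_cell_nonempty (T : Mesh Ω kind) {s : Finset (Pt d)} (hs : s ∈ T.elems) :
    (interior (cell s)).Nonempty := by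
  have hv := T.isVertexSet s hs
  cases kind with
  | simplicial =>
    obtain ⟨b, hr⟩ := IsSimplexVertexSet.exists_affineBasis hv
    rw [cell, interior_convexHull_nonempty_iff_affineSpan_eq_top, ← hr]
    exact b.tot
  | rectangular =>
    obtain ⟨a, b, hab, hsab⟩ := hv
    refine ⟨WithLp.toLp 2 fun i => (a i + b i) / 2, interior_maximal (t := {x : Pt d | ∀ i,
      a i < x i ∧ x i < b i}) ?_ ?_ fun i => ?_⟩
    · rw [IsBoxVertexSet.cell_eq hab hsab]
      exact fun x hx i => ⟨(hx i).1.le, (hx i).2.le⟩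
    · simp only [ofPred_forall]
      refine isOpen_iInter_of_finite fun i => IsOpen.and ?_ ?_
      · exact isOpen_lt continuous_const (by fun_prop)
      · exact isOpen_lt (by fun_prop) continuous_const
    · have := hab i
      constructor <;> simp only <;> linarith

lemma IsHierarchy.size_le {T : ℕ → Mesh Ω kind} {ρ fl fu : ℝ} (hT : IsHierarchy T ρ fl fu)
    (hd : 1 ≤ d) (hne : Ω.Nonempty) (hfl : 0 < fl) (j : ℕ) :
    (T j).size ≤ (T (j + 1)).size / fl := by
  have h := hT.ratio_lower j
  have hpos := (T j).size_pos hd hne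
  rw [le_div_iff₀ hpos] at h
  rw [le_div_iff₀ hfl]
  linarith

end Mesh

end Elements

section FiniteElements

/-! ### Finite element functions -/

namespace Mesh

variable {Ω : Set (Pt d)} {kind : MeshKind}

lemma exists_mem_cell (T : Mesh Ω kind) {x : Pt d} (hx : x ∈ closure Ω) :
    ∃ s ∈ T.elems, x ∈ cell s := by
  obtain ⟨s, hs, h⟩ := mem_iUnion₂.1 (T.covers.symm.subset hx)
  exact ⟨s, hs, h⟩

lemma exists_weights (T : Mesh Ω kind) {s : Finset (Pt d)} (hs : s ∈ T.elems) {x : Pt d}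
    (hx : x ∈ cell s) : ∃ w : Pt d → ℝ, (∀ P ∈ s, 0 ≤ w P) ∧ ∑ P ∈ s, w P = 1 ∧
      (∀ p ∈ kind.localSpace, p x = ∑ P ∈ s, w P * p P) ∧
      ∀ u ∈ T.feSpace, u x = ∑ P ∈ s, w P * u P := by
  obtain ⟨w, h0, h1, h2⟩ := (T.isVertexSet s hs).exists_weights hx
  refine ⟨w, h0, h1, h2, fun u hu => ?_⟩
  obtain ⟨p, hp, hpu⟩ := hu.2.2 s hs
  rw [hpu hx, h2 p hp]
  exact Finset.sum_congr rfl fun P hP => by rw [hpu (mem_cell hP)]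

/-- Vertex weights express every value through nodal values, and those at vertices outside `Ω`
vanish. -/
lemma feSpace_ext (T : Mesh Ω kind) {u v : Pt d → ℝ} (hu : u ∈ T.feSpace) (hv : v ∈ T.feSpace)
    (h : ∀ Q ∈ T.interiorNodes, u Q = v Q) : u = v := by
  funext x
  by_cases hx : x ∈ Ω
  · obtain ⟨s, hs, hxs⟩ := T.exists_mem_cell (subset_closure hx)
    obtain ⟨w, -, -, -, hw⟩ := T.exists_weights hs hxs
    rw [hw u hu, hw v hv]
    refine Finset.sum_congr rfl fun Q hQ => ?_
    by_cases hQΩ : Q ∈ Ω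
    · rw [h Q ⟨hQΩ, s, hs, hQ⟩]
    · rw [hu.2.1 Q hQΩ, hv.2.1 Q hQΩ]
  · rw [hu.2.1 x hx, hv.2.1 x hx]

lemma IsNodalBasisFunction.eq {T : Mesh Ω kind} {P : Pt d} {φ ψ : Pt d → ℝ}
    (hφ : T.IsNodalBasisFunction P φ) (hψ : T.IsNodalBasisFunction P ψ) : φ = ψ := by
  refine T.feSpace_ext hφ.1 hψ.1 fun Q hQ => ?_
  by_cases h : Q = P
  · rw [h, hφ.2.2.1, hψ.2.2.1]
  · rw [hφ.2.2.2 Q hQ h, hψ.2.2.2 Q hQ h]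

lemma inactiveSpace_le (T : Mesh Ω kind) (I : Set (Pt d)) : T.inactiveSpace I ≤ T.feSpace :=
  Submodule.span_le.2 fun _ ⟨_, _, h⟩ => h.1

lemma finite_interiorNodes (T : Mesh Ω kind) : T.interiorNodes.Finite :=
  (T.elems.finite_toSet.biUnion fun s _ => s.finite_toSet).subset fun _ ⟨_, s, hs, hP⟩ =>
    mem_iUnion₂.2 ⟨s, hs, hP⟩

lemma finite_nodalBasisFunctions (T : Mesh Ω kind) (I : Set (Pt d)) :
    {φ | ∃ P ∈ I, T.IsNodalBasisFunction P φ}.Finite := by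
  refine (T.finite_interiorNodes.biUnion (t := fun P => {φ | T.IsNodalBasisFunction P φ})
    fun P _ => ?_).subset fun φ ⟨P, _, h⟩ => mem_iUnion₂.2 ⟨P, h.2.1, h⟩
  exact Set.Subsingleton.finite fun φ hφ ψ hψ => hφ.eq hψ

instance (T : Mesh Ω kind) (I : Set (Pt d)) : FiniteDimensional ℝ (T.inactiveSpace I) :=
  FiniteDimensional.span_of_finite ℝ (T.finite_nodalBasisFunctions I)

lemma isClosed_inactiveDomain (T : Mesh Ω kind) (I : Set (Pt d)) :
    IsClosed (T.inactiveDomain I) :=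
  (T.finite_nodalBasisFunctions I).isClosed_biUnion fun φ _ => isClosed_tsupport φ

lemma measurableSet_numericalBoundary (Tc Tf : Mesh Ω kind) (I : Set (Pt d)) :
    MeasurableSet (numericalBoundary Tc Tf I) := by
  refine (Tf.isClosed_inactiveDomain I).measurableSet.diff (IsClosed.measurableSet ?_)
  exact (Tc.elems.finite_toSet.subset fun s (hs : s ∈ Tc.elems ∧ _) => hs.1).isClosed_biUnion
    fun s _ => (isCompact_cell s).isClosed

lemma eq_zero_of_notMem_inactiveDomain (T : Mesh Ω kind) {I : Set (Pt d)} {u : Pt d → ℝ}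
    (hu : u ∈ T.inactiveSpace I) {x : Pt d} (hx : x ∉ T.inactiveDomain I) : u x = 0 := by
  induction hu using Submodule.span_induction with
  | mem φ h => exact image_eq_zero_of_notMem_tsupport fun h' => hx (mem_iUnion₂.2 ⟨φ, h, h'⟩)
  | zero => rfl
  | add u v _ _ h1 h2 => simp [h1, h2]
  | smul c u _ h => simp [h]

lemma inactiveDomain_coarseInactive_subset (Tc Tf : Mesh Ω kind) (I : Set (Pt d)) :
    Tc.inactiveDomain (coarseInactive Tc Tf I) ⊆ Tf.inactiveDomain I := by
  refine iUnion₂_subset fun φ ⟨P, ⟨ψ, hψ, h⟩, hφ⟩ => ?_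
  rwa [hφ.eq hψ]

/-- The nodal functions come from `hJ`, which for `coarseInactive` is part of membership. Vertices
outside `J`, boundary vertices included, receive the value zero. -/
lemma exists_interpolant (T : Mesh Ω kind) {J : Set (Pt d)}
    (hJ : ∀ P ∈ J, ∃ φ, T.IsNodalBasisFunction P φ) (g : Pt d → ℝ) :
    ∃ w ∈ T.inactiveSpace J, ∀ s ∈ T.elems, ∀ Q ∈ s, (Q ∈ J → w Q = g Q) ∧ (Q ∉ J → w Q = 0) := by
  classical
  choose! φ hφ using hJ
  have hfin : J.Finite := T.finite_interiorNodes.subset fun P hP => (hφ P hP).2.1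
  refine ⟨∑ P ∈ hfin.toFinset, g P • φ P, Submodule.sum_mem _ fun P hP =>
    Submodule.smul_mem _ _ (Submodule.subset_span ?_), fun s hs Q hQ => ?_⟩
  · have := hfin.mem_toFinset.1 hP
    exact ⟨P, this, hφ P this⟩
  have key : ∀ P ∈ hfin.toFinset, φ P Q = if P = Q then 1 else 0 := fun P hP => by
    have h := hφ P (hfin.mem_toFinset.1 hP)
    split_ifs with hPQ
    · rw [← hPQ, h.2.2.1]
    · by_cases hQΩ : Q ∈ Ω
      · exact h.2.2.2 Q ⟨hQΩ, s, hs, hQ⟩ (Ne.symm hPQ)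
      · exact h.1.2.1 Q hQΩ
  have e : (∑ P ∈ hfin.toFinset, g P • φ P) Q = if Q ∈ J then g Q else 0 := by
    rw [Finset.sum_apply, Finset.sum_congr rfl fun P hP => by
      rw [Pi.smul_apply, smul_eq_mul, key P hP, mul_ite, mul_one, mul_zero]]
    simp
  rw [e]
  exact ⟨fun h => if_pos h, fun h => if_neg h⟩

lemma memLp_of_mem_feSpace (hb : Bornology.IsBounded Ω) (T : Mesh Ω kind) {u : Pt d → ℝ}
    (hu : u ∈ T.feSpace) : MemLp u 2 (volume.restrict Ω) := by
  refine hu.1.memLp_of_hasCompactSupport ?_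
  exact HasCompactSupport.intro hb.isCompact_closure fun x hx =>
    hu.2.1 x fun h => hx (subset_closure h)

end Mesh

/-! ### The `L²`-projection -/

lemma abs_l2Inner_le {Ω : Set (Pt d)} {f g : Pt d → ℝ} (hf : MemLp f 2 (volume.restrict Ω))
    (hg : MemLp g 2 (volume.restrict Ω)) : |l2Inner Ω f g| ≤ l2Norm Ω f * l2Norm Ω g := by
  have h := eLpNorm_smul_le_mul_eLpNorm (p := 2) (q := 2) (r := 1) hg.1 hf.1
  rw [l2Inner, l2Norm, l2Norm, ← ENNReal.toReal_mul, ← Real.norm_eq_abs]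
  refine (norm_integral_le_lintegral_norm _).trans (ENNReal.toReal_mono
    (ENNReal.mul_ne_top hf.2.ne hg.2.ne) ?_)
  refine le_trans (le_of_eq ?_) h
  rw [eLpNorm_one_eq_lintegral_enorm]
  exact lintegral_congr fun x => ofReal_norm (f x * g x)

lemma l2Inner_self {Ω : Set (Pt d)} {f : Pt d → ℝ} (hf : MemLp f 2 (volume.restrict Ω)) :
    l2Inner Ω f f = l2Norm Ω f ^ 2 := by
  rw [l2Norm, ← ENNReal.toReal_pow, eLpNorm_two_sq, l2Inner,
    integral_eq_lintegral_of_nonneg_ae (Eventually.of_forall fun x => mul_self_nonneg _)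
      (hf.1.mul hf.1)]
  congr 1
  refine lintegral_congr fun x => ?_
  rw [← sq, ← enorm_pow, Real.enorm_eq_ofReal (sq_nonneg _)]

lemma l2Inner_comm (Ω : Set (Pt d)) (f g : Pt d → ℝ) : l2Inner Ω f g = l2Inner Ω g f := by
  simp only [l2Inner, mul_comm]

lemma l2Inner_add_left {Ω : Set (Pt d)} {f g w : Pt d → ℝ} (hf : MemLp f 2 (volume.restrict Ω))
    (hg : MemLp g 2 (volume.restrict Ω)) (hw : MemLp w 2 (volume.restrict Ω)) :
    l2Inner Ω (f + g) w = l2Inner Ω f w + l2Inner Ω g w := by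
  simp only [l2Inner, Pi.add_apply, add_mul]
  exact integral_add (hf.integrable_mul hw) (hg.integrable_mul hw)

lemma l2Inner_sub_left {Ω : Set (Pt d)} {f g w : Pt d → ℝ} (hf : MemLp f 2 (volume.restrict Ω))
    (hg : MemLp g 2 (volume.restrict Ω)) (hw : MemLp w 2 (volume.restrict Ω)) :
    l2Inner Ω (fun x => f x - g x) w = l2Inner Ω f w - l2Inner Ω g w := by
  simp only [l2Inner, sub_mul]
  exact integral_sub (hf.integrable_mul hw) (hg.integrable_mul hw)

lemma l2Inner_smul_left (Ω : Set (Pt d)) (c : ℝ) (f w : Pt d → ℝ) :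
    l2Inner Ω (c • f) w = c * l2Inner Ω f w := by
  simp only [l2Inner, Pi.smul_apply, smul_eq_mul, mul_assoc, integral_const_mul]

/-- The Gram form maps `V` injectively into its dual, hence onto it by finite dimension.
Definiteness is required for functions, not for classes modulo null sets, so that `p` is unique as a
function. -/
lemma existsUnique_isL2Projection {Ω : Set (Pt d)} {V : Submodule ℝ (Pt d → ℝ)}
    [FiniteDimensional ℝ V] (hV : ∀ f ∈ V, MemLp f 2 (volume.restrict Ω))
    (hdef : ∀ f ∈ V, l2Inner Ω f f = 0 → f = 0) {u : Pt d → ℝ}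
    (hu : MemLp u 2 (volume.restrict Ω)) : ∃! p, IsL2Projection Ω V u p := by
  let B : V →ₗ[ℝ] Module.Dual ℝ V := LinearMap.mk₂ ℝ (fun f g => l2Inner Ω f g)
    (fun f g w => l2Inner_add_left (hV f f.2) (hV g g.2) (hV w w.2))
    (fun c f w => l2Inner_smul_left Ω c f w)
    (fun f g w => by
      simp only [l2Inner_comm Ω f]
      exact l2Inner_add_left (hV g g.2) (hV w w.2) (hV f f.2))
    (fun c f w => by
      simp only [l2Inner_comm Ω f]
      exact l2Inner_smul_left Ω c w f)
  have hB : Function.Injective B := by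
    rw [injective_iff_map_eq_zero]
    intro f hf
    have : l2Inner Ω f f = 0 := LinearMap.congr_fun hf f
    exact Subtype.ext (hdef f f.2 this)
  have hS : Function.Surjective B :=
    (LinearMap.injective_iff_surjective_of_finrank_eq_finrank Subspace.dual_finrank_eq.symm).1 hB
  let L : Module.Dual ℝ V :=
    { toFun := fun w => l2Inner Ω u w
      map_add' := fun f g => by
        simp only [l2Inner_comm Ω u]
        exact l2Inner_add_left (hV f f.2) (hV g g.2) hu
      map_smul' := fun c f => by
        simp only [l2Inner_comm Ω u]
        exact l2Inner_smul_left Ω c f u }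
  obtain ⟨p, hp⟩ := hS L
  refine ⟨p, ⟨p.2, fun w hw => ?_⟩, fun q hq => ?_⟩
  · rw [l2Inner_sub_left hu (hV p p.2) (hV w hw), sub_eq_zero]
    exact (LinearMap.congr_fun hp ⟨w, hw⟩).symm
  · have hqp : q - p ∈ V := sub_mem hq.1 p.2
    have h1 := hq.2 _ hqp
    rw [l2Inner_sub_left hu (hV q hq.1) (hV _ hqp)] at h1
    have h2 : l2Inner Ω p (q - p) = l2Inner Ω u (q - p) := LinearMap.congr_fun hp ⟨q - p, hqp⟩
    refine sub_eq_zero.1 (hdef _ hqp ?_)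
    have := l2Inner_sub_left (hV q hq.1) (hV p p.2) (hV _ hqp)
    exact this.trans (by linarith)

lemma IsL2Projection.l2Norm_sub_le {Ω : Set (Pt d)} {V : Submodule ℝ (Pt d → ℝ)}
    (hV : ∀ f ∈ V, MemLp f 2 (volume.restrict Ω)) {u p : Pt d → ℝ}
    (hu : MemLp u 2 (volume.restrict Ω)) (hp : IsL2Projection Ω V u p) :
    l2Norm Ω (fun x => u x - p x) ≤ l2Norm Ω u := by
  have hpL := hV p hp.1
  have hup : MemLp (fun x => u x - p x) 2 (volume.restrict Ω) := hu.sub hpL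
  have h1 : l2Norm Ω (fun x => u x - p x) ^ 2
      = l2Inner Ω u (fun x => u x - p x) := by
    rw [← l2Inner_self hup, l2Inner_sub_left hu hpL hup, l2Inner_comm Ω p, hp.2 p hp.1, sub_zero]
  have h2 := (le_abs_self _).trans (abs_l2Inner_le hu hup)
  have h0 : 0 ≤ l2Norm Ω u := ENNReal.toReal_nonneg
  have h0' : 0 ≤ l2Norm Ω (fun x => u x - p x) := ENNReal.toReal_nonneg
  nlinarith

/-- Continuity on the open set `Ω` and the zero extension outside turn vanishing almost everywhere
into vanishing everywhere. -/
lemma Mesh.eq_zero_of_l2Inner_self {Ω : Set (Pt d)} {kind : MeshKind} (hΩ : IsOpen Ω)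
    (hb : Bornology.IsBounded Ω) (T : Mesh Ω kind) {f : Pt d → ℝ} (hf : f ∈ T.feSpace)
    (h : l2Inner Ω f f = 0) : f = 0 := by
  have hL := T.memLp_of_mem_feSpace hb hf
  have h1 : f =ᵐ[volume.restrict Ω] 0 := by
    rw [l2Inner_self hL, sq_eq_zero_iff, l2Norm, ENNReal.toReal_eq_zero_iff] at h
    exact (eLpNorm_eq_zero_iff hL.1 two_ne_zero).1 (h.resolve_right hL.2.ne)
  have h2 := Measure.eqOn_open_of_ae_eq h1 hΩ hf.1.continuousOn continuousOn_const
  funext x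
  by_cases hx : x ∈ Ω
  · exact h2 hx
  · exact hf.2.1 x hx

end FiniteElements

section Interpolation

/-! ### Approximation by the coarse interpolant -/

lemma abs_le_of_mem_of_interior {K : Set (Pt d)} (hKc : Convex ℝ K)
    (hne : (interior K).Nonempty) {f : Pt d → ℝ} {x : Pt d} (hf : ContinuousAt f x) (hx : x ∈ K)
    {M : ℝ} (h : ∀ y ∈ interior K, |f y| ≤ M) : |f x| ≤ M := by
  have hx' : x ∈ closure (interior K) := by
    rw [hKc.closure_interior_eq_closure_of_nonempty_interior hne]
    exact subset_closure hx
  exact closure_minimal (t := {t : ℝ | |t| ≤ M}) (by rintro _ ⟨y, hy, rfl⟩; exact h y hy)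
    (isClosed_le continuous_abs continuous_const) (mem_closure_image hf hx')

lemma setLIntegral_biUnion_finset_le {α ι : Type*} [MeasurableSpace α] {μ : Measure α}
    (S : Finset ι) (t : ι → Set α) (f : α → ℝ≥0∞) :
    ∫⁻ x in ⋃ i ∈ S, t i, f x ∂μ ≤ ∑ i ∈ S, ∫⁻ x in t i, f x ∂μ := by
  classical
  induction S using Finset.induction_on with
  | empty => simp
  | insert i S hi ih =>
    rw [Finset.set_biUnion_insert, Finset.sum_insert hi]
    exact (lintegral_union_le _ _ _).trans (by gcongr)

lemma abs_sum_weights_le {s : Finset (Pt d)} {w f : Pt d → ℝ} (h0 : ∀ P ∈ s, 0 ≤ w P)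
    (h1 : ∑ P ∈ s, w P = 1) {M : ℝ} (h : ∀ P ∈ s, |f P| ≤ M) : |∑ P ∈ s, w P * f P| ≤ M :=
  calc |∑ P ∈ s, w P * f P| ≤ ∑ P ∈ s, |w P * f P| := Finset.abs_sum_le_sum_abs _ _
    _ ≤ ∑ P ∈ s, w P * M := Finset.sum_le_sum fun P hP => by
        rw [abs_mul, abs_of_nonneg (h0 P hP)]
        exact mul_le_mul_of_nonneg_left (h P hP) (h0 P hP)
    _ = M := by rw [← Finset.sum_mul, h1, one_mul]

lemma sqrt_volume_pos {K : Set (Pt d)} (hK : IsCompact K) (hne : (interior K).Nonempty) :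
    0 < √(volume K).toReal :=
  Real.sqrt_pos.2 (ENNReal.toReal_pos (interior_pos_measure hne) hK.measure_lt_top.ne)

namespace Mesh

variable {Ω : Set (Pt d)} {kind : MeshKind}

/-- The embedding of `H²` into the bounded functions, with a constant depending on a mesh only. -/
lemma exists_abs_rep_le (hd : d ≤ 3) (hΩ : IsOpen Ω) (hint : interior (closure Ω) = Ω)
    (T : Mesh Ω kind) :
    ∃ C : ℝ, 0 ≤ C ∧ ∀ (v : Pt d → ℝ) (g : Fin d → Pt d → ℝ) (G : Fin d → Fin d → Pt d → ℝ),
      HasWeakHessian Ω v g G → ∀ N : ℝ, l2Norm Ω v ≤ N → (∀ i, l2Norm Ω (g i) ≤ N) →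
      (∀ i k, l2Norm Ω (G i k) ≤ N) → ∀ x ∈ Ω, |rep Ω v x| ≤ C * N := by
  set h := T.size
  have hh : 0 ≤ h := Real.iSup_nonneg fun _ => Metric.diam_nonneg
  let M : Finset (Pt d) → ℝ := fun s =>
    3 * (4 * h ^ 2 * (d * d) + (1 + h * d)) / √(volume (cell s)).toReal
  have hM : ∀ s, 0 ≤ M s := fun s => by positivity
  refine ⟨∑ s ∈ T.elems, M s, Finset.sum_nonneg fun s _ => hM s,
    fun v g G H N h0 h1 h2 x hx => ?_⟩
  have hN : 0 ≤ N := ENNReal.toReal_nonneg.trans h0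
  obtain ⟨s, hs, hxs⟩ := T.exists_mem_cell (subset_closure hx)
  refine abs_le_of_mem_of_interior (convex_cell s) (T.interior_cell_nonempty hs)
    ((H.continuousOn_rep hd hΩ).continuousAt (hΩ.mem_nhds hx)) hxs fun y hy => ?_
  have hV := sqrt_volume_pos (isCompact_cell s) (T.interior_cell_nonempty hs)
  have key := H.abs_rep_le hd hΩ (isCompact_cell s) (convex_cell s) (T.interior_cell_nonempty hs)
    (T.interior_cell_subset hint hs) (fun x hx y hy => T.norm_sub_le_size hs hx hy) hy
  have b1 : ∑ i, ∑ k, l2Norm Ω (G i k) ≤ d * d * N :=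
    calc ∑ i, ∑ k, l2Norm Ω (G i k) ≤ ∑ _i : Fin d, ∑ _k : Fin d, N :=
          Finset.sum_le_sum fun i _ => Finset.sum_le_sum fun k _ => h2 i k
      _ = d * d * N := by simp [mul_assoc]
  have b2 : ∑ i, l2Norm Ω (g i) ≤ d * N :=
    calc ∑ i, l2Norm Ω (g i) ≤ ∑ _i : Fin d, N := Finset.sum_le_sum fun i _ => h1 i
      _ = d * N := by simp
  have b3 : |rep Ω v y| ≤ M s * N := by
    have : M s * N = 3 * (4 * h ^ 2 * (d * d * N) + (N + h * (d * N)))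
        / √(volume (cell s)).toReal := by simp only [M]; ring
    rw [this, le_div_iff₀ hV]
    refine key.trans ?_
    gcongr
  refine b3.trans (mul_le_mul_of_nonneg_right ?_ hN)
  exact Finset.single_le_sum (f := M) (fun s _ => hM s) hs

/-- Let `q` be the affine function that is close to `rep` inside the element. The interpolant is
equally close to `q` at the vertices: by continuity at vertices in `Ω`, and at the others because
`w` is zero and `rep` accumulates at zero. Nonnegative vertex weights carry this bound to the whole
element, and the triangle inequality doubles `12` to `24`. -/
lemma abs_rep_sub_le (hd : d ≤ 3) (hΩ : IsOpen Ω) (hint : interior (closure Ω) = Ω)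
    (T : Mesh Ω kind) {v : Pt d → ℝ}
    {G : Fin d → Fin d → Pt d → ℝ} (H : HasWeakHessian Ω v (fun i => weakPartial Ω i v) G)
    (hv : MemH10 Ω v) {w : Pt d → ℝ} (hw : w ∈ T.feSpace) {s : Finset (Pt d)} (hs : s ∈ T.elems)
    (hwQ : ∀ Q ∈ s, Q ∈ Ω → w Q = rep Ω v Q) {y : Pt d} (hy : y ∈ interior (cell s)) :
    |rep Ω v y - w y| * √(volume (cell s)).toReal ≤
      24 * T.size ^ 2 * ∑ i, ∑ k, l2Norm (interior (cell s)) (G i k) := by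
  obtain ⟨c, a, hq⟩ := H.exists_affine hd hΩ (isCompact_cell s) (convex_cell s) (T.interior_cell_nonempty hs)
    (T.interior_cell_subset hint hs) fun x hx y hy => T.norm_sub_le_size hs hx hy
  set q : Pt d → ℝ := fun y => c + ∑ i, a i * y i with hqdef
  have hqc : Continuous q := by rw [hqdef]; fun_prop
  have hV := sqrt_volume_pos (isCompact_cell s) (T.interior_cell_nonempty hs)
  set V := √(volume (cell s)).toReal
  set E := ∑ i, ∑ k, l2Norm (interior (cell s)) (G i k)
  set M := 12 * T.size ^ 2 * E / V with hM
  have hq' : ∀ z ∈ interior (cell s), |rep Ω v z - q z| ≤ M := fun z hz =>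
    (le_div_iff₀ hV).2 (hq z hz)
  have hvert : ∀ Q ∈ s, |q Q - w Q| ≤ M := by
    intro Q hQ
    by_cases hQΩ : Q ∈ Ω
    · rw [hwQ Q hQ hQΩ, abs_sub_comm]
      exact abs_le_of_mem_of_interior (f := fun z => rep Ω v z - q z) (convex_cell s) (T.interior_cell_nonempty hs)
        (((H.continuousOn_rep hd hΩ).continuousAt (hΩ.mem_nhds hQΩ)).sub hqc.continuousAt)
        (mem_cell hQ) hq'
    · rw [hw.2.1 Q hQΩ, sub_zero]
      refine le_of_forall_pos_le_add fun ε hε => ?_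
      obtain ⟨η, hη, hηq⟩ := Metric.continuousAt_iff.1 (hqc.continuousAt (x := Q)) (ε / 2)
        (by positivity)
      obtain ⟨z, hz, hzQ, hzv⟩ := exists_abs_rep_le_near_boundary hd hΩ hint H hv
        -- The mesh elements themselves serve as the cover of `closure Ω` by convex bodies conic
        -- near the vertex `Q`.
        (fun i _ => isCompact_cell i) (fun i _ => convex_cell i) T.covers
        (fun i hi => (T.isVertexSet i hi).isConicNear Q) hQΩ hs (T.interior_cell_nonempty hs) (mem_cell hQ)
        (half_pos hε) hη
      have h1 := hηq hzQ
      rw [Real.dist_eq] at h1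
      have h2 := hq' z hz
      rw [abs_le] at h2 hzv ⊢
      rw [abs_lt] at h1
      constructor <;> linarith
  obtain ⟨wt, h0, h1, h2, h3⟩ := T.exists_weights hs (interior_subset hy)
  have h4 : |q y - w y| ≤ M := by
    rw [h2 q (affine_mem_localSpace kind c a), h3 w hw, ← Finset.sum_sub_distrib]
    simp only [← mul_sub]
    exact abs_sum_weights_le h0 h1 hvert
  have h5 : |rep Ω v y - w y| ≤ M + M := by
    have := hq' y hy
    rw [abs_le] at this h4 ⊢
    constructor <;> linarith
  calc |rep Ω v y - w y| * V ≤ (M + M) * V := by gcongr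
    _ = _ := by rw [hM]; field_simp; ring

lemma pairwiseDisjoint_interior_cell (T : Mesh Ω kind) :
    (T.elems : Set (Finset (Pt d))).PairwiseDisjoint fun s => interior (cell s) := by
  intro s hs t ht hst
  rw [Function.onFun, disjoint_iff_inter_eq_empty,
    ← (isOpen_interior.inter isOpen_interior).measure_eq_zero_iff volume]
  exact measure_mono_null (inter_subset_inter interior_subset interior_subset)
    (T.volume_cell_inter_cell hs ht hst)

lemma sum_l2Norm_sq_le (hint : interior (closure Ω) = Ω) (T : Mesh Ω kind) {f : Pt d → ℝ}
    (hf : MemLp f 2 (volume.restrict Ω)) :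
    ∑ s ∈ T.elems, l2Norm (interior (cell s)) f ^ 2 ≤ l2Norm Ω f ^ 2 := by
  have hle : ∀ s ∈ T.elems,
      eLpNorm f 2 (volume.restrict (interior (cell s))) ^ 2 ≠ ⊤ := fun s hs =>
    ENNReal.pow_ne_top (hf.mono_measure
      (Measure.restrict_mono (T.interior_cell_subset hint hs) le_rfl)).2.ne
  simp only [l2Norm, ← ENNReal.toReal_pow]
  rw [← ENNReal.toReal_sum hle]
  refine ENNReal.toReal_mono (ENNReal.pow_ne_top hf.2.ne) ?_
  simp only [eLpNorm_two_sq]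
  rw [← lintegral_biUnion_finset T.pairwiseDisjoint_interior_cell
    fun s _ => isOpen_interior.measurableSet]
  exact lintegral_mono_set (iUnion₂_subset fun s hs => T.interior_cell_subset hint hs)

/-- The constant is `d ^ 4 ≤ 81`: one factor `d ^ 2` comes from Cauchy-Schwarz over the Hessian
entries, the other from bounding each entry by `N`. -/
lemma sum_sq_sum_l2Norm_le (hd : d ≤ 3) (hint : interior (closure Ω) = Ω) (T : Mesh Ω kind)
    {G : Fin d → Fin d → Pt d → ℝ} (hG : ∀ i k, MemLp (G i k) 2 (volume.restrict Ω)) {N : ℝ}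
    (hN : ∀ i k, l2Norm Ω (G i k) ≤ N) :
    ∑ s ∈ T.elems, (∑ i, ∑ k, l2Norm (interior (cell s)) (G i k)) ^ 2 ≤ 81 * N ^ 2 := by
  have hd' : (d : ℝ) ≤ 3 := by exact_mod_cast hd
  have h1 : ∀ s, (∑ i, ∑ k, l2Norm (interior (cell s)) (G i k)) ^ 2 ≤
      (d * d : ℝ) * ∑ p : Fin d × Fin d, l2Norm (interior (cell s)) (G p.1 p.2) ^ 2 := fun s => by
    have := sq_sum_le_card_mul_sum_sq (s := (Finset.univ : Finset (Fin d × Fin d)))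
      (f := fun p => l2Norm (interior (cell s)) (G p.1 p.2))
    simpa [Fintype.sum_prod_type] using this
  calc ∑ s ∈ T.elems, (∑ i, ∑ k, l2Norm (interior (cell s)) (G i k)) ^ 2
      ≤ ∑ s ∈ T.elems,
        (d * d : ℝ) * ∑ p : Fin d × Fin d, l2Norm (interior (cell s)) (G p.1 p.2) ^ 2 :=
        Finset.sum_le_sum fun s _ => h1 s
    _ = (d * d : ℝ) *
        ∑ p : Fin d × Fin d, ∑ s ∈ T.elems, l2Norm (interior (cell s)) (G p.1 p.2) ^ 2 := by
        rw [← Finset.mul_sum, Finset.sum_comm]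
    _ ≤ (d * d : ℝ) * ∑ _p : Fin d × Fin d, N ^ 2 := by
        gcongr with p
        refine (T.sum_l2Norm_sq_le hint (hG p.1 p.2)).trans ?_
        exact pow_le_pow_left₀ ENNReal.toReal_nonneg (hN p.1 p.2) 2
    _ = (d * d : ℝ) * (d * d) * N ^ 2 := by simp [mul_assoc]
    _ ≤ (3 * 3) * (3 * 3) * N ^ 2 := by gcongr
    _ = 81 * N ^ 2 := by norm_num

lemma inactiveDomain_subset (T : Mesh Ω kind) (I : Set (Pt d)) :
    T.inactiveDomain I ⊆ closure Ω :=
  iUnion₂_subset fun φ ⟨P, _, hφ⟩ => closure_mono fun x hx => by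
    by_contra h
    exact hx (hφ.1.2.1 x h)

/-- The factor `√|cell s|` in the pointwise bound cancels the volume of the element exactly, and its
frontier is null. -/
lemma setLIntegral_cell_le {s : Finset (Pt d)} (hne : (interior (cell s)).Nonempty)
    {f : Pt d → ℝ} {R : ℝ} (hf : ∀ y ∈ interior (cell s), |f y| * √(volume (cell s)).toReal ≤ R) :
    ∫⁻ x in cell s, ‖f x‖ₑ ^ 2 ≤ ENNReal.ofReal (R ^ 2) := by
  have hV := sqrt_volume_pos (isCompact_cell s) hne
  have hvol : ENNReal.ofReal (√(volume (cell s)).toReal ^ 2) = volume (cell s) := by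
    rw [Real.sq_sqrt ENNReal.toReal_nonneg,
      ENNReal.ofReal_toReal (isCompact_cell s).measure_lt_top.ne]
  set V := √(volume (cell s)).toReal
  calc ∫⁻ x in cell s, ‖f x‖ₑ ^ 2 = ∫⁻ x in interior (cell s), ‖f x‖ₑ ^ 2 :=
        setLIntegral_congr
          (interior_ae_eq_of_null_frontier ((convex_cell s).addHaar_frontier volume)).symm
    _ ≤ ∫⁻ _ in interior (cell s), ENNReal.ofReal ((R / V) ^ 2) := by
        refine setLIntegral_mono' isOpen_interior.measurableSet fun x hx => ?_
        rw [← enorm_pow, Real.enorm_eq_ofReal (sq_nonneg _), ← sq_abs]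
        exact ENNReal.ofReal_le_ofReal
          (pow_le_pow_left₀ (abs_nonneg _) ((le_div_iff₀ hV).2 (hf x hx)) 2)
    _ ≤ ENNReal.ofReal ((R / V) ^ 2) * volume (cell s) := by
        rw [setLIntegral_const]; gcongr; exact interior_subset
    _ = ENNReal.ofReal (R ^ 2) := by
        rw [← hvol, ← ENNReal.ofReal_mul (sq_nonneg _)]
        congr 1; field_simp

/-- The numerical interior contributes the sum of the element errors, with `216 = 24 · √81`. On the
numerical boundary both `rep` and `w` are bounded by `M`. -/
lemma l2Norm_indicator_rep_sub_le (hd : d ≤ 3) (hΩ : IsOpen Ω)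
    (hint : interior (closure Ω) = Ω) (hb : Bornology.IsBounded Ω) (Tc Tf : Mesh Ω kind)
    (I : Set (Pt d)) {v : Pt d → ℝ}
    {G : Fin d → Fin d → Pt d → ℝ} (H : HasWeakHessian Ω v (fun i => weakPartial Ω i v) G)
    (hv : MemH10 Ω v) {N M : ℝ} (hN0 : 0 ≤ N) (hM0 : 0 ≤ M) (hN : ∀ i k, l2Norm Ω (G i k) ≤ N)
    (hM : ∀ x ∈ Ω, |rep Ω v x| ≤ M) {w : Pt d → ℝ} (hw : w ∈ Tc.feSpace)
    (hwQ : ∀ s ∈ Tc.elems, ∀ Q ∈ s, (Q ∈ coarseInactive Tc Tf I → w Q = rep Ω v Q) ∧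
      (Q ∉ coarseInactive Tc Tf I → w Q = 0)) :
    l2Norm Ω ((Tf.inactiveDomain I).indicator fun x => rep Ω v x - w x) ≤
      216 * Tc.size ^ 2 * N + 2 * M * √(volume (numericalBoundary Tc Tf I)).toReal := by
  classical
  set D := Tf.inactiveDomain I with hD
  set B := numericalBoundary Tc Tf I with hB
  set e : Pt d → ℝ := fun x => rep Ω v x - w x with he
  have hBm : MeasurableSet B := measurableSet_numericalBoundary Tc Tf I
  have hBt : volume B ≠ ⊤ := ((measure_mono (sdiff_subset.trans
    (Tf.inactiveDomain_subset I))).trans_lt hb.isCompact_closure.measure_lt_top).ne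
  let S := Tc.elems.filter fun s => cell s ⊆ Tf.inactiveDomain I ∧
    ∀ P ∈ s, P ∈ coarseInactive Tc Tf I ∨ P ∈ frontier Ω
  let E : Finset (Pt d) → ℝ := fun s => ∑ i, ∑ k, l2Norm (interior (cell s)) (G i k)
  have hcov : D ∩ Ω ⊆ (⋃ s ∈ S, cell s) ∪ (B ∩ Ω) := by
    rintro x ⟨hxD, hxΩ⟩
    by_cases hx : x ∈ numericalInterior Tc Tf I
    · obtain ⟨s, hs, hxs⟩ := mem_iUnion₂.1 hx
      exact Or.inl (mem_iUnion₂.2 ⟨s, Finset.mem_filter.2 hs, hxs⟩)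
    · exact Or.inr ⟨⟨hxD, hx⟩, hxΩ⟩
  have hcell : ∀ s ∈ S, ∫⁻ x in cell s, ‖e x‖ₑ ^ 2 ≤
      ENNReal.ofReal ((24 * Tc.size ^ 2 * E s) ^ 2) := fun s hs => by
    obtain ⟨hs, -, hsP⟩ := Finset.mem_filter.1 hs
    refine setLIntegral_cell_le (Tc.interior_cell_nonempty hs) fun y hy =>
      Tc.abs_rep_sub_le hd hΩ hint H hv hw hs (fun Q hQ hQΩ => (hwQ s hs Q hQ).1 ?_) hy
    -- A vertex in the open set `Ω` is not on its frontier, so it must be an inactive node, where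
    -- `w` interpolates.
    refine (hsP Q hQ).resolve_right fun h => ?_
    rw [frontier, hΩ.interior_eq] at h
    exact h.2 hQΩ
  -- Interpolation with zeros at some vertices does not increase the maximum, since the vertex
  -- weights are nonnegative and sum to one.
  have hwM : ∀ x ∈ Ω, |w x| ≤ M := fun x hx => by
    obtain ⟨s, hs, hxs⟩ := Tc.exists_mem_cell (subset_closure hx)
    obtain ⟨wt, h0, h1, -, h3⟩ := Tc.exists_weights hs hxs
    rw [h3 w hw]
    refine abs_sum_weights_le h0 h1 fun Q hQ => ?_
    by_cases hQJ : Q ∈ coarseInactive Tc Tf I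
    · rw [(hwQ s hs Q hQ).1 hQJ]
      obtain ⟨φ, hφ, -⟩ := hQJ
      exact hM Q hφ.2.1.1
    · rw [(hwQ s hs Q hQ).2 hQJ, abs_zero]
      exact hM0
  have hbd : ∫⁻ x in B ∩ Ω, ‖e x‖ₑ ^ 2 ≤ ENNReal.ofReal ((2 * M) ^ 2 * (volume B).toReal) :=
    calc ∫⁻ x in B ∩ Ω, ‖e x‖ₑ ^ 2 ≤ ∫⁻ _ in B ∩ Ω, ENNReal.ofReal ((2 * M) ^ 2) := by
          refine setLIntegral_mono' (hBm.inter hΩ.measurableSet) fun x hx => ?_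
          rw [← enorm_pow, Real.enorm_eq_ofReal (sq_nonneg _), ← sq_abs]
          refine ENNReal.ofReal_le_ofReal (pow_le_pow_left₀ (abs_nonneg _) ?_ 2)
          have := abs_sub (rep Ω v x) (w x)
          linarith [hM x hx.2, hwM x hx.2]
      _ ≤ ENNReal.ofReal ((2 * M) ^ 2) * volume B := by
          rw [setLIntegral_const]; gcongr; exact inter_subset_left
      _ = _ := by rw [ENNReal.ofReal_mul (sq_nonneg _), ENNReal.ofReal_toReal hBt]
  have hsum : ∑ s ∈ S, (24 * Tc.size ^ 2 * E s) ^ 2 ≤ (216 * Tc.size ^ 2 * N) ^ 2 := by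
    have h1 := Tc.sum_sq_sum_l2Norm_le hd hint (fun i k => (H.hess i k).1) hN
    have h2 : ∑ s ∈ S, E s ^ 2 ≤ ∑ s ∈ Tc.elems, E s ^ 2 :=
      Finset.sum_le_sum_of_subset_of_nonneg (Finset.filter_subset _ _) fun s _ _ => sq_nonneg _
    calc ∑ s ∈ S, (24 * Tc.size ^ 2 * E s) ^ 2 = (24 * Tc.size ^ 2) ^ 2 * ∑ s ∈ S, E s ^ 2 := by
          rw [Finset.mul_sum]; exact Finset.sum_congr rfl fun s _ => mul_pow _ _ _
      _ ≤ (24 * Tc.size ^ 2) ^ 2 * (81 * N ^ 2) := by gcongr; exact h2.trans h1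
      _ = _ := by ring
  have htot : eLpNorm (D.indicator e) 2 (volume.restrict Ω) ^ 2 ≤ ENNReal.ofReal
      ((216 * Tc.size ^ 2 * N) ^ 2 + (2 * M) ^ 2 * (volume B).toReal) := by
    rw [eLpNorm_two_sq]
    have e1 : ∀ x, ‖D.indicator e x‖ₑ ^ 2 = D.indicator (fun x => ‖e x‖ₑ ^ 2) x := fun x => by
      by_cases hx : x ∈ D <;> simp [hx]
    simp only [e1]
    rw [lintegral_indicator (Tf.isClosed_inactiveDomain I).measurableSet,
      Measure.restrict_restrict (Tf.isClosed_inactiveDomain I).measurableSet]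
    refine (lintegral_mono_set hcov).trans ((lintegral_union_le _ _ _).trans ?_)
    rw [ENNReal.ofReal_add (by positivity) (by positivity)]
    refine add_le_add ?_ hbd
    refine (setLIntegral_biUnion_finset_le S _ _).trans ((Finset.sum_le_sum hcell).trans ?_)
    rw [← ENNReal.ofReal_sum_of_nonneg fun s _ => sq_nonneg _]
    exact ENNReal.ofReal_le_ofReal hsum
  have hsq : l2Norm Ω (D.indicator e) ^ 2 ≤
      (216 * Tc.size ^ 2 * N) ^ 2 + (2 * M) ^ 2 * (volume B).toReal := by
    rw [l2Norm, ← ENNReal.toReal_pow]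
    exact ENNReal.toReal_le_of_le_ofReal (by positivity) htot
  -- The bound `a² + b² ≤ (a + b)²` for nonnegative numbers separates the two contributions.
  refine le_of_sq_le_sq ?_ (by positivity)
  have hμ := Real.sq_sqrt (ENNReal.toReal_nonneg (a := volume B))
  have hμ0 := Real.sqrt_nonneg (volume B).toReal
  have : 0 ≤ (216 * Tc.size ^ 2 * N) * (2 * M * √(volume B).toReal) := by positivity
  nlinarith

end Mesh

end Interpolation

/-! ### The duality argument for the negative norm -/

section NegativeNorm

/-- The residual vanishes off `D`, so the approximation error matters only there; this lets `w` be a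
poor approximation outside the inactive domain. -/
lemma l2Inner_congr_of_eqOn {Ω : Set (Pt d)} (hΩ : MeasurableSet Ω) {r v v' w : Pt d → ℝ}
    {D : Set (Pt d)} (hr : ∀ x, x ∉ D → r x = 0) (hv : ∀ᵐ x, x ∈ Ω → v' x = v x) :
    l2Inner Ω r (fun x => v x - w x) = l2Inner Ω r (D.indicator fun x => v' x - w x) := by
  refine integral_congr_ae ?_
  rw [EventuallyEq, ae_restrict_iff' hΩ]
  filter_upwards [hv] with x hx hxΩ
  by_cases hxD : x ∈ D
  · rw [indicator_of_mem hxD, hx hxΩ]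
  · rw [hr x hxD, zero_mul, zero_mul]

namespace Mesh

variable {Ω : Set (Pt d)} {kind : MeshKind}

/-- The embedding constant `C` is a parameter, so that it can be taken from a mesh other than `Tc`
and `Tf`. -/
lemma hNegTwoNorm_sub_le (hd : d ≤ 3) (hΩ : IsPolyhedralDomain Ω) (Tc Tf : Mesh Ω kind)
    (I : Set (Pt d)) {C : ℝ} (hC : 0 ≤ C)
    (hrep : ∀ (v : Pt d → ℝ) (g : Fin d → Pt d → ℝ) (G : Fin d → Fin d → Pt d → ℝ),
      HasWeakHessian Ω v g G → ∀ N : ℝ, l2Norm Ω v ≤ N → (∀ i, l2Norm Ω (g i) ≤ N) →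
      (∀ i k, l2Norm Ω (G i k) ≤ N) → ∀ x ∈ Ω, |rep Ω v x| ≤ C * N)
    {u p : Pt d → ℝ} (hu : u ∈ Tf.inactiveSpace I)
    (hp : IsL2Projection Ω (Tc.inactiveSpace (coarseInactive Tc Tf I)) u p) :
    hNegTwoNorm Ω (fun x => u x - p x) ≤ ENNReal.ofReal
      ((216 * Tc.size ^ 2 + 2 * C * √(volume (numericalBoundary Tc Tf I)).toReal) *
        l2Norm Ω u) := by
  set μ := √(volume (numericalBoundary Tc Tf I)).toReal with hμ
  have hopen := hΩ.isOpen
  have hb := hΩ.isBounded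
  have hV : ∀ f ∈ Tc.inactiveSpace (coarseInactive Tc Tf I), MemLp f 2 (volume.restrict Ω) :=
    fun f hf => Tc.memLp_of_mem_feSpace hb (Tc.inactiveSpace_le _ hf)
  have huL := Tf.memLp_of_mem_feSpace hb (Tf.inactiveSpace_le _ hu)
  have hrL : MemLp (fun x => u x - p x) 2 (volume.restrict Ω) := huL.sub (hV p hp.1)
  have hr0 : ∀ x, x ∉ Tf.inactiveDomain I → u x - p x = 0 := fun x hx => by
    rw [Tf.eq_zero_of_notMem_inactiveDomain hu hx, Tc.eq_zero_of_notMem_inactiveDomain hp.1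
      fun h => hx (inactiveDomain_coarseInactive_subset Tc Tf I h), sub_zero]
  refine iSup₂_le fun v ⟨hv2, hv1⟩ => ENNReal.ofReal_le_ofReal ?_
  obtain ⟨G, H, n0, n1, n2⟩ := hv2.exists_hasWeakHessian
  set N := h2Norm Ω v
  have hN : 0 ≤ N := ENNReal.toReal_nonneg.trans n0
  have hu0 : 0 ≤ l2Norm Ω u := ENNReal.toReal_nonneg
  obtain ⟨w, hw, hwQ⟩ := Tc.exists_interpolant (J := coarseInactive Tc Tf I)
    (fun P ⟨φ, hφ, _⟩ => ⟨φ, hφ⟩) (rep Ω v)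
  have hbound := l2Norm_indicator_rep_sub_le hd hopen hΩ.interior_closure hb Tc Tf I H hv1 hN
    (mul_nonneg hC hN) n2 (hrep v _ G H N n0 n1 n2) (Tc.inactiveSpace_le _ hw) hwQ
  have hae := H.rep_ae_eq hd hopen
  have hdL : MemLp ((Tf.inactiveDomain I).indicator fun x => rep Ω v x - w x) 2
      (volume.restrict Ω) := by
    refine MemLp.indicator (Tf.isClosed_inactiveDomain I).measurableSet
      ((H.memLp.sub (hV w hw)).ae_eq ?_)
    rw [EventuallyEq, ae_restrict_iff' hopen.measurableSet]
    filter_upwards [hae] with x hx hxΩ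
    rw [Pi.sub_apply, hx hxΩ]
  have hkey : l2Inner Ω (fun x => u x - p x) v ≤
      ((216 * Tc.size ^ 2 + 2 * C * μ) * l2Norm Ω u) * N :=
    calc l2Inner Ω (fun x => u x - p x) v
        = l2Inner Ω (fun x => u x - p x) (fun x => v x - w x) := by
          rw [l2Inner_comm, l2Inner_comm Ω _ (fun x => v x - w x),
            l2Inner_sub_left H.memLp (hV w hw) hrL, l2Inner_comm Ω w, hp.2 w hw, sub_zero]
      _ = l2Inner Ω (fun x => u x - p x)
            ((Tf.inactiveDomain I).indicator fun x => rep Ω v x - w x) :=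
          l2Inner_congr_of_eqOn hopen.measurableSet hr0 hae
      _ ≤ l2Norm Ω (fun x => u x - p x) *
            l2Norm Ω ((Tf.inactiveDomain I).indicator fun x => rep Ω v x - w x) :=
          (le_abs_self _).trans (abs_l2Inner_le hrL hdL)
      _ ≤ l2Norm Ω u * (216 * Tc.size ^ 2 * N + 2 * (C * N) * μ) :=
          mul_le_mul (hp.l2Norm_sub_le hV huL) hbound ENNReal.toReal_nonneg hu0
      _ = _ := by ring
  -- This form of division also covers `h2Norm Ω v = 0`, where the quotient is zero by convention.
  exact div_le_of_le_mul₀ hN (by positivity) hkey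

end Mesh

end NegativeNorm

end TwoGrid

end

/-! ### The final estimate -/

theorem lemma3p3 (d : ℕ) (hd1 : 1 ≤ d) (hd3 : d ≤ 3)
    (Ω : Set (TwoGrid.Pt d)) (hΩ : TwoGrid.IsPolyhedralDomain Ω)
    (kind : TwoGrid.MeshKind) (T₀ : TwoGrid.Mesh Ω kind)
    (ρ fl fu : ℝ) (hρ : 0 < ρ) (hfl : 0 < fl) (hflu : fl ≤ fu) (hfu : fu < 1) :
    ∃ C : ℝ, 0 < C ∧
      ∀ T : ℕ → TwoGrid.Mesh Ω kind, T 0 = T₀ → TwoGrid.Mesh.IsHierarchy T ρ fl fu →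
      ∀ j : ℕ, 1 ≤ j →
      ∀ I : Set (TwoGrid.Pt d), I ⊆ (T j).interiorNodes →
      ∀ u ∈ (T j).inactiveSpace I,
        (∃! p, TwoGrid.IsL2Projection Ω
          ((T (j - 1)).inactiveSpace (TwoGrid.Mesh.coarseInactive (T (j - 1)) (T j) I)) u p) ∧
        ∀ p, TwoGrid.IsL2Projection Ω
            ((T (j - 1)).inactiveSpace (TwoGrid.Mesh.coarseInactive (T (j - 1)) (T j) I)) u p →
          TwoGrid.hNegTwoNorm Ω (fun x => u x - p x) ≤
            ENNReal.ofReal (C *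
              ((T j).size ^ 2 +
                √(volume (TwoGrid.Mesh.numericalBoundary (T (j - 1)) (T j) I)).toReal) *
              TwoGrid.l2Norm Ω u) := by
  have hne := hΩ.isConnected.nonempty
  -- The embedding constant is fixed on the base mesh before any hierarchy is chosen, so it is
  -- independent of `j` and of the other meshes.
  obtain ⟨C, hC, hrep⟩ := T₀.exists_abs_rep_le hd3 hΩ.isOpen hΩ.interior_closure
  -- The term `216 / fl ^ 2` is the interpolation constant after replacing `h_{j-1}` by `h_j / fl`,
  -- `2 * C` belongs to the numerical boundary, and `1` secures positivity.
  refine ⟨216 / fl ^ 2 + 2 * C + 1, by positivity, fun T _ hT j hj I _ u hu => ?_⟩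
  have huL := (T j).memLp_of_mem_feSpace hΩ.isBounded ((T j).inactiveSpace_le I hu)
  refine ⟨TwoGrid.existsUnique_isL2Projection
    (fun f hf => (T (j - 1)).memLp_of_mem_feSpace hΩ.isBounded ((T (j - 1)).inactiveSpace_le _ hf))
    (fun f hf => (T (j - 1)).eq_zero_of_l2Inner_self hΩ.isOpen hΩ.isBounded
      ((T (j - 1)).inactiveSpace_le _ hf)) huL, fun p hp => ?_⟩
  refine (TwoGrid.Mesh.hNegTwoNorm_sub_le hd3 hΩ (T (j - 1)) (T j) I hC hrep hu
    hp).trans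
    (ENNReal.ofReal_le_ofReal ?_)
  have hsize : (T (j - 1)).size ^ 2 ≤ (T j).size ^ 2 / fl ^ 2 := by
    have h := hT.size_le hd1 hne hfl (j - 1)
    rw [Nat.sub_add_cancel hj] at h
    rw [← div_pow]
    exact pow_le_pow_left₀ ((T (j - 1)).size_pos hd1 hne).le h 2
  set μ := √(volume (TwoGrid.Mesh.numericalBoundary (T (j - 1)) (T j) I)).toReal
  have hμ : 0 ≤ μ := Real.sqrt_nonneg _
  refine mul_le_mul_of_nonneg_right ?_ ENNReal.toReal_nonneg
  calc 216 * (T (j - 1)).size ^ 2 + 2 * C * μ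
      ≤ 216 * ((T j).size ^ 2 / fl ^ 2) + 2 * C * μ := by gcongr
    _ = 216 / fl ^ 2 * (T j).size ^ 2 + 2 * C * μ := by ring
    _ ≤ (216 / fl ^ 2 + 2 * C + 1) * (T j).size ^ 2 + (216 / fl ^ 2 + 2 * C + 1) * μ := by
        gcongr
        · linarith
        · have : 0 ≤ 216 / fl ^ 2 := by positivity
          linarith
    _ = (216 / fl ^ 2 + 2 * C + 1) * ((T j).size ^ 2 + μ) := by ring
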